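/- **Setting.** Let $F$ be a dyadic local field of characteristic $0$ (complete with respect to a discrete valuation, with finite residue field of characteristic $2$), with ring of integers $\mathcal O$, prime ideal $\mathfrak p=\pi\mathcal O$, normalized valuation $\mathrm{ord}:F\to\mathbb Z\cup\{\infty\}$, $\dot F=F\setminus\{0\}$, and $e=\mathrm{ord}\,2$. Let $(\cdot,\cdot)_{\mathfrak p}$ be the Hilbert symbol, $\mathfrak d(a)=\bigcap_{x\in F}(a-x^2)\mathcal O$ the quadratic defect and $d(a)=\mathrm{ord}\,a^{-1}\mathfrak d(a)$ for $a\in\dot F$. Let $\Delta=1-4\rho$, with $\rho\in\mathcal O^\times$, be a unit with $\mathfrak d(\Delta)=4\mathcal O$. Let $L$ be a (nondegenerate) quadratic lattice over $\mathcal O$ with quadratic form $Q$, $V=FL$. Its norm $\mathfrak nL$ is the fractional ideal generated by $Q(L)$, and $x\in L$ is a norm generator if $Q(x)\mathcal O=\mathfrak nL$. A basis of norm generators (BONG) of $L$ is defined recursively as a sequence $x_1,\ldots,x_n$ such that $x_1$ is a norm generator of $L$, $Q(x_1)\ne0$, and $x_2,\ldots,x_n$ is a BONG of the orthogonal projection of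 $L$ on $x_1^\perp$ (the empty sequence being the BONG of $0$). The BONG is good if $\mathrm{ord}\,Q(x_i)\le\mathrm{ord}\,Q(x_{i+2})$ for $1\le i\le n-2$. We write $L\cong\prec a_1,\ldots,a_n\succ$ if $L$ has a BONG $x_1,\ldots,x_n$ with $Q(x_i)=a_i$. In the statement below all such descriptions of $L$ and $L'$ are relative to good BONGs. Let $L\cong\prec a_1,\ldots,a_n\succ$ relative to a good BONG, and let $R_i=\mathrm{ord}\,a_i$. $L$ has property A if $R_i<R_{i+2}$ for $1\le i\le n-2$. It has property B if it has property A and, for every $1\le i\le n-1$ such that either $R_{i+1}-R_i$ is odd and $\le 2e+1$, or $R_{i+1}-R_i$ is even and $d(-a_ia_{i+1})\le e-(R_{i+1}-R_i)/2$, we have $R_i-R_{i-1}>2e$ (if $i\ge2$) and $R_{i+2}-R_{i+1}>2e$ (if $i\le n-2$). Let $O^+(L)=\{\sigma\in O^+(V)\mid\sigma(L)=L\}$ and let $\theta$ be the spinor norm; $\theta(O^+(L))$ is regarded as a subgroup of $\dot F$ containing $\dot F^2$. A lattice $J$ is called maximal if there is no lattice $M\supsetneq J$ with $FM=FJ$ and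 $\mathfrak nM\subseteq\mathfrak nJ$. Finally, let $$L'=\{x\in L\mid x\text{ is not a norm generator of }L\}.$$ **Lemma.** Assume that $L$ has property B or $\theta(O^+(L))=\mathcal O^\times\dot F^2$. If $n\ge2$ and $R_2-R_1=-2e$, then: (i) If $a_1a_2\in-\Delta\dot F^2$ and $R_1<R_3$ (or $n=2$), then $L'$ is a lattice and $L'\cong\prec\pi^2a_1,\pi^2a_2,a_3,\ldots,a_n\succ$. (ii) If $a_1a_2\in-\dot F^2$, or $n\ge3$ and $R_1=R_3$, then $L'$ is not a lattice (it is not even an $\mathcal O$-module). If $n=1$, or $n\ge2$ and $R_2-R_1>-2e$, then: (iii) If $n=1$, or if $\prec a_1,a_2\succ$ is not maximal and $R_1<R_3$ (or $n=2$), then $L'$ is a lattice and $L'\cong\prec\pi^2a_1,a_2,a_3,\ldots,a_n\succ$. (iv) If $n\ge 2$ and $\prec a_1,a_2\succ$ is maximal, then there is $\eta\in\mathcal O^\times$ such that $(\pi\eta,-a_1a_2)_{\mathfrak p}=1$, and for every such $\eta$, $L'$ is a lattice and $L'\cong\prec\pi\eta a_1,\pi\eta a_2,a_3,\ldots,a_n\succ$.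 (v) If $n\ge3$, $R_1=R_3$, and $1\le k\le\frac{n-1}2$ is maximal with the property that $R_1=R_{2k+1}$, then $a_1a_2\cdots a_{2k+1}\in(-1)^k\varepsilon\pi^{R_1}\dot F^2$ for some $\varepsilon\in\mathcal O^\times$, and for every such $\varepsilon$ we have $$L\cong\prec\pi^{R_1}\varepsilon,-\pi^{R_2}\varepsilon,\pi^{R_3}\varepsilon,\ldots,-\pi^{R_{2k}}\varepsilon,\pi^{R_{2k+1}}\varepsilon,a_{2k+2},\ldots,a_n\succ,$$ and $L'$ is a lattice with $$L'\cong\prec\pi^{R_1+2}\varepsilon,-\pi^{R_2-2}\varepsilon,\pi^{R_3+2}\varepsilon,\ldots,-\pi^{R_{2k}-2}\varepsilon,\pi^{R_{2k+1}+2}\varepsilon,a_{2k+2},\ldots,a_n\succ.$$ -/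

import Mathlib

/-!
Quadratic lattices over the ring of integers `O` of a local field `F`, and their bases of norm
generators.  Throughout, `O` is a discrete valuation ring with fraction field `F`, and `V` is a
quadratic space over `F` with quadratic form `Q`; the symmetric bilinear form is
`B(x, y) = (Q(x + y) - Q(x) - Q(y)) / 2 = QuadraticMap.polar Q x y / 2`, so that `Q(x) = B(x, x)`.
-/

namespace DyadicLattice

noncomputable section Field

variable (O : Type*) {F : Type*} [CommRing O] [IsDomain O] [IsDiscreteValuationRing O]
  [Field F] [Algebra O F] [IsFractionRing O F]

open Classical in
/-- The normalized additive valuation `ord : F → ℤ ∪ {∞}`. -/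
def ord (x : F) : WithTop ℤ :=
  if x = 0 then ⊤
  else ((-(WithZero.log ((IsDiscreteValuationRing.maximalIdeal O).valuation F x)) : ℤ) :
    WithTop ℤ)

/-- The order of a fractional ideal: the least order of its elements (`∞` for the zero ideal). -/
def ordIdeal (I : Submodule O F) : WithTop ℤ := sInf (ord O '' (I : Set F))

/-- The quadratic defect of `a`: the intersection of the ideals `(a - x²)O`, `x ∈ F`. -/
def quadraticDefect (a : F) : Submodule O F :=
  ⨅ x : F, Submodule.span O {a - x ^ 2}

/-- The order `d(a)` of the relative quadratic defect, the order of the ideal `a⁻¹ 𝔡(a)`. -/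
def relDefect (a : F) : WithTop ℤ :=
  ordIdeal O (Submodule.span O {a⁻¹} * quadraticDefect O a)

/-- The subgroup `O^× (F^×)²` of `F^×`, as a subset of `F`. -/
def unitSquares : Set F :=
  {c | ∃ u t : F, ord O u = 0 ∧ t ≠ 0 ∧ c = u * t ^ 2}

open Classical in
/-- The Hilbert symbol `(a, b)` of nonzero elements `a`, `b` of the local field `F`. -/
def hilbertSymbol {K : Type*} [Field K] (a b : K) : ℤ :=
  if ∃ x y : K, a * x ^ 2 + b * y ^ 2 = 1 then 1 else -1

end Field

noncomputable section Space

variable {F V : Type*} [Field F] [AddCommGroup V] [Module F V]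

/-- The orthogonal projection `y ↦ y - (B(x, y) / Q(x)) x` of `V` onto `x^⊥`, for `Q(x) ≠ 0`. -/
def projPerp (Q : QuadraticForm F V) (x : V) : V →ₗ[F] V :=
  LinearMap.id - ((2 * Q x)⁻¹ • Q.polarBilin x).smulRight x

/-- The reflection `τ_x : y ↦ y - (2 B(x, y) / Q(x)) x`, for `Q(x) ≠ 0`. -/
def reflection (Q : QuadraticForm F V) (x : V) : V →ₗ[F] V :=
  LinearMap.id - ((Q x)⁻¹ • Q.polarBilin x).smulRight x

/-- `c` represents the spinor norm of `σ`: `σ` is a product of reflections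
`τ_{x₁} ⋯ τ_{x_r}` and `c ∈ Q(x₁) ⋯ Q(x_r) (F^×)²`. -/
def IsSpinorNorm (Q : QuadraticForm F V) (σ : V ≃ₗ[F] V) (c : F) : Prop :=
  ∃ l : List V, (∀ x ∈ l, Q x ≠ 0) ∧
    (σ : V →ₗ[F] V) = (l.map (reflection Q)).prod ∧
    ∃ t : F, t ≠ 0 ∧ c = (l.map Q).prod * t ^ 2

end Space

noncomputable section Lattice

variable {O F V : Type*} [CommRing O] [IsDomain O] [IsDiscreteValuationRing O]
  [Field F] [Algebra O F] [IsFractionRing O F]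
  [AddCommGroup V] [Module F V] [Module O V] [IsScalarTower O F V]

/-- The group `O⁺(L)` of rotations of `V` that map the lattice `L` on `V` onto itself. -/
def properOrthogonalGroup (Q : QuadraticForm F V) (L : Submodule O V) : Set (V ≃ₗ[F] V) :=
  {σ | (∀ y, Q (σ y) = Q y) ∧ LinearMap.det (σ : V →ₗ[F] V) = 1 ∧
    L.map ((σ : V →ₗ[F] V).restrictScalars O) = L}

/-- `θ(O⁺(L))`, the spinor norms of the rotations of `L`, as a union of cosets of `(F^×)²`. -/
def spinorNorms (Q : QuadraticForm F V) (L : Submodule O V) : Set F :=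
  {c | ∃ σ ∈ properOrthogonalGroup Q L, IsSpinorNorm Q σ c}

/-- The norm `𝔫L`: the fractional ideal generated by `Q(L)`. -/
def norm (Q : QuadraticForm F V) (L : Submodule O V) : Submodule O F :=
  Submodule.span O (Q '' (L : Set V))

/-- `x` is a norm generator of `L`: `x ∈ L` and `Q(x)O = 𝔫L`. -/
def IsNormGenerator (Q : QuadraticForm F V) (L : Submodule O V) (x : V) : Prop :=
  x ∈ L ∧ Submodule.span O {Q x} = norm Q L

/-- The set `L'` of the elements of `L` that are not norm generators of `L`. -/
def nonNormGenerators (Q : QuadraticForm F V) (L : Submodule O V) : Set V :=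
  {x | x ∈ L ∧ ¬ IsNormGenerator Q L x}

/-- `x₁, …, x_n` is a basis of norm generators (BONG) of `L`: `x₁` is an (anisotropic) norm
generator of `L` and `x₂, …, x_n` is a BONG of the projection of `L` to `x₁^⊥`. The empty sequence
is a BONG of the zero lattice only. -/
def IsBONG (Q : QuadraticForm F V) : (n : ℕ) → Submodule O V → (Fin n → V) → Prop
  | 0, L, _ => L = ⊥
  | n + 1, L, x =>
      IsNormGenerator Q L (x 0) ∧ Q (x 0) ≠ 0 ∧
        IsBONG Q n (L.map ((projPerp Q (x 0)).restrictScalars O)) (Fin.tail x)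

/-- `L ≅ ≺a₁, …, a_n≻` relative to some BONG. Only the values `a 1, …, a n` of `a` matter. -/
def HasBONG (Q : QuadraticForm F V) (L : Submodule O V) (n : ℕ) (a : ℕ → F) : Prop :=
  ∃ x : Fin n → V, IsBONG Q n L x ∧ ∀ i : Fin n, Q (x i) = a (i + 1)

/-- `L ≅ ≺a₁, …, a_n≻` relative to some good BONG, i.e. a BONG `x₁, …, x_n` with
`ord Q(x_i) ≤ ord Q(x_{i+2})` for `1 ≤ i ≤ n - 2`. Only `a 1, …, a n` matter. -/
def HasGoodBONG (Q : QuadraticForm F V) (L : Submodule O V) (n : ℕ) (a : ℕ → F) : Prop :=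
  ∃ x : Fin n → V, IsBONG Q n L x ∧
    (∀ i j : Fin n, (j : ℕ) = i + 2 → ord O (Q (x i)) ≤ ord O (Q (x j))) ∧
    ∀ i : Fin n, Q (x i) = a (i + 1)

/-- The subset `S` of `V` is a lattice with `S ≅ ≺b₁, …, b_n≻` relative to some good BONG. -/
def IsLatticeWithGoodBONG (O : Type*) [CommRing O] [IsDomain O] [IsDiscreteValuationRing O]
    [Algebra O F] [IsFractionRing O F] [Module O V] [IsScalarTower O F V]
    (Q : QuadraticForm F V) (S : Set V) (n : ℕ) (b : ℕ → F) : Prop :=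
  ∃ M : Submodule O V, (M : Set V) = S ∧ HasGoodBONG Q M n b

/-- `J` is `𝔫J`-maximal: it is not strictly contained in a lattice on the same quadratic space `FJ`
whose norm is contained in `𝔫J`. -/
def IsNormMaximal (Q : QuadraticForm F V) (J : Submodule O V) : Prop :=
  ∀ M : Submodule O V, M.FG →
    Submodule.span F (M : Set V) = Submodule.span F (J : Set V) →
    J ≤ M → norm Q M ≤ norm Q J → M = J

/-- The binary lattice `≺a₁, a₂≻` (realized inside `V`) is maximal. -/
def IsMaximalPair (O : Type*) [CommRing O] [IsDomain O] [IsDiscreteValuationRing O]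
    [Algebra O F] [IsFractionRing O F] [Module O V] [IsScalarTower O F V]
    (Q : QuadraticForm F V) (a : ℕ → F) : Prop :=
  ∃ J : Submodule O V, HasBONG Q J 2 a ∧ IsNormMaximal Q J

/-- Property A, in terms of `R_i = ord a_i`, where `L ≅ ≺a₁, …, a_n≻` relative to a good BONG. -/
def PropertyA (n : ℕ) (R : ℕ → ℤ) : Prop :=
  ∀ i, 1 ≤ i → i + 2 ≤ n → R i < R (i + 2)

/-- Property B, in terms of `a_i` and `R_i = ord a_i`, where `L ≅ ≺a₁, …, a_n≻` relative to a good
BONG, and of `e = ord 2`. -/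
def PropertyB (O : Type*) [CommRing O] [IsDomain O] [IsDiscreteValuationRing O]
    [Algebra O F] [IsFractionRing O F] (e : ℤ) (n : ℕ) (a : ℕ → F) (R : ℕ → ℤ) : Prop :=
  PropertyA n R ∧ ∀ i, 1 ≤ i → i + 1 ≤ n →
    ((Odd (R (i + 1) - R i) ∧ R (i + 1) - R i ≤ 2 * e + 1) ∨
      (Even (R (i + 1) - R i) ∧
        relDefect O (-(a i * a (i + 1))) ≤ ((e - (R (i + 1) - R i) / 2 : ℤ) : WithTop ℤ))) →
    (2 ≤ i → R i - R (i - 1) > 2 * e) ∧ (i + 2 ≤ n → R (i + 2) - R (i + 1) > 2 * e)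

end Lattice

end DyadicLattice

/-! Write R_i = ord a_i and let x₁, x₂, … be the BONG. A vector y of L lies in L' exactly when ord
Q(y) > R_1 (`nonNormGenerators_eq`), so L' is a module as soon as the polar form of L takes values
in 𝔭^(R_1+1). This holds unless R_2 - R_1 = -2e (`HasGoodBONG.ordGE_polar_succ`).

The spinor norm hypothesis enters only through parity: if the reflection in x ∈ L preserves L,
composing it with the reflection in x₁ gives a rotation of spinor norm Q(x)Q(x₁), whence ord Q(x) ≡
R_1 mod 2 (`reflectionParity_of_spinorNorms`). Either this parity or property B excludes R_3 = R_1 +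
1 (`HasGoodBONG.add_two_le_third`).

If R_2 - R_1 = -2e and a₁a₂ ∈ -ΔF², the form on the first two vectors is a multiple of u² + uw +
ρw². It is anisotropic modulo 𝔭, so passing to L' multiplies the plane by π and keeps the rest. If
a₁a₂ ∈ -F², there are two isotropic vectors of L whose difference is a unit multiple of x₁. If R_1 =
R_3, two vectors with polar value of order R_1 can be moved into L' by adding multiples of x₃. In
both cases L' is not closed under addition.

If R_2 - R_1 > -2e, identify αx₁ + βx₂ with α + βω, where ω² = -a₂/a₁; its trace is 2α and its norm
is Q(αx₁ + βx₂)/a₁. Maximality of ≺a₁, a₂≻ means that β is integral for every integral element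
(`BinaryMaximal`). A vector of order R_1 + 1 with integral β forces maximality
(`binaryMaximal_of_uniformizer`). So in the non-maximal case with R_1 < R_3 all vectors of L' have
order at least R_1 + 2, and πx₁ is a norm generator of L' with the same projection as before. In the
maximal case there are elements of norm πη, and multiplication by one of them maps the binary
lattice onto its part of order > R_1. Property B makes R_3 large enough for the remaining vectors to
be unaffected; the parity property is incompatible with this case.

If moreover R_1 = R_3, property A fails, so parity is available. It produces a hyperbolic plane
spanned by near-isotropic combinations of the first three vectors, which splits L
(`exists_hyperbolic_pair`). `HyperbolicSplitting.hasGoodBONG` reads off a BONG of plane ⟂ J from one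
of J. The same plane splits L', with complement J', and induction on k gives both BONGs at once
(`HasGoodBONG.alternating`). -/

set_option linter.unusedSectionVars false

namespace DyadicLattice
open QuadraticMap (polar)

/-! ### Arithmetic of orders in the field of fractions. -/

section Valuation

variable (O : Type*) {F : Type*} [CommRing O] [IsDomain O] [IsDiscreteValuationRing O]
  [Field F] [Algebra O F] [IsFractionRing O F]

/-- `x` lies in the `k`-th power of the maximal ideal. -/
def OrdGE (k : ℤ) (x : F) : Prop := (k : WithTop ℤ) ≤ ord O x

/-- `x` has order exactly `k`. -/
def OrdEq (k : ℤ) (x : F) : Prop := ord O x = (k : WithTop ℤ)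

variable {O}

theorem ord_zero : ord O (0 : F) = ⊤ := by simp [ord]

theorem ord_ne_top {x : F} (hx : x ≠ 0) :
    ord O x = ((-(WithZero.log ((IsDiscreteValuationRing.maximalIdeal O).valuation F x)) : ℤ) :
    WithTop ℤ) := by simp [ord, hx]

theorem exists_ordEq {x : F} (hx : x ≠ 0) : ∃ k, OrdEq O k x := ⟨_, ord_ne_top hx⟩

theorem OrdEq.ne_zero {k : ℤ} {x : F} (h : OrdEq O k x) : x ≠ 0 := by
  rintro rfl
  rw [OrdEq, ord_zero] at h
  exact WithTop.coe_ne_top h.symm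

theorem OrdGE.zero (k : ℤ) : OrdGE O k (0 : F) := by simp [OrdGE, ord_zero]

theorem OrdEq.ge {k : ℤ} {x : F} (h : OrdEq O k x) : OrdGE O k x :=
  le_of_eq (Eq.symm h)

theorem OrdEq.le_of_ge {k l : ℤ} {x : F} (h : OrdEq O k x) (h' : OrdGE O l x) : l ≤ k := by
  unfold OrdEq at h; unfold OrdGE at h'
  rw [h] at h'
  exact_mod_cast h'

theorem OrdEq.unique {k l : ℤ} {x : F} (h : OrdEq O k x) (h' : OrdEq O l x) : k = l := by
  unfold OrdEq at h h'
  rw [h] at h'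
  exact_mod_cast h'

theorem OrdGE.mono {k l : ℤ} {x : F} (h : OrdGE O k x) (hl : l ≤ k) : OrdGE O l x :=
  le_trans (by exact_mod_cast hl) h

theorem OrdGE.eq_or {k : ℤ} {x : F} (h : OrdGE O k x) : OrdEq O k x ∨ OrdGE O (k + 1) x := by
  rcases eq_or_ne x 0 with rfl | hx
  · exact Or.inr (OrdGE.zero _)
  obtain ⟨l, hl⟩ := exists_ordEq (O := O) hx
  rcases eq_or_lt_of_le (hl.le_of_ge h) with h1 | h1
  · exact Or.inl (h1 ▸ hl)
  · exact Or.inr (hl.ge.mono (by omega))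

theorem OrdEq.of_ge {k : ℤ} {x : F} (h : OrdGE O k x) (h' : ¬ OrdGE O (k + 1) x) : OrdEq O k x :=
  h.eq_or.resolve_right h'

theorem OrdEq.not_ge {k l : ℤ} {x : F} (h : OrdEq O k x) (hl : k < l) : ¬ OrdGE O l x :=
  fun h' => absurd (h.le_of_ge h') (by omega)

theorem OrdEq.mul {k l : ℤ} {x y : F} (hx : OrdEq O k x) (hy : OrdEq O l y) :
    OrdEq O (k + l) (x * y) := by
  have h1 := hx.ne_zero
  have h2 := hy.ne_zero
  unfold OrdEq at *
  rw [ord_ne_top h1] at hx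
  rw [ord_ne_top h2] at hy
  rw [ord_ne_top (mul_ne_zero h1 h2), map_mul, WithZero.log_mul (by simpa using h1) (by simpa using h2)]
  have hx' := WithTop.coe_injective hx
  have hy' := WithTop.coe_injective hy
  exact congrArg _ (by rw [← hx', ← hy']; ring)

theorem OrdGE.mul {k l : ℤ} {x y : F} (hx : OrdGE O k x) (hy : OrdGE O l y) :
    OrdGE O (k + l) (x * y) := by
  rcases eq_or_ne x 0 with rfl | h1
  · rw [zero_mul]; exact OrdGE.zero _
  rcases eq_or_ne y 0 with rfl | h2
  · rw [mul_zero]; exact OrdGE.zero _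
  obtain ⟨i, hi⟩ := exists_ordEq (O := O) h1
  obtain ⟨j, hj⟩ := exists_ordEq (O := O) h2
  have := hi.le_of_ge hx
  have := hj.le_of_ge hy
  exact (hi.mul hj).ge.mono (by omega)

theorem OrdGE.add {k : ℤ} {x y : F} (hx : OrdGE O k x) (hy : OrdGE O k y) :
    OrdGE O k (x + y) := by
  rcases eq_or_ne x 0 with rfl | h1
  · rwa [zero_add]
  rcases eq_or_ne y 0 with rfl | h2
  · rwa [add_zero]
  rcases eq_or_ne (x + y) 0 with h3 | h3
  · rw [h3]; exact OrdGE.zero _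
  unfold OrdGE at *
  rw [ord_ne_top h1] at hx
  rw [ord_ne_top h2] at hy
  rw [ord_ne_top h3]
  have hx' := WithTop.coe_le_coe.1 hx
  have hy' := WithTop.coe_le_coe.1 hy
  refine WithTop.coe_le_coe.2 ?_
  rcases Valuation.map_add' ((IsDiscreteValuationRing.maximalIdeal O).valuation F) x y with h | h
  · have := (WithZero.log_le_log (by simpa using h3) (by simpa using h1)).2 h
    omega
  · have := (WithZero.log_le_log (by simpa using h3) (by simpa using h2)).2 h
    omega

theorem ordEq_one : OrdEq O 0 (1 : F) := by
  unfold OrdEq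
  rw [ord_ne_top one_ne_zero]
  simp

theorem ordGE_one : OrdGE O 0 (1 : F) := ordEq_one.ge

theorem ordEq_neg_one : OrdEq O 0 (-1 : F) := by
  obtain ⟨k, hk⟩ := exists_ordEq (O := O) (neg_ne_zero.2 (one_ne_zero (α := F)))
  have h := hk.mul hk
  rw [neg_one_mul, neg_neg] at h
  have := h.unique ordEq_one
  have : k = 0 := by omega
  exact this ▸ hk

theorem OrdEq.neg {k : ℤ} {x : F} (hx : OrdEq O k x) : OrdEq O k (-x) := by
  have := ordEq_neg_one.mul hx
  rwa [zero_add, neg_one_mul] at this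

theorem OrdGE.neg {k : ℤ} {x : F} (hx : OrdGE O k x) : OrdGE O k (-x) := by
  have := ordEq_neg_one.ge.mul hx
  rwa [zero_add, neg_one_mul] at this

theorem OrdGE.sub {k : ℤ} {x y : F} (hx : OrdGE O k x) (hy : OrdGE O k y) :
    OrdGE O k (x - y) := by
  rw [sub_eq_add_neg]; exact hx.add hy.neg

theorem OrdEq.inv {k : ℤ} {x : F} (hx : OrdEq O k x) : OrdEq O (-k) x⁻¹ := by
  obtain ⟨l, hl⟩ := exists_ordEq (O := O) (inv_ne_zero hx.ne_zero)
  have h := hx.mul hl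
  rw [mul_inv_cancel₀ hx.ne_zero] at h
  have := h.unique ordEq_one
  have : l = -k := by omega
  exact this ▸ hl

theorem OrdEq.div {k l : ℤ} {x y : F} (hx : OrdEq O k x) (hy : OrdEq O l y) :
    OrdEq O (k - l) (x / y) := by
  rw [div_eq_mul_inv, sub_eq_add_neg]; exact hx.mul hy.inv

theorem OrdGE.div {k l : ℤ} {x y : F} (hx : OrdGE O k x) (hy : OrdEq O l y) :
    OrdGE O (k - l) (x / y) := by
  rw [div_eq_mul_inv, sub_eq_add_neg]; exact hx.mul hy.inv.ge

theorem OrdEq.sq {k : ℤ} {x : F} (hx : OrdEq O k x) : OrdEq O (2 * k) (x ^ 2) := by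
  rw [pow_two, two_mul]; exact hx.mul hx

theorem OrdGE.sq {k : ℤ} {x : F} (hx : OrdGE O k x) : OrdGE O (2 * k) (x ^ 2) := by
  rw [pow_two, two_mul]; exact hx.mul hx

theorem OrdGE.of_mul_left {k l m : ℤ} {x y : F} (h : OrdGE O k (x * y)) (hx : OrdEq O l x)
    (hm : m ≤ k - l) : OrdGE O m y := by
  have := h.div hx
  rw [mul_div_cancel_left₀ _ hx.ne_zero] at this
  exact this.mono hm

theorem OrdGE.of_mul_right {k l m : ℤ} {x y : F} (h : OrdGE O k (x * y)) (hy : OrdEq O l y)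
    (hm : m ≤ k - l) : OrdGE O m x := by
  rw [mul_comm] at h; exact h.of_mul_left hy hm

/-- The order of a square is even, so an odd bound on it can be raised by one before halving; hence
the slack `k + 1`. -/
theorem OrdGE.of_sq {k m : ℤ} {x : F} (h : OrdGE O k (x ^ 2)) (hm : 2 * m ≤ k + 1) :
    OrdGE O m x := by
  rcases eq_or_ne x 0 with rfl | h1
  · exact OrdGE.zero _
  obtain ⟨i, hi⟩ := exists_ordEq (O := O) h1
  have := hi.sq.le_of_ge h
  exact hi.ge.mono (by omega)

/-- If `x + y` has larger order than `x`, then `y` has the order of `x`. -/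
theorem OrdEq.of_add_ge {k : ℤ} {x y : F} (hx : OrdEq O k x) (h : OrdGE O (k + 1) (x + y)) :
    OrdEq O k y := by
  have h1 : y = (x + y) - x := by ring
  refine OrdEq.of_ge ?_ fun h2 => ?_
  · rw [h1]; exact (h.mono (by omega)).sub hx.ge
  · have : x = (x + y) - y := by ring
    rw [this] at hx
    exact hx.not_ge (by omega) (h.sub h2)

theorem OrdEq.add_ge {k : ℤ} {x y : F} (hx : OrdEq O k x) (hy : OrdGE O (k + 1) y) :
    OrdEq O k (x + y) := by
  have := hx.neg.of_add_ge (y := x + y) (by simpa using hy)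
  exact this

/-- The maximal ideal is the only height-one prime of a discrete valuation ring, so integrality at
this one valuation already means membership in `O`. -/
theorem ordGE_zero_iff {x : F} : OrdGE O 0 x ↔ ∃ o : O, algebraMap O F o = x := by
  constructor
  · intro h
    rcases eq_or_ne x 0 with rfl | h1
    · exact ⟨0, map_zero _⟩
    have := IsDedekindDomain.HeightOneSpectrum.mem_integers_of_valuation_le_one (R := O) F x ?_
    · obtain ⟨o, ho⟩ := this
      exact ⟨o, ho⟩
    intro v
    have hv : v = IsDiscreteValuationRing.maximalIdeal O := by
      ext1
      exact IsLocalRing.eq_maximalIdeal (v.isPrime.isMaximal v.ne_bot)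
    rw [hv]
    unfold OrdGE at h
    rw [ord_ne_top h1] at h
    have h' := WithTop.coe_le_coe.1 h
    rw [← WithZero.log_le_log (by simpa using h1) one_ne_zero, WithZero.log_one]
    omega
  · rintro ⟨o, rfl⟩
    rcases eq_or_ne (algebraMap O F o) 0 with h1 | h1
    · rw [h1]; exact OrdGE.zero _
    unfold OrdGE
    rw [ord_ne_top h1]
    have : (IsDiscreteValuationRing.maximalIdeal O).valuation F (algebraMap O F o) ≤ 1 :=
      IsDedekindDomain.HeightOneSpectrum.valuation_le_one _ o
    rw [← WithZero.log_le_log (by simpa using h1) one_ne_zero, WithZero.log_one] at this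
    refine WithTop.coe_le_coe.2 ?_
    omega

theorem ordGE_algebraMap (o : O) : OrdGE O 0 (algebraMap O F o) := ordGE_zero_iff.2 ⟨o, rfl⟩

theorem ordGE_zero_two : OrdGE O 0 (2 : F) := by
  have := ordGE_algebraMap (F := F) (2 : O)
  rwa [map_ofNat] at this

theorem ordGE_one_iff {o : O} : OrdGE O 1 (algebraMap O F o) ↔ o ∈ IsLocalRing.maximalIdeal O := by
  rw [IsLocalRing.mem_maximalIdeal, mem_nonunits_iff]
  constructor
  · rintro h ⟨u, rfl⟩
    have h1 : OrdGE O 1 ((algebraMap O F u) * (algebraMap O F (↑u⁻¹ : O))) := by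
      have := h.mul (ordGE_algebraMap (F := F) (↑u⁻¹ : O))
      rwa [add_zero] at this
    rw [← map_mul, Units.mul_inv, map_one] at h1
    exact ordEq_one.not_ge (by omega) h1
  · intro h
    by_contra h1
    have h2 : OrdEq O 0 (algebraMap O F o) := OrdEq.of_ge (ordGE_algebraMap o) (by simpa using h1)
    obtain ⟨o', ho'⟩ := ordGE_zero_iff.1 (show OrdGE O 0 (algebraMap O F o)⁻¹ by
      simpa using h2.inv.ge)
    apply h
    refine IsUnit.of_mul_eq_one o' ?_
    apply IsFractionRing.injective O F
    rw [map_mul, ho', map_one, mul_inv_cancel₀ h2.ne_zero]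

theorem mem_span_singleton_iff {k : ℤ} {x y : F} (hx : OrdEq O k x) :
    y ∈ Submodule.span O {x} ↔ OrdGE O k y := by
  rw [Submodule.mem_span_singleton]
  constructor
  · rintro ⟨o, rfl⟩
    rw [Algebra.smul_def]
    exact ((ordGE_algebraMap o).mul hx.ge).mono (by omega)
  · intro h
    have := h.div hx
    obtain ⟨o, ho⟩ := ordGE_zero_iff.1 (this.mono (by omega : 0 ≤ k - k))
    refine ⟨o, ?_⟩
    rw [Algebra.smul_def, ho, div_mul_cancel₀ _ hx.ne_zero]

theorem OrdEq.zpow {k : ℤ} {x : F} (hx : OrdEq O k x) (m : ℤ) : OrdEq O (m * k) (x ^ m) := by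
  have hn : ∀ n : ℕ, OrdEq O (n * k) (x ^ n) := by
    intro n
    induction n with
    | zero => simpa using ordEq_one
    | succ n ih =>
      rw [pow_succ]
      have := ih.mul hx
      convert this using 1
      push_cast; ring
  obtain ⟨n, rfl | rfl⟩ := m.eq_nat_or_neg
  · simpa using hn n
  · simpa using (hn n).inv

theorem uniformizer_zpow {π : F} (hπ : OrdEq O 1 π) (m : ℤ) : OrdEq O m (π ^ m) := by
  simpa using hπ.zpow m

theorem ordEq_of_sq {k : ℤ} {x : F} (h : OrdEq O (2 * k) (x ^ 2)) : OrdEq O k x := by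
  have hx : x ≠ 0 := by
    rintro rfl
    exact h.ne_zero (by simp)
  obtain ⟨i, hi⟩ := exists_ordEq (O := O) hx
  have := hi.sq.unique h
  have : i = k := by omega
  exact this ▸ hi

/-- Integral closedness of `O` for monic quadratic polynomials. -/
theorem ordGE_zero_of_root {x p q : F} (hp : OrdGE O 0 p) (hq : OrdGE O 0 q)
    (h : x ^ 2 + p * x + q = 0) : OrdGE O 0 x := by
  by_contra hx
  have hx0 : x ≠ 0 := by
    rintro rfl; exact hx (OrdGE.zero _)
  obtain ⟨i, hi⟩ := exists_ordEq (O := O) hx0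
  have hi0 : i < 0 := by
    by_contra h'
    exact hx (hi.ge.mono (by omega))
  -- For ord x = i < 0 the left side has order 2i < i, but the right side has order at least i.
  have h1 : x ^ 2 = -(p * x + q) := by linear_combination h
  have h2 : OrdGE O i (-(p * x + q)) :=
    (((hp.mul hi.ge).mono (by omega)).add (hq.mono (by omega))).neg
  rw [← h1] at h2
  exact hi.sq.not_ge (by omega) h2

/-! ### Approximation by squares over a perfect residue field of characteristic 2. -/

section Dyadic

variable [Finite (IsLocalRing.ResidueField O)] [CharP (IsLocalRing.ResidueField O) 2]

theorem ordGE_one_two : OrdGE O 1 (2 : F) := by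
  have : (2 : F) = algebraMap O F 2 := (map_ofNat (algebraMap O F) 2).symm
  rw [this, ordGE_one_iff, ← IsLocalRing.residue_eq_zero_iff, map_ofNat]
  exact CharP.cast_eq_zero (IsLocalRing.ResidueField O) 2

/-- The residue field being perfect, integral elements are squares modulo the maximal ideal. -/
theorem exists_sq_approx {u : F} (hu : OrdGE O 0 u) :
    ∃ v : F, OrdGE O 0 v ∧ OrdGE O 1 (u - v ^ 2) := by
  obtain ⟨o, rfl⟩ := ordGE_zero_iff.1 hu
  have : ExpChar (IsLocalRing.ResidueField O) 2 := ExpChar.prime Nat.prime_two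
  have hs : Function.Surjective (frobenius (IsLocalRing.ResidueField O) 2) :=
    Finite.injective_iff_surjective.1 (frobenius_inj _ 2)
  obtain ⟨r, hr⟩ := hs (IsLocalRing.residue O o)
  obtain ⟨v, rfl⟩ := IsLocalRing.residue_surjective r
  refine ⟨algebraMap O F v, ordGE_algebraMap v, ?_⟩
  rw [← map_pow, ← map_sub, ordGE_one_iff, ← IsLocalRing.residue_eq_zero_iff, map_sub, map_pow,
    ← hr, frobenius_def, sub_self]

/-- Every element is approximated by `λ² A` if the order of `A` is right. -/
theorem exists_add_sq_mul {q A π : F} {N j : ℤ} (hπ : OrdEq O 1 π) (hq : OrdGE O (N + 2 * j) q)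
    (hA : OrdEq O N A) : ∃ l : F, OrdGE O j l ∧ OrdGE O (N + 2 * j + 1) (q + l ^ 2 * A) := by
  have hj := uniformizer_zpow hπ j
  have h1 := hq.div (hj.sq.mul hA)
  obtain ⟨v, hv, hv'⟩ := exists_sq_approx (u := -(q / ((π ^ j) ^ 2 * A)))
    (h1.neg.mono (by omega))
  refine ⟨π ^ j * v, (hj.ge.mul hv).mono (by omega), ?_⟩
  have h2 := (hv'.mul (hj.sq.mul hA).ge).neg
  have h3 : (q + (π ^ j * v) ^ 2 * A) =
      -((-(q / ((π ^ j) ^ 2 * A)) - v ^ 2) * ((π ^ j) ^ 2 * A)) := by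
    field_simp [hj.ne_zero, hA.ne_zero]
    ring
  rw [h3]
  exact h2.mono (by omega)

/-- Successive approximation: either some `q + λ² A` has an order of the wrong parity, or `q` is
approximated by `-λ² A` up to the order `N + 2e`. -/
theorem exists_add_sq_mul_of_parity {q A π : F} {N e m : ℤ} (hπ : OrdEq O 1 π)
    (he : OrdEq O e (2 : F)) (hq : OrdGE O N q) (hA : OrdEq O N A) (hm : m < N + 2 * e)
    (hpar : ∀ l k, OrdGE O 0 l → OrdEq O k (q + l ^ 2 * A) → k ≤ m → Even (k - N)) :
    ∃ l : F, OrdGE O 0 l ∧ OrdGE O (m + 1) (q + l ^ 2 * A) := by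
  have key : ∀ i : ℕ, N + i ≤ m + 1 →
      ∃ l : F, OrdGE O 0 l ∧ OrdGE O (N + i) (q + l ^ 2 * A) := by
    intro i
    induction i with
    | zero => exact fun _ => ⟨0, OrdGE.zero _, by simpa using hq⟩
    | succ i ih =>
      intro hi
      push_cast at hi
      obtain ⟨l, hl, hl'⟩ := ih (by omega)
      rcases hl'.eq_or with h1 | h1
      · obtain ⟨j, hj⟩ := hpar l _ hl h1 (by omega)
        have hj' : (i : ℤ) = 2 * j := by omega
        rw [hj'] at hl'
        obtain ⟨v, hv, hv'⟩ := exists_add_sq_mul hπ hl' hA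
        refine ⟨l + v, hl.add (hv.mono (by omega)), ?_⟩
        -- The cross term has order at least N + e + j, and j < e because N + 2j ≤ m < N + 2e, so it
        -- does not disturb the gain of one.
        have h2 : q + (l + v) ^ 2 * A = (q + l ^ 2 * A + v ^ 2 * A) + 2 * l * v * A := by ring
        rw [h2]
        push_cast
        refine (hv'.mono (by omega)).add ?_
        exact ((((he.ge.mul hl).mul hv).mul hA.ge).mono (by omega))
      · exact ⟨l, hl, h1.mono (by push_cast; omega)⟩
  rcases le_or_gt N (m + 1) with h | h
  · obtain ⟨i, hi⟩ := Int.eq_ofNat_of_zero_le (show 0 ≤ m + 1 - N by omega)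
    obtain ⟨l, hl, hl'⟩ := key i (by omega)
    exact ⟨l, hl, hl'.mono (by omega)⟩
  · exact ⟨0, OrdGE.zero _, by simpa using hq.mono (by omega)⟩

end Dyadic

/-- Hensel's lemma at the approximate root 0. The derivative there is 1, so no power of 2 is lost.
-/
theorem exists_root_of_ordGE [IsAdicComplete (IsLocalRing.maximalIdeal O) O] {q : F}
    (hq : OrdGE O 1 q) : ∃ t : F, OrdGE O 1 t ∧ t ^ 2 + t + q = 0 := by
  obtain ⟨o, rfl⟩ := ordGE_zero_iff.1 (hq.mono (by omega : (0 : ℤ) ≤ 1))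
  have hh := HenselianRing.is_henselian (R := O) (I := IsLocalRing.maximalIdeal O)
    (Polynomial.X ^ 2 + Polynomial.X + Polynomial.C o)
    (by monicity!) 0 (by simpa using ordGE_one_iff.1 hq) (by simp)
  obtain ⟨t, ht, ht'⟩ := hh
  refine ⟨algebraMap O F t, ordGE_one_iff.2 (by simpa using ht'), ?_⟩
  have : t ^ 2 + t + o = 0 := by simpa [Polynomial.IsRoot] using ht
  rw [← map_pow, ← map_add, ← map_add, this, map_zero]

/-- A quadratic polynomial whose linear coefficient dominates has a root. -/
theorem exists_quadratic_root [IsAdicComplete (IsLocalRing.maximalIdeal O) O] {A B C : F} {m : ℤ}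
    (hA : OrdGE O (m + 1) A) (hB : OrdEq O m B) (hC : OrdGE O (m + 1) C) :
    ∃ t : F, OrdGE O 1 t ∧ A + B * t + C * t ^ 2 = 0 := by
  rcases eq_or_ne C 0 with rfl | hC0
  · refine ⟨-(A / B), (hA.div hB).neg.mono (by omega), ?_⟩
    field_simp [hB.ne_zero]; ring
  obtain ⟨t, ht, ht'⟩ := exists_root_of_ordGE (O := O) (q := A * C / B ^ 2)
    (((hA.mul hC).div hB.sq).mono (by omega))
  have hu : OrdEq O 0 (1 + t) := ordEq_one.add_ge ht
  -- This root is Bt/C, rewritten by means of t(1 + t) = -AC/B² so that its order is visible.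
  refine ⟨-(A / (B * (1 + t))), (hA.div (hB.mul hu)).neg.mono (by omega), ?_⟩
  have hB0 := hB.ne_zero
  have hu0 := hu.ne_zero
  have h1 : A * C = -(t ^ 2 + t) * B ^ 2 := by
    field_simp at ht'; linear_combination ht'
  field_simp
  linear_combination A * h1

/-! ### An upper bound for the quadratic defect. -/

section Defect

/-- An approximation of `c` by a square with an error of odd order below `4c` is best possible. -/
theorem relDefect_le {c s ν : F} {e k l : ℤ} (he : OrdEq O e (2 : F)) (hc : OrdEq O k c)
    (hk : Even k) (hl : Odd l) (hν : OrdEq O l ν) (h : c = s ^ 2 + ν) (hlk : l < 2 * e + k)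
    (hkl : k ≤ l) : relDefect O c ≤ ((l - k : ℤ) : WithTop ℤ) := by
  have hmem : ν ∈ quadraticDefect O c := by
    rw [quadraticDefect, Submodule.mem_iInf]
    intro x
    have hs : OrdEq O k (s ^ 2) := by
      have : k < l := by
        rcases hk with ⟨i, rfl⟩
        rcases hl with ⟨j, rfl⟩
        omega
      have h1 : s ^ 2 = c + -ν := by rw [h]; ring
      rw [h1]
      exact hc.add_ge (hν.neg.ge.mono (by omega))
    obtain ⟨i, hi⟩ := hk
    have hs' : OrdEq O i s := ordEq_of_sq (by rwa [two_mul, ← hi])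
    -- If c - x² were smaller than ν, then (s - x)(s + x) would have the odd order l. When s - x is
    -- larger in size than 2s, both factors have equal order and the product has even order;
    -- otherwise the product has order at least 2e + k > l.
    have hne : ¬ OrdGE O (l + 1) (c - x ^ 2) := by
      intro h1
      have h2 : (s - x) * (2 * s - (s - x)) = -ν + (c - x ^ 2) := by rw [h]; ring
      have h3 : OrdEq O l ((s - x) * (2 * s - (s - x))) := by
        rw [h2]; exact hν.neg.add_ge h1
      have hz : s - x ≠ 0 := by
        intro h0; rw [h0, zero_mul] at h3; exact h3.ne_zero rfl
      obtain ⟨z, hz⟩ := exists_ordEq (O := O) hz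
      rcases lt_or_ge z (e + i) with h4 | h4
      · have h5 : OrdEq O z (2 * s - (s - x)) := by
          have := hz.neg.add_ge (y := 2 * s) ((he.mul hs').ge.mono (by omega))
          convert this using 1; ring
        have := (hz.mul h5).unique h3
        obtain ⟨j, rfl⟩ := hl
        omega
      · have h5 : OrdGE O (e + i) (2 * s - (s - x)) := ((he.mul hs').ge).sub (hz.ge.mono h4)
        have := h3.le_of_ge (hz.ge.mul h5)
        omega
    have hne0 : c - x ^ 2 ≠ 0 := by
      intro h0; rw [h0] at hne; exact hne (OrdGE.zero _)
    obtain ⟨j, hj⟩ := exists_ordEq (O := O) hne0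
    rw [mem_span_singleton_iff hj]
    refine hν.ge.mono ?_
    by_contra h'
    exact hne (hj.ge.mono (by omega))
  have hmem' : c⁻¹ * ν ∈ Submodule.span O {c⁻¹} * quadraticDefect O c :=
    Submodule.mul_mem_mul (Submodule.mem_span_singleton_self _) hmem
  unfold relDefect ordIdeal
  have hord : ord O (c⁻¹ * ν) = ((l - k : ℤ) : WithTop ℤ) := by
    have := hc.inv.mul hν
    rw [show -k + l = l - k by ring] at this
    exact this
  -- The infimum is taken in ℤ ∪ {∞}, so a lower bound must be supplied: x = 0 in the defect gives
  -- 𝔡(c) ⊆ cO.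
  refine csInf_le ⟨((0 : ℤ) : WithTop ℤ), ?_⟩ ⟨_, hmem', hord⟩
  rintro _ ⟨y, hy, rfl⟩
  change OrdGE O 0 y
  have hle : Submodule.span O {c⁻¹} * quadraticDefect O c ≤ Submodule.span O {(1 : F)} := by
    have h1 : quadraticDefect O c ≤ Submodule.span O {c} := by
      refine (iInf_le _ (0 : F)).trans ?_
      simp
    refine (mul_le_mul' le_rfl h1).trans ?_
    rw [Submodule.span_mul_span, Set.singleton_mul_singleton, inv_mul_cancel₀ hc.ne_zero]
  exact (mem_span_singleton_iff ordEq_one).1 (hle hy)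

end Defect

end Valuation

/-! ### Projections and reflections in a quadratic space. -/

section QuadraticSpace

variable {F V : Type*} [Field F] [AddCommGroup V] [Module F V] (Q : QuadraticForm F V)

theorem map_smul_sq (c : F) (x : V) : Q (c • x) = c ^ 2 * Q x := by
  rw [QuadraticMap.map_smul, smul_eq_mul, pow_two]

theorem polar_self_mul (x : V) : polar Q x x = 2 * Q x := by
  rw [QuadraticMap.polar_self, nsmul_eq_mul]; norm_num

theorem polar_smul_add_left (c : F) (x y z : V) :
    polar Q (c • x + y) z = c * polar Q x z + polar Q y z := by
  rw [QuadraticMap.polar_add_left, QuadraticMap.polar_smul_left, smul_eq_mul]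

theorem map_add_polar (x y : V) : Q (x + y) = Q x + Q y + polar Q x y := by
  rw [polar]; ring

theorem map_smul_add (c : F) (x y : V) :
    Q (c • x + y) = c ^ 2 * Q x + c * polar Q x y + Q y := by
  rw [map_add_polar, map_smul_sq, QuadraticMap.polar_smul_left, smul_eq_mul]; ring

theorem map_smul_add_of_polar_eq_zero (c : F) {x y : V} (h : polar Q x y = 0) :
    Q (c • x + y) = c ^ 2 * Q x + Q y := by
  rw [map_smul_add, h]; ring

theorem projPerp_apply (x y : V) :
    projPerp Q x y = y - ((2 * Q x)⁻¹ * polar Q x y) • x := by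
  simp [projPerp]

theorem reflection_apply (x y : V) :
    reflection Q x y = y - ((Q x)⁻¹ * polar Q x y) • x := by
  simp [reflection]

variable {Q}

theorem polar_projPerp (h2 : (2 : F) ≠ 0) {x : V} (hx : Q x ≠ 0) (y : V) :
    polar Q x (projPerp Q x y) = 0 := by
  rw [projPerp_apply, QuadraticMap.polar_sub_right, QuadraticMap.polar_smul_right,
    polar_self_mul, smul_eq_mul]
  field_simp
  ring

theorem projPerp_eq_self {x y : V} (h : polar Q x y = 0) : projPerp Q x y = y := by
  rw [projPerp_apply, h]; simp

theorem projPerp_self (h2 : (2 : F) ≠ 0) {x : V} (hx : Q x ≠ 0) : projPerp Q x x = 0 := by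
  rw [projPerp_apply, polar_self_mul, inv_mul_cancel₀ (mul_ne_zero h2 hx), one_smul, sub_self]

theorem projPerp_smul_add (h2 : (2 : F) ≠ 0) {x y : V} (hx : Q x ≠ 0) (h : polar Q x y = 0)
    (c : F) : projPerp Q x (c • x + y) = y := by
  rw [map_add, map_smul, projPerp_self h2 hx, projPerp_eq_self h, smul_zero, zero_add]

theorem projPerp_smul {c : F} (hc : c ≠ 0) (x : V) :
    projPerp Q (c • x) = projPerp Q x := by
  ext y
  rw [projPerp_apply, projPerp_apply, map_smul_sq, QuadraticMap.polar_smul_left, smul_smul,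
    smul_eq_mul]
  congr 2
  rcases eq_or_ne (2 * Q x) 0 with h | h
  -- If 2Q(x) = 0, both coefficients vanish by the convention 0⁻¹ = 0.
  · rw [show 2 * (c ^ 2 * Q x) = c ^ 2 * (2 * Q x) by ring, h]; simp
  · have : (2 : F) ≠ 0 := left_ne_zero_of_mul h
    have : Q x ≠ 0 := right_ne_zero_of_mul h
    field_simp

/-- The orthogonal decomposition of a vector along `x` and `x^⊥`. -/
theorem exists_eq_smul_add_projPerp (x y : V) : ∃ c : F, y = c • x + projPerp Q x y :=
  ⟨_, by rw [projPerp_apply]; abel⟩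

theorem map_reflection {x : V} (hx : Q x ≠ 0) (y : V) : Q (reflection Q x y) = Q y := by
  rw [reflection_apply, sub_eq_add_neg, ← neg_smul, add_comm, map_smul_add]
  field_simp; ring

theorem reflection_reflection {x : V} (hx : Q x ≠ 0) (y : V) :
    reflection Q x (reflection Q x y) = y := by
  rw [reflection_apply, reflection_apply, QuadraticMap.polar_sub_right,
    QuadraticMap.polar_smul_right, polar_self_mul, smul_eq_mul, sub_sub, ← add_smul]
  convert sub_zero y
  convert zero_smul F x
  field_simp; ring

theorem det_reflection [Module.Finite F V] {x : V} (hx : Q x ≠ 0) :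
    LinearMap.det (reflection Q x) = -1 := by
  have : reflection Q x = LinearMap.transvection (-((Q x)⁻¹ • Q.polarBilin x)) x := by
    ext y
    simp [reflection, LinearMap.transvection, sub_eq_add_neg]
  rw [this, LinearMap.transvection.det]
  simp only [LinearMap.neg_apply, LinearMap.smul_apply, QuadraticMap.polarBilin_apply_apply,
    polar_self_mul, smul_eq_mul]
  field_simp; ring

/-- The reflection in an anisotropic vector as an automorphism. -/
noncomputable def reflectionEquiv {x : V} (hx : Q x ≠ 0) : V ≃ₗ[F] V :=
  LinearEquiv.ofLinearMap (reflection Q x) (reflection Q x)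
    (LinearMap.ext (reflection_reflection hx)) (LinearMap.ext (reflection_reflection hx))

theorem coe_reflectionEquiv {x : V} (hx : Q x ≠ 0) :
    (reflectionEquiv hx : V →ₗ[F] V) = reflection Q x := rfl

end QuadraticSpace

/-! ### Norm generators, good BONGs and parity of reflections. -/

section Lattice

variable {O F V : Type*} [CommRing O] [IsDomain O] [IsDiscreteValuationRing O]
  [Field F] [Algebra O F] [IsFractionRing O F]
  [AddCommGroup V] [Module F V] [Module O V] [IsScalarTower O F V]
  {Q : QuadraticForm F V} {L M : Submodule O V}

theorem smul_mem_of_ordGE {c : F} {y : V} (hc : OrdGE O 0 c) (hy : y ∈ L) : c • y ∈ L := by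
  obtain ⟨o, rfl⟩ := ordGE_zero_iff.1 hc
  rw [algebraMap_smul]
  exact L.smul_mem o hy

theorem map_mem_norm {y : V} (hy : y ∈ L) : Q y ∈ norm Q L :=
  Submodule.subset_span ⟨y, hy, rfl⟩

theorem isNormGenerator_iff {x : V} {k : ℤ} (hx : OrdEq O k (Q x)) :
    IsNormGenerator Q L x ↔ x ∈ L ∧ ∀ y ∈ L, OrdGE O k (Q y) := by
  refine and_congr_right fun hxL => ⟨fun h y hy => ?_, fun h => le_antisymm ?_ ?_⟩
  · rw [← mem_span_singleton_iff hx, h]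
    exact map_mem_norm hy
  · rw [Submodule.span_singleton_le_iff_mem]
    exact map_mem_norm hxL
  · refine Submodule.span_le.2 ?_
    rintro _ ⟨y, hy, rfl⟩
    exact (mem_span_singleton_iff hx).2 (h y hy)

/-- The lattice of the projections of the vectors of `L` to the orthogonal complement of `x`. -/
abbrev projLattice (Q : QuadraticForm F V) (L : Submodule O V) (x : V) : Submodule O V :=
  L.map ((projPerp Q x).restrictScalars O)

theorem mem_projLattice {x y : V} : y ∈ projLattice Q L x ↔ ∃ z ∈ L, projPerp Q x z = y :=
  Submodule.mem_map

theorem HasGoodBONG.congr {n : ℕ} {a b : ℕ → F} (h : HasGoodBONG Q L n a)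
    (hab : ∀ i, 1 ≤ i → i ≤ n → a i = b i) : HasGoodBONG Q L n b := by
  obtain ⟨x, h1, h2, h3⟩ := h
  exact ⟨x, h1, h2, fun i => (h3 i).trans (hab _ (by omega) (by omega))⟩

theorem hasGoodBONG_zero {a : ℕ → F} : HasGoodBONG Q L 0 a ↔ L = ⊥ :=
  ⟨fun ⟨_, h, _⟩ => h, fun h => ⟨0, h, fun i => i.elim0, fun i => i.elim0⟩⟩

/-- The first vector of a good BONG, and the good BONG of the projection. -/
theorem HasGoodBONG.exists_head {n : ℕ} {a : ℕ → F} (h : HasGoodBONG Q L (n + 1) a) :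
    ∃ x ∈ L, IsNormGenerator Q L x ∧ Q x = a 1 ∧ Q x ≠ 0 ∧
      HasGoodBONG Q (projLattice Q L x) n (fun i => a (i + 1)) ∧
      (2 ≤ n → ord O (a 1) ≤ ord O (a 3)) := by
  obtain ⟨x, ⟨h1, h2, h3⟩, h4, h5⟩ := h
  refine ⟨x 0, h1.1, h1, by simpa using h5 0, h2, ⟨Fin.tail x, h3, ?_, ?_⟩, ?_⟩
  · intro i j hij
    exact h4 i.succ j.succ (by simp [hij])
  · intro i
    simpa [Fin.tail] using h5 i.succ
  · intro hn
    have := h4 ⟨0, by omega⟩ ⟨2, by omega⟩ rfl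
    rwa [h5, h5] at this

/-- A good BONG is obtained from a norm generator and a good BONG of the projection. -/
theorem hasGoodBONG_succ {n : ℕ} {a : ℕ → F} {x : V} {k : ℤ} (hxL : x ∈ L)
    (hx : Q x = a 1) (hk : OrdEq O k (a 1)) (hQ : ∀ y ∈ L, OrdGE O k (Q y))
    (h : HasGoodBONG Q (projLattice Q L x) n (fun i => a (i + 1)))
    (hgood : 2 ≤ n → OrdGE O k (a 3)) : HasGoodBONG Q L (n + 1) a := by
  obtain ⟨z, h1, h2, h3⟩ := h
  refine ⟨Fin.cons x z, ⟨(isNormGenerator_iff (hx ▸ hk)).2 ⟨hxL, hQ⟩, ?_, ?_⟩, ?_, ?_⟩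
  · rw [Fin.cons_zero, hx]; exact hk.ne_zero
  · rw [Fin.cons_zero, Fin.tail_cons]; exact h1
  · intro i j hij
    induction i using Fin.cases with
    | zero =>
      induction j using Fin.cases with
      | zero => simp at hij
      | succ j =>
        rw [Fin.cons_zero, Fin.cons_succ, hx, h3]
        have hj : (j : ℕ) = 1 := by simpa using hij
        have := hgood (by omega)
        rw [hj]
        exact (le_of_eq hk).trans this
    | succ i =>
      induction j using Fin.cases with
      | zero => simp at hij
      | succ j =>
        rw [Fin.cons_succ, Fin.cons_succ]
        exact h2 i j (by simp at hij; omega)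
  · intro i
    induction i using Fin.cases with
    | zero => simpa using hx
    | succ i => rw [Fin.cons_succ, h3]; simp

/-- Good BONGs are transported by linear maps that are isometries on the span of the lattice. -/
theorem HasGoodBONG.map {n : ℕ} {W : Submodule F V} (f : V →ₗ[F] V)
    (hf : ∀ y ∈ W, Q (f y) = Q y) {a : ℕ → F} {L : Submodule O V}
    (hL : ∀ y ∈ L, y ∈ W) (h : HasGoodBONG Q L n a) :
    HasGoodBONG Q (L.map (f.restrictScalars O)) n a := by
  have hpol : ∀ y ∈ W, ∀ z ∈ W, polar Q (f y) (f z) = polar Q y z := by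
    intro y hy z hz
    rw [polar, polar, ← map_add, hf _ (W.add_mem hy hz), hf _ hy, hf _ hz]
  obtain ⟨x, h1, h2, h3⟩ := h
  have key : ∀ (n : ℕ) (L : Submodule O V) (x : Fin n → V), (∀ y ∈ L, y ∈ W) → IsBONG Q n L x →
      IsBONG Q n (L.map (f.restrictScalars O)) (fun i => f (x i)) ∧ ∀ i, Q (f (x i)) = Q (x i) := by
    intro n
    induction n with
    | zero =>
      intro L x _ h
      refine ⟨?_, fun i => i.elim0⟩
      have : L = ⊥ := h
      rw [this]
      exact Submodule.map_bot _
    | succ n ih =>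
      intro L x hL ⟨h1, h2, h3⟩
      have hx : x 0 ∈ W := hL _ h1.1
      obtain ⟨h4, h5⟩ := ih (projLattice Q L (x 0)) (Fin.tail x) (by
        intro y hy
        obtain ⟨z, hz, rfl⟩ := mem_projLattice.1 hy
        rw [projPerp_apply]
        exact W.sub_mem (hL _ hz) (W.smul_mem _ hx)) h3
      refine ⟨⟨⟨Submodule.mem_map_of_mem h1.1, ?_⟩, ?_, ?_⟩, fun i => ?_⟩
      · rw [hf _ hx, h1.2]
        unfold norm
        congr 1
        ext c
        constructor
        · rintro ⟨y, hy, rfl⟩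
          exact ⟨f y, Submodule.mem_map_of_mem hy, hf _ (hL _ hy)⟩
        · rintro ⟨_, ⟨y, hy, rfl⟩, rfl⟩
          exact ⟨y, hy, (hf _ (hL _ hy)).symm⟩
      · rwa [hf _ hx]
      · change IsBONG Q n _ (fun i => f (Fin.tail x i))
        convert h4 using 1
        rw [projLattice, ← Submodule.map_comp, ← Submodule.map_comp]
        ext y
        simp only [Submodule.mem_map]
        refine exists_congr fun z => and_congr_right fun hz => ?_
        simp only [LinearMap.comp_apply, LinearMap.coe_restrictScalars, projPerp_apply, map_sub,
          map_smul, hf _ hx, hpol _ hx _ (hL _ hz)]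
      · induction i using Fin.cases with
        | zero => exact hf _ hx
        | succ i => exact h5 i
  obtain ⟨h4, h5⟩ := key n L x hL h1
  refine ⟨_, h4, fun i j hij => ?_, fun i => ?_⟩
  · rw [h5, h5]; exact h2 i j hij
  · rw [h5]; exact h3 i

/-- The vectors of a lattice whose values have order at least `k`, as a sublattice. -/
def sublatticeOrdGE (Q : QuadraticForm F V) (L : Submodule O V) (k : ℤ)
    (h : ∀ x ∈ L, ∀ y ∈ L, OrdGE O k (polar Q x y)) : Submodule O V where
  carrier := {x | x ∈ L ∧ OrdGE O k (Q x)}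
  zero_mem' := ⟨L.zero_mem, by rw [QuadraticMap.map_zero]; exact OrdGE.zero _⟩
  add_mem' {x y} hx hy := ⟨L.add_mem hx.1 hy.1, by
    rw [map_add_polar]
    exact (hx.2.add hy.2).add (h _ hx.1 _ hy.1)⟩
  smul_mem' c x hx := ⟨L.smul_mem c hx.1, by
    rw [← algebraMap_smul F c x, map_smul_sq]
    exact ((ordGE_algebraMap c).sq.mul hx.2).mono (by omega)⟩

/-- All values of `L` lie in 𝔭^k, so a vector fails to generate the norm exactly when its value
gains at least one order. Every later description of L' starts from this valuation condition. -/
theorem nonNormGenerators_eq {x : V} {k : ℤ} (hx : OrdEq O k (Q x)) (h : IsNormGenerator Q L x) :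
    nonNormGenerators Q L = {y | y ∈ L ∧ OrdGE O (k + 1) (Q y)} := by
  have h1 := ((isNormGenerator_iff hx).1 h).2
  ext y
  refine and_congr_right fun hy => ?_
  constructor
  · intro h2
    rcases (h1 y hy).eq_or with h3 | h3
    · exact absurd ((isNormGenerator_iff h3).2 ⟨hy, h1⟩) h2
    · exact h3
  · rintro h2 ⟨_, h3⟩
    -- Isotropic vectors have no finite order and are treated apart: they would generate the zero
    -- ideal.
    rcases eq_or_ne (Q y) 0 with h0 | h0
    · have : Q x ∈ norm Q L := map_mem_norm h.1
      rw [← h3, h0, Submodule.mem_span_singleton] at this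
      obtain ⟨c, hc⟩ := this
      rw [smul_zero] at hc
      exact hx.ne_zero hc.symm
    obtain ⟨l, hl⟩ := exists_ordEq (O := O) h0
    have : Q x ∈ norm Q L := map_mem_norm h.1
    rw [← h3, mem_span_singleton_iff hl] at this
    have := hx.le_of_ge this
    have := hl.le_of_ge h2
    omega

theorem ordGE_polar {k : ℤ} (h : ∀ y ∈ L, OrdGE O k (Q y)) {y z : V} (hy : y ∈ L) (hz : z ∈ L) :
    OrdGE O k (polar Q y z) :=
  ((h _ (L.add_mem hy hz)).sub (h _ hy)).sub (h _ hz)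

/-- A vector of a lattice whose reflection preserves the lattice has a value of order congruent
to `r` modulo `2`. -/
def ReflectionParity (Q : QuadraticForm F V) (L : Submodule O V) (r : ℤ) : Prop :=
  ∀ x ∈ L, ∀ k, OrdEq O k (Q x) → (∀ y ∈ L, OrdGE O k (polar Q x y)) → Even (k - r)

theorem reflection_mem {x : V} {k : ℤ} (hxL : x ∈ L) (hx : OrdEq O k (Q x))
    (h : ∀ y ∈ L, OrdGE O k (polar Q x y)) {y : V} (hy : y ∈ L) : reflection Q x y ∈ L := by
  rw [reflection_apply]
  exact L.sub_mem hy (smul_mem_of_ordGE ((hx.inv.ge.mul (h y hy)).mono (by omega)) hxL)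

/-- The reflection in the norm generator x preserves `L`. Composing it with the given reflection in
z yields a rotation of `L` with spinor norm Q(z)Q(x), which must have even order. -/
theorem reflectionParity_of_spinorNorms [Module.Finite F V] {x : V} {r : ℤ}
    (hx : OrdEq O r (Q x)) (h : IsNormGenerator Q L x)
    (hθ : spinorNorms Q L ⊆ unitSquares O) : ReflectionParity Q L r := by
  intro z hz k hk hpol
  have hQ := ((isNormGenerator_iff hx).1 h).2
  have hx0 := hx.ne_zero
  have hz0 := hk.ne_zero
  have hm1 : ∀ y ∈ L, reflection Q x y ∈ L := fun y hy =>
    reflection_mem h.1 hx (fun w hw => ordGE_polar hQ h.1 hw) hy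
  have hm2 : ∀ y ∈ L, reflection Q z y ∈ L := fun y hy => reflection_mem hz hk hpol hy
  have hmem : Q z * Q x ∈ spinorNorms Q L := by
    refine ⟨(reflectionEquiv hx0).trans (reflectionEquiv hz0), ⟨?_, ?_, ?_⟩, [z, x], ?_, ?_, 1,
      one_ne_zero, ?_⟩
    · intro y
      exact (map_reflection hz0 _).trans (map_reflection hx0 y)
    · rw [LinearEquiv.coe_trans, LinearMap.det_comp, coe_reflectionEquiv, coe_reflectionEquiv,
        det_reflection hx0, det_reflection hz0]
      norm_num
    · apply le_antisymm
      · rintro _ ⟨y, hy, rfl⟩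
        exact hm2 _ (hm1 _ hy)
      · intro y hy
        refine ⟨reflection Q x (reflection Q z y), hm1 _ (hm2 _ hy), ?_⟩
        change reflection Q z (reflection Q x (reflection Q x (reflection Q z y))) = y
        rw [reflection_reflection hx0, reflection_reflection hz0]
    · intro y hy
      simp only [List.mem_cons, List.not_mem_nil, or_false] at hy
      rcases hy with rfl | rfl <;> assumption
    · ext y
      simp [reflectionEquiv]
    · simp
  obtain ⟨u, t, hu, ht, hut⟩ := hθ hmem
  obtain ⟨j, hj⟩ := exists_ordEq (O := O) ht
  have h1 := hk.mul hx
  rw [hut] at h1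
  have := h1.unique (OrdEq.mul (show OrdEq O 0 u from hu) hj.sq)
  exact ⟨j - r, by omega⟩

end Lattice

/-! ### The first two vectors of a BONG, splittings and the scale. -/

section HeadPair

variable {O F V : Type*} [CommRing O] [IsDomain O] [IsDiscreteValuationRing O]
  [Field F] [Algebra O F] [IsFractionRing O F]
  [AddCommGroup V] [Module F V] [Module O V] [IsScalarTower O F V]
  {Q : QuadraticForm F V} {L K L₂ : Submodule O V}

/-- The values of a good BONG have the orders `R 1, …, R n`. -/
def HasOrders (O : Type*) {F : Type*} [CommRing O] [IsDomain O] [IsDiscreteValuationRing O]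
    [Field F] [Algebra O F] [IsFractionRing O F] (n : ℕ) (a : ℕ → F) (R : ℕ → ℤ) : Prop :=
  ∀ i, 1 ≤ i → i ≤ n → OrdEq O (R i) (a i)

theorem HasOrders.shift {n : ℕ} {a : ℕ → F} {R : ℕ → ℤ} (m : ℕ) (h : HasOrders O (n + m) a R) :
    HasOrders O n (fun i => a (i + m)) (fun i => R (i + m)) :=
  fun i h1 h2 => h (i + m) (by omega) (by omega)

theorem HasGoodBONG.le_add_two {n : ℕ} {a : ℕ → F} {R : ℕ → ℤ} (h : HasGoodBONG Q L n a)
    (hR : HasOrders O n a R) {i : ℕ} (hi : 1 ≤ i) (hin : i + 2 ≤ n) : R i ≤ R (i + 2) := by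
  obtain ⟨x, _, h2, h3⟩ := h
  have h4 := h2 ⟨i - 1, by omega⟩ ⟨i + 1, by omega⟩ (by simp; omega)
  have h5 : OrdEq O (R i) (Q (x ⟨i - 1, by omega⟩)) := by
    rw [h3]; convert hR i hi (by omega) using 2; simp; omega
  have h6 : OrdEq O (R (i + 2)) (Q (x ⟨i + 1, by omega⟩)) := by
    rw [h3]; exact hR (i + 2) (by omega) (by omega)
  unfold OrdEq at h5 h6
  rw [h5, h6] at h4
  exact_mod_cast h4

theorem HasGoodBONG.ordGE {n : ℕ} {a : ℕ → F} {r s : ℤ} (h : HasGoodBONG Q L n a)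
    (hr : 1 ≤ n → OrdEq O s (a 1) ∧ r ≤ s) : ∀ y ∈ L, OrdGE O r (Q y) := by
  intro y hy
  cases n with
  | zero =>
    rw [hasGoodBONG_zero.1 h] at hy
    rw [(Submodule.mem_bot O).1 hy, QuadraticMap.map_zero]
    exact OrdGE.zero _
  | succ n =>
    obtain ⟨x, _, h2, h3, _⟩ := h.exists_head
    obtain ⟨h4, h5⟩ := hr (by omega)
    exact (((isNormGenerator_iff (h3 ▸ h4)).1 h2).2 y hy).mono h5

/-- The first two vectors of a BONG of `L` and the lattices obtained by projection. -/
structure HeadPair (Q : QuadraticForm F V) (L : Submodule O V) (r s : ℤ) (x₁ x₂ : V)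
    (L₂ K : Submodule O V) : Prop where
  mem₁ : x₁ ∈ L
  ord₁ : OrdEq O r (Q x₁)
  norm₁ : ∀ y ∈ L, OrdGE O r (Q y)
  proj₁ : L₂ = projLattice Q L x₁
  mem₂ : x₂ ∈ L₂
  ord₂ : OrdEq O s (Q x₂)
  norm₂ : ∀ y ∈ L₂, OrdGE O s (Q y)
  proj₂ : K = projLattice Q L₂ x₂

theorem HasGoodBONG.exists_first {n : ℕ} {a : ℕ → F} {R : ℕ → ℤ}
    (h : HasGoodBONG Q L (n + 1) a) (hR : HasOrders O (n + 1) a R) :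
    ∃ x ∈ L, Q x = a 1 ∧ OrdEq O (R 1) (Q x) ∧ (∀ y ∈ L, OrdGE O (R 1) (Q y)) ∧
      IsNormGenerator Q L x ∧
      HasGoodBONG Q (projLattice Q L x) n (fun i => a (i + 1)) := by
  obtain ⟨x, h1, h2, h3, _, h5, _⟩ := h.exists_head
  have h6 : OrdEq O (R 1) (Q x) := h3 ▸ hR 1 le_rfl (by omega)
  exact ⟨x, h1, h3, h6, ((isNormGenerator_iff h6).1 h2).2, h2, h5⟩

theorem HasGoodBONG.exists_headPair {n : ℕ} {a : ℕ → F} {R : ℕ → ℤ}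
    (h : HasGoodBONG Q L (n + 2) a) (hR : HasOrders O (n + 2) a R) :
    ∃ x₁ x₂ L₂ K, HeadPair Q L (R 1) (R 2) x₁ x₂ L₂ K ∧ Q x₁ = a 1 ∧ Q x₂ = a 2 ∧
      HasGoodBONG Q L₂ (n + 1) (fun i => a (i + 1)) ∧ HasGoodBONG Q K n (fun i => a (i + 2)) := by
  obtain ⟨x₁, h1, h2, h3, h4, _, h5⟩ := h.exists_first hR
  obtain ⟨x₂, h6, h7, h8, h9, _, h10⟩ := h5.exists_first (hR.shift (n := n + 1) 1)
  exact ⟨x₁, x₂, _, _, ⟨h1, h3, h4, rfl, h6, h8, h9, rfl⟩, h2, h7, h5, h10⟩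

theorem polar_of_mem_projLattice (h2 : (2 : F) ≠ 0) {x y : V} (hx : Q x ≠ 0)
    (hy : y ∈ projLattice Q L x) : polar Q x y = 0 := by
  obtain ⟨z, _, rfl⟩ := mem_projLattice.1 hy
  exact polar_projPerp h2 hx z

theorem exists_decomp_of_mem {x y : V} (hy : y ∈ L) :
    ∃ c : F, ∃ y' ∈ projLattice Q L x, y = c • x + y' := by
  obtain ⟨c, hc⟩ := exists_eq_smul_add_projPerp (Q := Q) x y
  exact ⟨c, _, mem_projLattice.2 ⟨y, hy, rfl⟩, hc⟩

theorem exists_lift_of_mem_projLattice {x y : V} (hy : y ∈ projLattice Q L x) :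
    ∃ c : F, c • x + y ∈ L := by
  obtain ⟨z, hz, rfl⟩ := mem_projLattice.1 hy
  obtain ⟨c, hc⟩ := exists_eq_smul_add_projPerp (Q := Q) x z
  exact ⟨c, hc ▸ hz⟩

/-- By orthogonality c²Q(x) = Q(cx + y) - Q(y). This is how bounds on norms become integrality of
coefficients, and thereby orthogonal splittings of lattices. -/
theorem ordGE_of_smul_add {x y : V} {c : F} {r : ℤ} (h : polar Q x y = 0)
    (hx : OrdEq O r (Q x)) (hQ : OrdGE O r (Q (c • x + y))) (hy : OrdGE O r (Q y)) :
    OrdGE O 0 c := by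
  rw [map_smul_add_of_polar_eq_zero Q c h] at hQ
  have := hQ.sub hy
  rw [add_sub_cancel_right] at this
  exact (this.of_mul_right hx (m := 0) (by omega)).of_sq (by omega)

namespace HeadPair

variable {r s e : ℤ} {x₁ x₂ : V} (H : HeadPair Q L r s x₁ x₂ L₂ K) (h2 : (2 : F) ≠ 0)

include H h2

theorem polar₁ {y : V} (hy : y ∈ L₂) : polar Q x₁ y = 0 :=
  polar_of_mem_projLattice h2 H.ord₁.ne_zero (H.proj₁ ▸ hy)

theorem polar₁₂ : polar Q x₁ x₂ = 0 := H.polar₁ h2 H.mem₂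

theorem polarK₂ {y : V} (hy : y ∈ K) : polar Q x₂ y = 0 :=
  polar_of_mem_projLattice h2 H.ord₂.ne_zero (H.proj₂ ▸ hy)

theorem polarK₁ {y : V} (hy : y ∈ K) : polar Q x₁ y = 0 := by
  obtain ⟨c, hc⟩ := exists_lift_of_mem_projLattice (H.proj₂ ▸ hy)
  have := H.polar₁ h2 hc
  rwa [QuadraticMap.polar_add_right, QuadraticMap.polar_smul_right, H.polar₁₂ h2, smul_zero,
    zero_add] at this

omit h2 in
theorem exists_lift₂ : ∃ b : F, b • x₁ + x₂ ∈ L :=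
  exists_lift_of_mem_projLattice (H.proj₁ ▸ H.mem₂)

omit h2 in
theorem exists_decomp₁ {y : V} (hy : y ∈ L) : ∃ c : F, ∃ y' ∈ L₂, y = c • x₁ + y' :=
  H.proj₁ ▸ exists_decomp_of_mem hy

omit h2 in
theorem exists_decomp₂ {y : V} (hy : y ∈ L₂) : ∃ c : F, ∃ y' ∈ K, y = c • x₂ + y' :=
  H.proj₂ ▸ exists_decomp_of_mem hy

theorem mem₂_of_eq {y y' : V} {c : F} (hy : y ∈ L) (hyc : y = c • x₁ + y')
    (h : polar Q x₁ y' = 0) : y' ∈ L₂ := by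
  rw [H.proj₁]
  exact mem_projLattice.2 ⟨y, hy, by rw [hyc, projPerp_smul_add h2 H.ord₁.ne_zero h]⟩

/-- If the norm of the projection is contained in the norm, then the norm generator splits. -/
theorem le_of_norm (hn : r ≤ s) : L₂ ≤ L := by
  intro y hy
  obtain ⟨c, hc⟩ := exists_lift_of_mem_projLattice (H.proj₁ ▸ hy)
  have h1 := ordGE_of_smul_add (H.polar₁ h2 hy) H.ord₁ (H.norm₁ _ hc) ((H.norm₂ _ hy).mono hn)
  have := L.sub_mem hc (smul_mem_of_ordGE h1 H.mem₁)
  rwa [add_sub_cancel_left] at this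

theorem exists_integral_decomp₁ (hn : r ≤ s) {y : V} (hy : y ∈ L) :
    ∃ c : F, OrdGE O 0 c ∧ ∃ y' ∈ L₂, y = c • x₁ + y' := by
  obtain ⟨c, y', hy', rfl⟩ := H.exists_decomp₁ hy
  exact ⟨c, ordGE_of_smul_add (H.polar₁ h2 hy') H.ord₁ (H.norm₁ _ hy)
    ((H.norm₂ _ hy').mono hn), y', hy', rfl⟩

omit h2 in
theorem exists_decomp {y : V} (hy : y ∈ L) :
    ∃ α β : F, ∃ k ∈ K, β • x₂ + k ∈ L₂ ∧ y = α • x₁ + (β • x₂ + k) := by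
  obtain ⟨α, y', hy', rfl⟩ := H.exists_decomp₁ hy
  obtain ⟨β, k, hk, rfl⟩ := H.exists_decomp₂ hy'
  exact ⟨α, β, k, hk, hy', rfl⟩

theorem map_eq {α β : F} {k : V} (hk : k ∈ K) :
    Q (α • x₁ + (β • x₂ + k)) = α ^ 2 * Q x₁ + (β ^ 2 * Q x₂ + Q k) := by
  rw [map_smul_add_of_polar_eq_zero, map_smul_add_of_polar_eq_zero Q _ (H.polarK₂ h2 hk)]
  rw [QuadraticMap.polar_add_right, QuadraticMap.polar_smul_right, H.polar₁₂ h2,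
    H.polarK₁ h2 hk, smul_zero, zero_add]

theorem map_pair {α β : F} : Q (α • x₁ + β • x₂) = α ^ 2 * Q x₁ + β ^ 2 * Q x₂ := by
  have := H.map_eq h2 (α := α) (β := β) K.zero_mem
  simpa using this

theorem map_lift {b : F} : Q (b • x₁ + x₂) = b ^ 2 * Q x₁ + Q x₂ := by
  have := H.map_pair h2 (α := b) (β := 1)
  simpa using this

/-- If the norm of `K` is contained in the norms of `L` and `L₂`, then `K` splits `L`. -/
theorem le_of_norm₂ (hr : ∀ k ∈ K, OrdGE O r (Q k)) (hs : ∀ k ∈ K, OrdGE O s (Q k)) : K ≤ L := by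
  intro k hk
  obtain ⟨β, hβ⟩ := exists_lift_of_mem_projLattice (H.proj₂ ▸ hk)
  have h1 := ordGE_of_smul_add (H.polarK₂ h2 hk) H.ord₂ (H.norm₂ _ hβ) (hs k hk)
  have hk2 : k ∈ L₂ := by
    have := L₂.sub_mem hβ (smul_mem_of_ordGE h1 H.mem₂)
    rwa [add_sub_cancel_left] at this
  obtain ⟨c, hc⟩ := exists_lift_of_mem_projLattice (H.proj₁ ▸ hk2)
  have h3 := ordGE_of_smul_add (H.polar₁ h2 hk2) H.ord₁ (H.norm₁ _ hc) (hr k hk)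
  have := L.sub_mem hc (smul_mem_of_ordGE h3 H.mem₁)
  rwa [add_sub_cancel_left] at this

theorem exists_integral_decomp (hr : ∀ k ∈ K, OrdGE O r (Q k)) (hs : ∀ k ∈ K, OrdGE O s (Q k))
    {b : F} (hb : b • x₁ + x₂ ∈ L) {y : V} (hy : y ∈ L) :
    ∃ u c : F, OrdGE O 0 u ∧ OrdGE O 0 c ∧ ∃ k ∈ K, y = u • x₁ + c • (b • x₁ + x₂) + k := by
  obtain ⟨α, β, k, hk, hL₂, rfl⟩ := H.exists_decomp hy
  have h1 := ordGE_of_smul_add (H.polarK₂ h2 hk) H.ord₂ (H.norm₂ _ hL₂) (hs k hk)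
  have h3 : (α - β * b) • x₁ + k ∈ L := by
    have := L.sub_mem hy (smul_mem_of_ordGE h1 hb)
    convert this using 1
    module
  refine ⟨α - β * b, β, ordGE_of_smul_add (H.polarK₁ h2 hk) H.ord₁ (H.norm₁ _ h3) (hr k hk), h1,
    k, hk, by module⟩

/-- The binary component of a lattice consists of the integral combinations whose second
coefficient is integral. -/
theorem pair_mem {b α β : F} (hb : b • x₁ + x₂ ∈ L) (hβ : OrdGE O 0 β)
    (hα : OrdGE O 0 (α - β * b)) : α • x₁ + β • x₂ ∈ L := by
  have := L.add_mem (smul_mem_of_ordGE hα H.mem₁) (smul_mem_of_ordGE hβ hb)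
  convert this using 1
  module

/-- The polar value with x₁ itself is 2αQ(x₁), and polar values of `L` lie in the norm ideal. -/
theorem ordGE_two_mul {α : F} {y' : V} (h : polar Q x₁ y' = 0) (hy : α • x₁ + y' ∈ L) :
    OrdGE O 0 (2 * α) := by
  have h1 := ordGE_polar H.norm₁ H.mem₁ hy
  rw [QuadraticMap.polar_add_right, QuadraticMap.polar_smul_right, h, polar_self_mul, add_zero,
    smul_eq_mul, ← mul_assoc] at h1
  rw [mul_comm 2]
  exact h1.of_mul_right H.ord₁ (by omega)

theorem lift_ordGE {b : F} (hb : b • x₁ + x₂ ∈ L) :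
    OrdGE O 0 (2 * b) ∧ OrdGE O r (b ^ 2 * Q x₁ + Q x₂) := by
  refine ⟨H.ordGE_two_mul h2 (H.polar₁₂ h2) hb, ?_⟩
  rw [← H.map_lift h2]
  exact H.norm₁ _ hb

/-- Some bx₁ + x₂ lies in `L`, with ord b ≥ -e and b²Q(x₁) + Q(x₂) of order at least r. If s < r -
2e, nothing can cancel the leading term of Q(x₂). If s < r, the term b²Q(x₁) cancels it, which
forces s ≡ r mod 2. -/
theorem adjacent (he : OrdEq O e (2 : F)) : r - 2 * e ≤ s ∧ (Odd (s - r) → r < s) := by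
  obtain ⟨b, hb⟩ := H.exists_lift₂
  obtain ⟨h3, h4⟩ := H.lift_ordGE h2 hb
  have h3 : OrdGE O (-e) b := h3.of_mul_left he (by omega)
  have h5 : b ^ 2 * Q x₁ + Q x₂ - b ^ 2 * Q x₁ = Q x₂ := by ring
  constructor
  · by_contra h
    have he0 := he.le_of_ge ordGE_zero_two
    have h6 : OrdGE O (s + 1) (b ^ 2 * Q x₁) := (h3.sq.mul H.ord₁.ge).mono (by omega)
    have := (h4.mono (by omega : s + 1 ≤ r)).sub h6
    rw [h5] at this
    exact H.ord₂.not_ge (by omega) this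
  · intro hodd
    by_contra h
    have hb0 : b ≠ 0 := by
      rintro rfl
      have : OrdGE O r (Q x₂) := by simpa using h4
      have := H.ord₂.le_of_ge this
      have : s - r = 0 := by omega
      rw [this] at hodd
      exact absurd hodd (by decide)
    obtain ⟨j, hj⟩ := exists_ordEq (O := O) hb0
    have h6 : OrdEq O s (b ^ 2 * Q x₁) := by
      refine H.ord₂.of_add_ge ?_
      rw [add_comm (Q x₂)]
      obtain ⟨i, hi⟩ := hodd
      exact h4.mono (show s + 1 ≤ r by omega)
    have := h6.unique (hj.sq.mul H.ord₁)
    obtain ⟨i, hi⟩ := hodd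
    omega

end HeadPair

/-- Tails of good BONGs are good BONGs of iterated projections, so facts about the first pair of
vectors transfer to every consecutive pair. -/
theorem HasGoodBONG.exists_drop {a : ℕ → F} {R : ℕ → ℤ} (m : ℕ) :
    ∀ {n : ℕ} {L : Submodule O V}, HasGoodBONG Q L (n + m) a → HasOrders O (n + m) a R →
      ∃ M : Submodule O V, HasGoodBONG Q M n (fun i => a (i + m)) := by
  induction m with
  | zero => exact fun h _ => ⟨_, h⟩
  | succ m ih =>
    intro n L h hR
    obtain ⟨M, hM⟩ := ih (n := n + 1) (by rwa [add_right_comm, add_assoc])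
      (by rwa [add_right_comm, add_assoc])
    obtain ⟨x, _, _, _, _, _, hx⟩ := hM.exists_first
      (HasOrders.shift m (by rwa [add_right_comm, add_assoc]))
    refine ⟨_, hx.congr fun i _ _ => ?_⟩
    rw [add_right_comm, add_assoc]

theorem HasGoodBONG.adjacent {n : ℕ} {a : ℕ → F} {R : ℕ → ℤ} {e : ℤ} (h : HasGoodBONG Q L n a)
    (hR : HasOrders O n a R) (he : OrdEq O e (2 : F)) {i : ℕ} (hi : 1 ≤ i) (hin : i + 1 ≤ n) :
    R i - 2 * e ≤ R (i + 1) ∧ (Odd (R (i + 1) - R i) → R i < R (i + 1)) := by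
  obtain ⟨j, rfl⟩ := Nat.exists_eq_add_of_le' hi
  obtain ⟨m, rfl⟩ := Nat.exists_eq_add_of_le' hin
  obtain ⟨M, hM⟩ := HasGoodBONG.exists_drop (n := m + 2) j (by convert h using 1; omega)
    (by convert hR using 1; omega)
  obtain ⟨x₁, x₂, L₂, K, H, _⟩ := hM.exists_headPair
    (HasOrders.shift (n := m + 2) j (by convert hR using 1; omega))
  have := H.adjacent he.ne_zero he
  rw [show j + 1 + 1 = 2 + j by omega, show j + 1 = 1 + j by omega]
  exact this

/-- The scale of a lattice in terms of the first two orders of a good BONG. -/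
theorem HasGoodBONG.ordGE_polar_of_le {e : ℤ} (he : OrdEq O e (2 : F)) (n : ℕ) :
    ∀ {L : Submodule O V} {a : ℕ → F} {R : ℕ → ℤ}, HasGoodBONG Q L n a → HasOrders O n a R →
      ∀ k : ℤ, (1 ≤ n → k ≤ R 1 + e) → (2 ≤ n → 2 * k ≤ R 1 + R 2 + 2 * e) →
      ∀ y ∈ L, ∀ z ∈ L, OrdGE O k (polar Q y z) := by
  have h2 := he.ne_zero
  induction n using Nat.strong_induction_on with
  | _ n ih =>
  intro L a R h hR k hk1 hk2 y hy z hz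
  rcases n with - | - | n
  · rw [hasGoodBONG_zero.1 h] at hy
    rw [(Submodule.mem_bot O).1 hy, QuadraticMap.polar_zero_left]
    exact OrdGE.zero _
  · obtain ⟨x, hx, _, hx', hQ, _, hK⟩ := h.exists_first hR
    have key : ∀ y ∈ L, ∃ c : F, OrdGE O 0 c ∧ y = c • x := by
      intro y hy
      obtain ⟨c, y', hy', rfl⟩ := exists_decomp_of_mem (Q := Q) (x := x) hy
      rw [hasGoodBONG_zero.1 hK, Submodule.mem_bot] at hy'
      subst hy'
      refine ⟨c, ordGE_of_smul_add (y := 0) (QuadraticMap.polar_zero_right ..) hx' (hQ _ hy) ?_,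
        add_zero _⟩
      rw [QuadraticMap.map_zero]; exact OrdGE.zero _
    obtain ⟨c, hc, rfl⟩ := key y hy
    obtain ⟨d, hd, rfl⟩ := key z hz
    rw [QuadraticMap.polar_smul_left, QuadraticMap.polar_smul_right, polar_self_mul, smul_eq_mul,
      smul_eq_mul]
    have := hk1 le_rfl
    exact (hc.mul (hd.mul (he.ge.mul hx'.ge))).mono (by omega)
  · obtain ⟨x₁, x₂, L₂, K, H, _, _, hL₂, hK⟩ := h.exists_headPair hR
    have hk1 := hk1 (by omega)
    have hk2 := hk2 (by omega)
    have h13 : 1 ≤ n → R 1 ≤ R 3 := fun hn => h.le_add_two hR le_rfl (by omega)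
    have h24 : 2 ≤ n → R 2 ≤ R 4 := fun hn => h.le_add_two hR (by omega) (by omega)
    rcases lt_or_ge (R 1) (R 2) with hlt | hle
    -- Here x₁ splits off. The induction hypothesis applies to `L₂`, because R 1 ≤ R 3 and R 1 < R 2
    -- carry the bounds on k over.
    · obtain ⟨c, hc, y', hy', rfl⟩ := H.exists_integral_decomp₁ h2 hlt.le hy
      obtain ⟨d, hd, z', hz', rfl⟩ := H.exists_integral_decomp₁ h2 hlt.le hz
      rw [polar_smul_add_left, QuadraticMap.polar_add_right, QuadraticMap.polar_add_right,
        QuadraticMap.polar_smul_right, QuadraticMap.polar_smul_right, H.polar₁ h2 hz',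
        QuadraticMap.polar_comm Q y' x₁, H.polar₁ h2 hy', polar_self_mul, smul_zero, zero_add,
        add_zero, smul_eq_mul]
      refine OrdGE.add ((hc.mul (hd.mul (he.ge.mul H.ord₁.ge))).mono (by omega)) ?_
      refine ih (n + 1) (by omega) hL₂ (hR.shift (n := n + 1) 1) k (fun _ => ?_) (fun hn => ?_)
        y' hy' z' hz'
      · change k ≤ R 2 + e; omega
      · change 2 * k ≤ R 2 + R 3 + 2 * e
        have := h13 (by omega)
        omega
    -- Now R 2 ≤ R 1 ≤ R 3, so the whole binary component splits off and the induction continues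
    -- with `K`.
    · have hr : ∀ k ∈ K, OrdGE O (R 1) (Q k) := hK.ordGE fun hn =>
        ⟨hR 3 (by omega) (by omega), h13 hn⟩
      have hs : ∀ k ∈ K, OrdGE O (R 2) (Q k) := fun k hk => (hr k hk).mono hle
      obtain ⟨b, hb⟩ := H.exists_lift₂
      obtain ⟨u, c, hu, hc, y', hy', rfl⟩ := H.exists_integral_decomp h2 hr hs hb hy
      obtain ⟨v, d, hv, hd, z', hz', rfl⟩ := H.exists_integral_decomp h2 hr hs hb hz
      have hpol : polar Q (u • x₁ + c • (b • x₁ + x₂) + y') (v • x₁ + d • (b • x₁ + x₂) + z') =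
          u * v * (2 * Q x₁) + (u * d + v * c) * (2 * b * Q x₁) + c * d * (2 * Q (b • x₁ + x₂)) +
            polar Q y' z' := by
        rw [H.map_lift h2]
        simp only [QuadraticMap.polar_add_right, QuadraticMap.polar_add_left,
          QuadraticMap.polar_smul_left, QuadraticMap.polar_smul_right, smul_eq_mul, H.polarK₁ h2 hy',
          H.polarK₁ h2 hz', H.polarK₂ h2 hy', H.polarK₂ h2 hz', QuadraticMap.polar_comm Q y' x₁,
          QuadraticMap.polar_comm Q y' x₂, QuadraticMap.polar_comm Q x₂ x₁, H.polar₁₂ h2,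
          polar_self_mul]
        ring
      obtain ⟨_, hb2⟩ := H.lift_ordGE h2 hb
      have hbsq : OrdGE O (R 2 - R 1) (b ^ 2) := by
        have := (hb2.mono hle).sub H.ord₂.ge
        rw [add_sub_cancel_right] at this
        exact this.of_mul_right H.ord₁ le_rfl
      have h3 : OrdGE O k (2 * b * Q x₁) := by
        have h4 : OrdGE O (k - e - R 1) b := hbsq.of_sq (by omega)
        exact ((he.ge.mul h4).mul H.ord₁.ge).mono (by omega)
      rw [hpol]
      refine (((?_ : OrdGE O k _).add ?_).add ?_).add ?_
      · exact ((hu.mul hv).mul (he.ge.mul H.ord₁.ge)).mono (by omega)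
      · exact (((hu.mul hd).add (hv.mul hc)).mul h3).mono (by omega)
      · exact ((hc.mul hd).mul (he.ge.mul (H.norm₁ _ hb))).mono (by omega)
      · refine ih n (by omega) hK (hR.shift (n := n) 2) k (fun hn => ?_) (fun hn => ?_)
          y' hy' z' hz'
        · change k ≤ R 3 + e
          have := h13 hn
          omega
        · change 2 * k ≤ R 3 + R 4 + 2 * e
          have := h13 (by omega)
          have := h24 hn
          omega

/-- Unless `R 2 - R 1 = -2e`, the scale ideal of `2B` is smaller than the norm. -/
theorem HasGoodBONG.ordGE_polar_succ {e : ℤ} (he : OrdEq O e (2 : F)) (he1 : 1 ≤ e) {n : ℕ}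
    {a : ℕ → F} {R : ℕ → ℤ} (h : HasGoodBONG Q L n a) (hR : HasOrders O n a R)
    (h12 : 2 ≤ n → R 1 - 2 * e < R 2) :
    ∀ y ∈ L, ∀ z ∈ L, OrdGE O (R 1 + 1) (polar Q y z) := by
  refine h.ordGE_polar_of_le he n hR _ (fun _ => by omega) fun hn => ?_
  have h3 : Odd (R 2 - R 1) → R 1 < R 2 := (h.adjacent hR he (i := 1) le_rfl (by omega)).2
  have h4 := h12 hn
  -- For an even difference the strict inequality improves to R 2 - R 1 ≥ 2 - 2e, which is exactly
  -- what is needed. An odd difference forces R 1 < R 2, and e ≥ 1 suffices.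
  rcases Int.even_or_odd (R 2 - R 1) with ⟨i, hi⟩ | ho
  · omega
  · have := h3 ho
    obtain ⟨i, hi⟩ := ho
    omega

end HeadPair

/-! ### Binary components and maximality. -/

section Binary

variable {O F V : Type*} [CommRing O] [IsDomain O] [IsDiscreteValuationRing O]
  [Field F] [Algebra O F] [IsFractionRing O F]
  [AddCommGroup V] [Module F V] [Module O V] [IsScalarTower O F V]
  {Q : QuadraticForm F V} {L M K L₂ : Submodule O V}

/-- A good BONG of a lattice that is spanned by a binary lattice `O w₁ + O (b w₁ + w₂)` and an
orthogonal lattice `K`. -/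
theorem hasGoodBONG_of_decomp (h2 : (2 : F) ≠ 0) {n : ℕ} {a : ℕ → F} {w₁ w₂ : V} {b : F} {r s : ℤ}
    (hw₁ : w₁ ∈ M) (hw₂ : b • w₁ + w₂ ∈ M) (hKM : K ≤ M)
    (p₁₂ : polar Q w₁ w₂ = 0) (p₁ : ∀ k ∈ K, polar Q w₁ k = 0) (p₂ : ∀ k ∈ K, polar Q w₂ k = 0)
    (hdec : ∀ y ∈ M, ∃ u c : F, OrdGE O 0 u ∧ OrdGE O 0 c ∧ ∃ k ∈ K,
      y = u • w₁ + c • (b • w₁ + w₂) + k)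
    (hQ₁ : Q w₁ = a 1) (hQ₂ : Q w₂ = a 2) (ho₁ : OrdEq O r (a 1)) (ho₂ : OrdEq O s (a 2))
    (hb : OrdGE O r (b ^ 2 * a 1 + a 2)) (hb2 : OrdGE O 0 (2 * b))
    (hKr : ∀ k ∈ K, OrdGE O r (Q k)) (hKs : ∀ k ∈ K, OrdGE O s (Q k))
    (hK : HasGoodBONG Q K n (fun i => a (i + 2))) (h3 : 1 ≤ n → OrdGE O r (a 3))
    (h4 : 2 ≤ n → OrdGE O s (a 4)) : HasGoodBONG Q M (n + 2) a := by
  have hw10 : Q w₁ ≠ 0 := hQ₁ ▸ ho₁.ne_zero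
  have hw20 : Q w₂ ≠ 0 := hQ₂ ▸ ho₂.ne_zero
  have p₁' : ∀ c : F, ∀ k ∈ K, polar Q w₁ (c • w₂ + k) = 0 := by
    intro c k hk
    rw [QuadraticMap.polar_add_right, QuadraticMap.polar_smul_right, p₁₂, p₁ k hk, smul_zero,
      zero_add]
  have hproj : ∀ u c : F, ∀ k ∈ K,
      projPerp Q w₁ (u • w₁ + c • (b • w₁ + w₂) + k) = c • w₂ + k := by
    intro u c k hk
    rw [show u • w₁ + c • (b • w₁ + w₂) + k = (u + c * b) • w₁ + (c • w₂ + k) by module,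
      projPerp_smul_add h2 hw10 (p₁' c k hk)]
  have hmem : ∀ y, y ∈ projLattice Q M w₁ ↔ ∃ c : F, OrdGE O 0 c ∧ ∃ k ∈ K, y = c • w₂ + k := by
    intro y
    rw [mem_projLattice]
    constructor
    · rintro ⟨z, hz, rfl⟩
      obtain ⟨u, c, _, hc, k, hk, rfl⟩ := hdec z hz
      exact ⟨c, hc, k, hk, hproj u c k hk⟩
    · rintro ⟨c, hc, k, hk, rfl⟩
      exact ⟨_, M.add_mem (M.add_mem (smul_mem_of_ordGE (OrdGE.zero 0) hw₁)
        (smul_mem_of_ordGE hc hw₂)) (hKM hk), hproj 0 c k hk⟩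
  refine hasGoodBONG_succ (n := n + 1) hw₁ hQ₁ ho₁ ?_ ?_ fun hn => h3 (by omega)
  · intro y hy
    obtain ⟨u, c, hu, hc, k, hk, rfl⟩ := hdec y hy
    rw [show u • w₁ + c • (b • w₁ + w₂) + k = (u + c * b) • w₁ + (c • w₂ + k) by module,
      map_smul_add_of_polar_eq_zero Q _ (p₁' c k hk), map_smul_add_of_polar_eq_zero Q _ (p₂ k hk),
      hQ₁, hQ₂, show (u + c * b) ^ 2 * a 1 + (c ^ 2 * a 2 + Q k) =
        u ^ 2 * a 1 + u * c * (2 * b) * a 1 + c ^ 2 * (b ^ 2 * a 1 + a 2) + Q k by ring]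
    exact ((((hu.sq.mul ho₁.ge).mono (by omega)).add
      ((((hu.mul hc).mul hb2).mul ho₁.ge).mono (by omega))).add
      ((hc.sq.mul hb).mono (by omega))).add (hKr k hk)
  · refine hasGoodBONG_succ ((hmem _).2 ⟨1, ordGE_one, 0, K.zero_mem, by module⟩) hQ₂ ho₂ ?_ ?_ h4
    · intro y hy
      obtain ⟨c, hc, k, hk, rfl⟩ := (hmem y).1 hy
      rw [map_smul_add_of_polar_eq_zero Q _ (p₂ k hk), hQ₂]
      exact ((hc.sq.mul ho₂.ge).mono (by omega)).add (hKs k hk)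
    · convert hK using 1
      ext y
      rw [mem_projLattice]
      constructor
      · rintro ⟨z, hz, rfl⟩
        obtain ⟨c, _, k, hk, rfl⟩ := (hmem z).1 hz
        rwa [projPerp_smul_add h2 hw20 (p₂ k hk)]
      · intro hy
        exact ⟨y, (hmem y).2 ⟨0, OrdGE.zero 0, y, hy, by module⟩, projPerp_eq_self (p₂ y hy)⟩

/-- The numerical form of the maximality of the binary lattice `≺p, q≻` with `ord p = r`. -/
def BinaryMaximal (O : Type*) {F : Type*} [CommRing O] [IsDomain O] [IsDiscreteValuationRing O]
    [Field F] [Algebra O F] [IsFractionRing O F] (p q : F) (r : ℤ) : Prop :=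
  ∀ α β : F, OrdGE O 0 (2 * α) → OrdGE O r (α ^ 2 * p + β ^ 2 * q) → OrdGE O 0 β

/-- The integral elements of a quadratic algebra are closed under addition: the trace form is
integral on them. -/
theorem ordGE_trace {p q α β α' β' : F} {r : ℤ} (hp : OrdEq O r p) (hα : OrdGE O 0 (2 * α))
    (hβ : OrdGE O r (α ^ 2 * p + β ^ 2 * q)) (hα' : OrdGE O 0 (2 * α'))
    (hβ' : OrdGE O r (α' ^ 2 * p + β' ^ 2 * q)) :
    OrdGE O r (2 * (α * α' * p + β * β' * q)) := by
  have hp0 := hp.ne_zero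
  have h1 : OrdGE O 0 (α ^ 2 + β ^ 2 * (q / p)) := by
    have := (hβ.div hp).mono (by omega : 0 ≤ r - r)
    convert this using 1; field_simp
  have h2 : OrdGE O 0 (α' ^ 2 + β' ^ 2 * (q / p)) := by
    have := (hβ'.div hp).mono (by omega : 0 ≤ r - r)
    convert this using 1; field_simp
  have h4 : OrdGE O 0 (4 : F) := by
    have := ordGE_algebraMap (F := F) (4 : O)
    rwa [map_ofNat] at this
  -- With z = α + βω, z' = α' + β'ω and ω² = -q/p, this is tr(z z̄'). Together with tr(z z') it is a
  -- root of a monic quadratic whose coefficients are integral polynomials in the traces and norms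
  -- of z and z'.
  have h3 : OrdGE O 0 (2 * (α * α' + β * β' * (q / p))) := by
    refine ordGE_zero_of_root (p := -(2 * α * (2 * α')))
      (q := (α ^ 2 + β ^ 2 * (q / p)) * (2 * α') ^ 2 + (α' ^ 2 + β' ^ 2 * (q / p)) * (2 * α) ^ 2 -
        4 * ((α ^ 2 + β ^ 2 * (q / p)) * (α' ^ 2 + β' ^ 2 * (q / p)))) (hα.mul hα').neg ?_ (by ring)
    exact ((h1.mul hα'.sq).add (h2.mul hα.sq)).sub (h4.mul (h1.mul h2))
  have := (h3.mul hp.ge).mono (by omega : r ≤ 0 + r)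
  convert this using 1
  field_simp

theorem ordGE_add_binary {p q α β α' β' : F} {r : ℤ} (hp : OrdEq O r p) (hα : OrdGE O 0 (2 * α))
    (hβ : OrdGE O r (α ^ 2 * p + β ^ 2 * q)) (hα' : OrdGE O 0 (2 * α'))
    (hβ' : OrdGE O r (α' ^ 2 * p + β' ^ 2 * q)) :
    OrdGE O r ((α + α') ^ 2 * p + (β + β') ^ 2 * q) := by
  have := (hβ.add hβ').add (ordGE_trace hp hα hβ hα' hβ')
  convert this using 1; ring

/-- The integral elements of the quadratic algebra form a lattice `N` that contains `J` and has the
same norm, so maximality gives N = J. Projecting J along x₁ then bounds the second coordinate. -/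
theorem binaryMaximal_of_isMaximalPair {π : F} (hπ : OrdEq O 1 π) {e : ℤ} (he : OrdEq O e (2 : F))
    {a : ℕ → F} {R : ℕ → ℤ} (hR : HasOrders O 2 a R) (h : IsMaximalPair (V := V) O Q a) :
    BinaryMaximal O (a 1) (a 2) (R 1) := by
  have h2 := he.ne_zero
  obtain ⟨J, ⟨x, hJ1, hJ2⟩, hmax⟩ := h
  have hJ : HasGoodBONG Q J 2 a := ⟨x, hJ1, fun i j hij => by omega, hJ2⟩
  obtain ⟨x₁, x₂, J₂, K, H, hQ₁, hQ₂, _, hK⟩ := hJ.exists_headPair (n := 0) hR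
  rw [hasGoodBONG_zero] at hK
  subst hK
  have ho₁ : OrdEq O (R 1) (a 1) := hR 1 le_rfl (by omega)
  have ho₂ : OrdEq O (R 2) (a 2) := hR 2 (by omega) le_rfl
  have hmap : ∀ α β : F, Q (α • x₁ + β • x₂) = α ^ 2 * a 1 + β ^ 2 * a 2 := by
    intro α β
    rw [H.map_pair h2, hQ₁, hQ₂]
  let N : Submodule O V :=
    { carrier := {v | ∃ α β : F, v = α • x₁ + β • x₂ ∧ OrdGE O 0 (2 * α) ∧
        OrdGE O (R 1) (α ^ 2 * a 1 + β ^ 2 * a 2)}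
      zero_mem' := ⟨0, 0, by simp, by simpa using OrdGE.zero 0, by simpa using OrdGE.zero (R 1)⟩
      add_mem' := by
        rintro _ _ ⟨α, β, rfl, h3, h4⟩ ⟨α', β', rfl, h5, h6⟩
        refine ⟨α + α', β + β', by module, ?_, ordGE_add_binary ho₁ h3 h4 h5 h6⟩
        rw [mul_add]
        exact h3.add h5
      smul_mem' := by
        rintro c _ ⟨α, β, rfl, h3, h4⟩
        have hc := ordGE_algebraMap (F := F) c
        refine ⟨algebraMap O F c * α, algebraMap O F c * β, ?_, ?_, ?_⟩
        · rw [← algebraMap_smul F c]; module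
        · rw [mul_left_comm]; exact (hc.mul h3).mono (by omega)
        · have := (hc.sq.mul h4).mono (by omega : R 1 ≤ 2 * 0 + R 1)
          convert this using 1; ring }
  have hJN : J ≤ N := by
    intro y hy
    obtain ⟨α, β, k, hk, _, hy'⟩ := H.exists_decomp hy
    rw [(Submodule.mem_bot O).1 hk, add_zero] at hy'
    have h3 := H.norm₁ _ hy
    rw [hy', hmap] at h3
    refine ⟨α, β, hy', H.ordGE_two_mul h2 (y' := β • x₂) ?_ (hy' ▸ hy), h3⟩
    rw [QuadraticMap.polar_smul_right, H.polar₁₂ h2, smul_zero]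
  have hspan : ∀ S : Submodule F V, x₁ ∈ S → x₂ ∈ S → (N : Set V) ⊆ S := by
    rintro S h3 h4 _ ⟨α, β, rfl, _, _⟩
    exact S.add_mem (S.smul_mem _ h3) (S.smul_mem _ h4)
  have hNJ : N = J := by
    refine hmax N ?_ ?_ hJN ?_
    -- `N` is finitely generated because its coordinates have bounded denominators: ord α ≥ -e as 2α
    -- is integral, so β²a₂ has order at least R 1 - 2e. A submodule of a finitely generated module
    -- over a Noetherian ring is finitely generated.
    · obtain ⟨m, hm⟩ : ∃ m : ℤ, ∀ α β : F, OrdGE O 0 (2 * α) →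
          OrdGE O (R 1) (α ^ 2 * a 1 + β ^ 2 * a 2) → OrdGE O m α ∧ OrdGE O m β := by
        have he0 := he.le_of_ge ordGE_zero_two
        refine ⟨min (-e) ((R 1 - 2 * e - R 2) / 2), fun α β h3 h4 => ?_⟩
        have h5 : OrdGE O (-e) α := h3.of_mul_left he (by omega)
        refine ⟨h5.mono (by omega), ?_⟩
        have h6 : OrdGE O (R 1 - 2 * e) (β ^ 2 * a 2) := by
          have h7 : OrdGE O (R 1 - 2 * e) (α ^ 2 * a 1) := (h5.sq.mul ho₁.ge).mono (by omega)
          have := (h4.mono (by omega : R 1 - 2 * e ≤ R 1)).sub h7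
          rwa [add_sub_cancel_left] at this
        exact (h6.of_mul_right ho₂ le_rfl).of_sq (by omega)
      have hS : (Submodule.span O {π ^ m • x₁, π ^ m • x₂} : Submodule O V).FG :=
        Submodule.fg_span (by simp)
      have hnoeth := isNoetherian_of_fg_of_noetherian _ hS
      refine isNoetherian_submodule.1 hnoeth N ?_
      rintro _ ⟨α, β, rfl, h3, h4⟩
      obtain ⟨h5, h6⟩ := hm α β h3 h4
      have hz := uniformizer_zpow hπ m
      have key : ∀ γ : F, ∀ z : V, OrdGE O m γ →
          π ^ m • z ∈ Submodule.span O {π ^ m • x₁, π ^ m • x₂} →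
          γ • z ∈ Submodule.span O {π ^ m • x₁, π ^ m • x₂} := by
        intro γ z hγ hz'
        have := smul_mem_of_ordGE ((hγ.div hz).mono (by omega : 0 ≤ m - m)) hz'
        rwa [smul_smul, div_mul_cancel₀ _ hz.ne_zero] at this
      exact Submodule.add_mem _ (key _ _ h5 (Submodule.subset_span (by simp)))
        (key _ _ h6 (Submodule.subset_span (by simp)))
    · apply le_antisymm
      · rw [Submodule.span_le]
        have h3 : x₁ ∈ Submodule.span F (J : Set V) := Submodule.subset_span H.mem₁
        refine hspan _ h3 ?_
        obtain ⟨b, hb⟩ := H.exists_lift₂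
        have := Submodule.sub_mem _ (Submodule.subset_span hb : _ ∈ Submodule.span F (J : Set V))
          (Submodule.smul_mem _ b h3)
        rwa [add_sub_cancel_left] at this
      · exact Submodule.span_mono hJN
    · have hgen : norm Q J = Submodule.span O {Q x₁} :=
        ((isNormGenerator_iff H.ord₁).2 ⟨H.mem₁, H.norm₁⟩).2.symm
      rw [hgen]
      refine Submodule.span_le.2 ?_
      rintro _ ⟨_, ⟨α, β, rfl, _, h4⟩, rfl⟩
      refine (mem_span_singleton_iff H.ord₁).2 ?_
      rw [hmap]
      exact h4
  intro α β h3 h4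
  have h5 : α • x₁ + β • x₂ ∈ J := hNJ ▸ (⟨α, β, rfl, h3, h4⟩ : α • x₁ + β • x₂ ∈ N)
  have h6 : β • x₂ ∈ J₂ := H.mem₂_of_eq h2 h5 rfl (by
    rw [QuadraticMap.polar_smul_right, H.polar₁₂ h2, smul_zero])
  have h7 := H.norm₂ _ h6
  rw [map_smul_sq, hQ₂] at h7
  exact (h7.of_mul_right ho₂ (m := 0) (by omega)).of_sq (by omega)

/-- In any larger lattice of the same norm, the polar value with x₁ makes 2α integral, hence β is
integral. Subtracting β(bx₁ + x₂) leaves a multiple of x₁, whose coefficient is integral by the norm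
condition. -/
theorem isMaximalPair_of_binaryMaximal {e : ℤ} (he : OrdEq O e (2 : F)) {a : ℕ → F} {r s : ℤ}
    {x₁ x₂ : V} (H : HeadPair Q L r s x₁ x₂ L₂ K) (hQ₁ : Q x₁ = a 1) (hQ₂ : Q x₂ = a 2)
    (h : BinaryMaximal O (a 1) (a 2) r) : IsMaximalPair (V := V) O Q a := by
  have h2 := he.ne_zero
  have ho₁ : OrdEq O r (a 1) := hQ₁ ▸ H.ord₁
  have ho₂ : OrdEq O s (a 2) := hQ₂ ▸ H.ord₂
  obtain ⟨b, hb⟩ := H.exists_lift₂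
  obtain ⟨hb1, hb2⟩ := H.lift_ordGE h2 hb
  rw [hQ₁, hQ₂] at hb2
  set J : Submodule O V := Submodule.span O {x₁, b • x₁ + x₂} with hJ
  have hx₁ : x₁ ∈ J := Submodule.subset_span (by simp)
  have hx₂ : b • x₁ + x₂ ∈ J := Submodule.subset_span (by simp)
  have hJgood : HasGoodBONG Q J 2 a := by
    refine hasGoodBONG_of_decomp (K := ⊥) (n := 0) h2 hx₁ hx₂ bot_le (H.polar₁₂ h2)
      ?_ ?_ ?_ hQ₁ hQ₂ ho₁ ho₂ hb2 hb1 ?_ ?_ ?_ (by omega) (by omega)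
    · intro k hk
      rw [(Submodule.mem_bot O).1 hk, QuadraticMap.polar_zero_right]
    · intro k hk
      rw [(Submodule.mem_bot O).1 hk, QuadraticMap.polar_zero_right]
    · intro y hy
      obtain ⟨u, c, rfl⟩ := Submodule.mem_span_pair.1 hy
      refine ⟨_, _, ordGE_algebraMap u, ordGE_algebraMap c, 0, Submodule.zero_mem _, ?_⟩
      rw [algebraMap_smul, algebraMap_smul, add_zero]
    · intro k hk
      rw [(Submodule.mem_bot O).1 hk, QuadraticMap.map_zero]; exact OrdGE.zero _
    · intro k hk
      rw [(Submodule.mem_bot O).1 hk, QuadraticMap.map_zero]; exact OrdGE.zero _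
    · exact hasGoodBONG_zero.2 rfl
  refine ⟨J, ?_, ?_⟩
  · obtain ⟨x, hx, _, hx'⟩ := hJgood
    exact ⟨x, hx, hx'⟩
  intro M _ hspan hJM hnorm
  refine le_antisymm (fun y hy => ?_) hJM
  have hgen : norm Q J = Submodule.span O {Q x₁} := by
    obtain ⟨x, hx, hx', _⟩ := HasGoodBONG.exists_head (n := 1) hJgood
    have h3 : OrdEq O r (Q x) := by
      rename_i h4
      rw [h4.1]; exact ho₁
    exact ((isNormGenerator_iff H.ord₁).2 ⟨hx₁, ((isNormGenerator_iff h3).1 hx').2⟩).2.symm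
  have hM : ∀ z ∈ M, OrdGE O r (Q z) := by
    intro z hz
    rw [← mem_span_singleton_iff H.ord₁, ← hgen]
    exact hnorm (map_mem_norm hz)
  have hy' : y ∈ Submodule.span F (J : Set V) := hspan ▸ Submodule.subset_span hy
  have hle : Submodule.span F (J : Set V) ≤ Submodule.span F {x₁, x₂} := by
    have h3 : x₁ ∈ Submodule.span F {x₁, x₂} := Submodule.subset_span (by simp)
    have h4 : x₂ ∈ Submodule.span F {x₁, x₂} := Submodule.subset_span (by simp)
    have h5 : J ≤ (Submodule.span F {x₁, x₂}).restrictScalars O := by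
      refine Submodule.span_le.2 ?_
      rintro z (rfl | rfl)
      · exact h3
      · exact Submodule.add_mem _ (Submodule.smul_mem _ _ h3) h4
    exact Submodule.span_le.2 h5
  obtain ⟨α, β, rfl⟩ := Submodule.mem_span_pair.1 (hle hy')
  have h3 := hM _ hy
  rw [H.map_pair h2, hQ₁, hQ₂] at h3
  have h4 : OrdGE O 0 (2 * α) := by
    have := ordGE_polar hM (hJM hx₁) hy
    rw [QuadraticMap.polar_add_right, QuadraticMap.polar_smul_right, QuadraticMap.polar_smul_right,
      H.polar₁₂ h2, smul_zero, add_zero, polar_self_mul, smul_eq_mul, ← mul_assoc] at this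
    rw [mul_comm]
    exact this.of_mul_right H.ord₁ (by omega)
  have h5 := h α β h4 h3
  have h6 : (α - β * b) • x₁ ∈ M := by
    have := M.sub_mem hy (smul_mem_of_ordGE h5 (hJM hx₂))
    convert this using 1
    module
  have h7 := hM _ h6
  rw [map_smul_sq] at h7
  have h8 : OrdGE O 0 (α - β * b) := (h7.of_mul_right H.ord₁ (m := 0) (by omega)).of_sq (by omega)
  have := J.add_mem (smul_mem_of_ordGE h8 hx₁) (smul_mem_of_ordGE h5 hx₂)
  convert this using 1
  module

/-- If no vector of `L` has order `R 1 + 1`, then the vectors that are not norm generators form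
a lattice whose norm is `π² a 1`. -/
theorem isLatticeWithGoodBONG_of_no_succ [Finite (IsLocalRing.ResidueField O)]
    [CharP (IsLocalRing.ResidueField O) 2] {π : F} (hπ : OrdEq O 1 π) (h2 : (2 : F) ≠ 0)
    {n : ℕ} {a a' : ℕ → F} {R : ℕ → ℤ} (h : HasGoodBONG Q L (n + 1) a)
    (hR : HasOrders O (n + 1) a R)
    (hpol : ∀ x ∈ L, ∀ y ∈ L, OrdGE O (R 1 + 1) (polar Q x y))
    (hno : ∀ x ∈ L, ¬ OrdEq O (R 1 + 1) (Q x)) (h3 : 2 ≤ n → R 1 + 2 ≤ R 3)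
    (ha1 : a' 1 = π ^ 2 * a 1) (ha' : ∀ i, 2 ≤ i → i ≤ n + 1 → a' i = a i) :
    IsLatticeWithGoodBONG O Q (nonNormGenerators Q L) (n + 1) a' := by
  obtain ⟨x, hx, hQx, hox, hnorm, hgen, hK⟩ := h.exists_first hR
  refine ⟨sublatticeOrdGE Q L (R 1 + 1) hpol, (nonNormGenerators_eq hox hgen).symm, ?_⟩
  have ho' : OrdEq O (R 1 + 2) (a' 1) := by
    rw [ha1, ← hQx]
    have := hπ.sq.mul hox
    convert this using 1; ring
  have hQx' : Q (π • x) = a' 1 := by rw [map_smul_sq, hQx, ha1]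
  refine hasGoodBONG_succ (x := π • x) (k := R 1 + 2) ?_ hQx' ho' ?_ ?_ ?_
  · exact ⟨smul_mem_of_ordGE (hπ.ge.mono (by omega)) hx, by
      rw [hQx']; exact ho'.ge.mono (by omega)⟩
  · rintro y ⟨hy, hy'⟩
    have := hy'.eq_or.resolve_left (hno y hy)
    rwa [add_assoc] at this
  · have : projLattice Q (sublatticeOrdGE Q L (R 1 + 1) hpol) (π • x) = projLattice Q L x := by
      ext y
      rw [mem_projLattice, mem_projLattice, projPerp_smul hπ.ne_zero]
      constructor
      · rintro ⟨z, hz, rfl⟩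
        exact ⟨z, hz.1, rfl⟩
      · rintro ⟨z, hz, rfl⟩
        -- Adding a multiple of x does not change the projection and, residues being squares, can
        -- push any z ∈ `L` into the sublattice. Thus both lattices have the same projection.
        obtain ⟨c, hc, hc'⟩ := exists_add_sq_mul (N := R 1) (j := 0) hπ
          ((hnorm z hz).mono (by omega)) hox
        have hcx := smul_mem_of_ordGE hc hx
        refine ⟨c • x + z, ⟨L.add_mem hcx hz, ?_⟩, ?_⟩
        · rw [map_add_polar, map_smul_sq, add_comm (c ^ 2 * Q x)]
          exact (hc'.mono (by omega)).add (hpol _ hcx _ hz)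
        · rw [map_add, map_smul, projPerp_self h2 hox.ne_zero, smul_zero, zero_add]
    rw [this]
    exact hK.congr fun i hi hin => (ha' (i + 1) (by omega) (by omega)).symm
  · intro hn
    rw [ha' 3 (by omega) (by omega)]
    exact (hR 3 (by omega) (by omega)).ge.mono (h3 hn)

end Binary

/-! ### Numerical study of maximal binary forms. -/

section BinaryForms

variable {O F : Type*} [CommRing O] [IsDomain O] [IsDiscreteValuationRing O]
  [Field F] [Algebra O F] [IsFractionRing O F] {p q π : F} {r s e : ℤ}

/-- An integral element of odd order generates the maximal order. -/
theorem binaryMaximal_of_uniformizer (hp : OrdEq O r p) {α β : F} (hβ : OrdGE O 0 β)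
    (h : OrdEq O (r + 1) (α ^ 2 * p + β ^ 2 * q)) : BinaryMaximal O p q r := by
  intro α' β' hα' h'
  by_contra hβ'
  have hβ0 : β' ≠ 0 := by
    rintro rfl; exact hβ' (OrdGE.zero 0)
  obtain ⟨j, hj⟩ := exists_ordEq (O := O) hβ0
  have hj0 : j < 0 := by
    by_contra h3; exact hβ' (hj.ge.mono (by omega))
  -- If β' is not integral, then l ∈ 𝔭 and the given element is γ plus l times the integral element
  -- (α', β'). Its value then has order at least r + 2 when γ ∈ 𝔭, and order r + 2 ord γ otherwise;
  -- neither is r + 1.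
  set l := β / β' with hl
  have hl1 : OrdGE O 1 l := (hβ.div hj).mono (by omega)
  have hll : β = l * β' := by rw [hl, div_mul_cancel₀ _ hβ0]
  set γ := α - l * α' with hγ
  have key : α ^ 2 * p + β ^ 2 * q =
      γ ^ 2 * p + (l * (2 * α') * p) * γ + l ^ 2 * (α' ^ 2 * p + β' ^ 2 * q) := by
    rw [hγ, hll]; ring
  have h3 : OrdGE O (r + 1) (l * (2 * α') * p) := ((hl1.mul hα').mul hp.ge).mono (by omega)
  have h4 : OrdGE O (r + 2) (l ^ 2 * (α' ^ 2 * p + β' ^ 2 * q)) :=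
    (hl1.sq.mul h').mono (by omega)
  rw [key] at h
  by_cases hγ1 : OrdGE O 1 γ
  · refine h.not_ge (by omega : r + 1 < r + 2) (OrdGE.add (OrdGE.add ?_ ?_) h4)
    · exact (hγ1.sq.mul hp.ge).mono (by omega)
    · exact (h3.mul hγ1).mono (by omega)
  · have hγ0 : γ ≠ 0 := by
      intro h0; rw [h0] at hγ1; exact hγ1 (OrdGE.zero 1)
    obtain ⟨i, hi⟩ := exists_ordEq (O := O) hγ0
    have hi0 : i < 1 := by
      by_contra h5; exact hγ1 (hi.ge.mono (by omega))
    have h5 : OrdEq O (2 * i + r) (γ ^ 2 * p + (l * (2 * α') * p) * γ) :=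
      (hi.sq.mul hp).add_ge ((h3.mul hi.ge).mono (by omega))
    have := h5.add_ge (h4.mono (by omega))
    have := this.unique h
    omega

/-- A split algebra contains an idempotent of trace 1 and norm 0, with coordinates 1/2 and 1/(2t).
Its second coordinate is not integral when s > r - 2e. -/
theorem BinaryMaximal.ne_neg_sq (h : BinaryMaximal O p q r) (he : OrdEq O e (2 : F))
    (hp : OrdEq O r p) (hq : OrdEq O s q) (hrs : r - 2 * e < s) (t : F) : q ≠ -(t ^ 2 * p) := by
  intro hqt
  have ht : t ≠ 0 := by
    rintro rfl; exact hq.ne_zero (by rw [hqt]; ring)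
  obtain ⟨j, hj⟩ := exists_ordEq (O := O) ht
  have h2 := he.ne_zero
  have h3 := h (1 / 2) (1 / (2 * t)) (by rw [mul_one_div_cancel h2]; exact ordGE_one) (by
    rw [hqt, show (1 / 2 : F) ^ 2 * p + (1 / (2 * t)) ^ 2 * -(t ^ 2 * p) = 0 by
      field_simp; ring]
    exact OrdGE.zero _)
  have h4 := ((ordEq_one (O := O) (F := F)).div (he.mul hj)).le_of_ge h3
  rw [hqt] at hq
  have := (hj.sq.mul hp).neg.unique hq
  omega

/-- In an anisotropic binary space the elements of integral norm have integral trace. -/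
theorem ordGE_two_mul_of_anisotropic [IsAdicComplete (IsLocalRing.maximalIdeal O) O]
    (hp : OrdEq O r p) (he : OrdEq O e (2 : F)) (han : ∀ t : F, q ≠ -(t ^ 2 * p)) {α β : F}
    (h : OrdGE O r (α ^ 2 * p + β ^ 2 * q)) : OrdGE O 0 (2 * α) := by
  have hp0 := hp.ne_zero
  have h2 := he.ne_zero
  by_contra h3
  have hα : 2 * α ≠ 0 := by
    intro h0; rw [h0] at h3; exact h3 (OrdGE.zero 0)
  obtain ⟨m, hm⟩ := exists_ordEq (O := O) hα
  have hm0 : m < 0 := by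
    by_contra h4; exact h3 (hm.ge.mono (by omega))
  -- If the trace 2α is not integral, dividing by it gives an element of trace 1 with norm in 𝔭. Its
  -- characteristic polynomial splits by Hensel, contrary to anisotropy.
  obtain ⟨w, _, hw⟩ := exists_root_of_ordGE (O := O)
    (q := (α ^ 2 * p + β ^ 2 * q) / p / (2 * α) ^ 2) (((h.div hp).div hm.sq).mono (by omega))
  have hα0 : α ≠ 0 := right_ne_zero_of_mul hα
  have h4 : (2 * α * w + α) ^ 2 * p = -(β ^ 2 * q) := by
    field_simp at hw
    linear_combination hw
  rcases eq_or_ne β 0 with rfl | hβ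
  · have h5 : OrdGE O r (α ^ 2 * p) := by simpa using h
    have h6 : OrdGE O 0 α := (h5.of_mul_right hp (m := 0) (by omega)).of_sq (by omega)
    exact h3 ((he.ge.mul h6).mono (by have := he.le_of_ge ordGE_zero_two; omega))
  · refine han ((2 * α * w + α) / β) ?_
    field_simp
    linear_combination h4

/-- Subtracting β times the integral element b + ω leaves an integral element without second
coordinate, whose value is (α - βb)²p. -/
theorem ordGE_sub_mul (hp : OrdEq O r p) {α β b : F} (hα : OrdGE O 0 (2 * α)) (hβ : OrdGE O 0 β)
    (h : OrdGE O r (α ^ 2 * p + β ^ 2 * q)) (hb : OrdGE O 0 (2 * b))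
    (hb2 : OrdGE O r (b ^ 2 * p + q)) : OrdGE O 0 (α - β * b) := by
  have h1 := ordGE_add_binary hp hα h (α' := -(β * b)) (β' := -β) (q := q) ?_ ?_
  · rw [add_neg_cancel, zero_pow two_ne_zero, zero_mul, add_zero, ← sub_eq_add_neg] at h1
    exact (h1.of_mul_right hp (m := 0) (by omega)).of_sq (by omega)
  · have := (hβ.mul hb).neg.mono (by omega : (0 : ℤ) ≤ 0 + 0)
    convert this using 1; ring
  · have := (hβ.sq.mul hb2).mono (by omega : r ≤ 2 * 0 + r)
    convert this using 1; ring

/-- A maximal binary lattice that is not unimodular up to scaling by its norm has a vector whose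
order exceeds the order of the norm by one. -/
theorem BinaryMaximal.exists_ordEq_succ [Finite (IsLocalRing.ResidueField O)]
    [CharP (IsLocalRing.ResidueField O) 2] (h : BinaryMaximal O p q r) (hπ : OrdEq O 1 π)
    (he : OrdEq O e (2 : F)) (hp : OrdEq O r p) (hq : OrdEq O s q) (hrs : r - 2 * e < s) :
    ∃ α β : F, α ≠ 0 ∧ OrdEq O (r + 1) (α ^ 2 * p + β ^ 2 * q) := by
  rcases Int.even_or_odd (s - r) with ⟨i, hi⟩ | ⟨i, hi⟩
  · have hz := uniformizer_zpow hπ (-i)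
    by_contra hcon
    push Not at hcon
    obtain ⟨l, hl, hl'⟩ := exists_add_sq_mul_of_parity (q := (π ^ (-i)) ^ 2 * q) (A := p) (N := r)
      (m := r + 2 * e - 1) hπ he ((hz.sq.mul hq).ge.mono (by omega)) hp (by omega) (by
        intro l k hl hk hkm
        by_contra hodd
        rw [Int.not_even_iff_odd] at hodd
        obtain ⟨j, hj⟩ := hodd
        -- A value of order r + 2j + 1 becomes one of order r + 1 after scaling by π^(-j), contrary
        -- to the assumption.
        have hw := uniformizer_zpow hπ (-j)
        have hl0 : l ≠ 0 := by
          rintro rfl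
          have := (hz.sq.mul hq).unique (by simpa using hk)
          omega
        refine hcon (π ^ (-j) * l) (π ^ (-j) * π ^ (-i)) (mul_ne_zero hw.ne_zero hl0) ?_
        have := hw.sq.mul hk
        convert this using 1
        · omega
        · ring)
    -- The approximation reaches order r + 2e, so half the vector is an integral element. Its second
    -- coordinate has order -i - e < 0, contrary to maximality.
    have h3 := h (l / 2) (π ^ (-i) / 2) (by rwa [mul_div_cancel₀ _ he.ne_zero]) (by
      have := (hl'.div he.sq).mono (by omega : r ≤ _)
      convert this using 1
      field_simp [he.ne_zero]
      ring)
    have := (hz.div he).le_of_ge h3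
    omega
  -- The vector π^(-i)x₂ alone has order r + 1. The summand πx₁, of order r + 2, only serves to make
  -- the first coordinate nonzero, so that it can be divided by in the Hilbert symbol.
  · refine ⟨π, π ^ (-i), hπ.ne_zero, ?_⟩
    rw [add_comm (π ^ 2 * p)]
    have := ((uniformizer_zpow hπ (-i)).sq.mul hq).add_ge (y := π ^ 2 * p)
      ((hπ.sq.mul hp).ge.mono (by omega))
    convert this using 1
    omega

/-- The value divided by πp is a unit η, and πη is a norm from the quadratic algebra; dividing the
norm equation by α² gives the form required by the symbol. -/
theorem exists_hilbertSymbol_eq_one (hπ : OrdEq O 1 π) (hp : OrdEq O r p) {α β : F} (hα : α ≠ 0)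
    (h : OrdEq O (r + 1) (α ^ 2 * p + β ^ 2 * q)) :
    ∃ η : F, ord O η = 0 ∧ hilbertSymbol (π * η) (-(p * q)) = 1 := by
  have hp0 := hp.ne_zero
  have hπ0 := hπ.ne_zero
  refine ⟨(α ^ 2 * p + β ^ 2 * q) / (π * p), ?_, ?_⟩
  · have := h.div (hπ.mul hp)
    rw [show r + 1 - (1 + r) = 0 by ring] at this
    exact this
  · unfold hilbertSymbol
    rw [if_pos]
    refine ⟨1 / α, β / (α * p), ?_⟩
    field_simp
    ring

/-- Clearing denominators inverts the passage from norms to Hilbert symbols. Anisotropy rules out x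
= 0. -/
theorem exists_norm_eq_of_hilbertSymbol {c : F} (hp0 : p ≠ 0) (han : ∀ t : F, q ≠ -(t ^ 2 * p))
    (h : hilbertSymbol c (-(p * q)) = 1) : ∃ α β : F, α ^ 2 * p + β ^ 2 * q = c * p := by
  have h1 : ∃ x y : F, c * x ^ 2 + -(p * q) * y ^ 2 = 1 := by
    by_contra hcon
    unfold hilbertSymbol at h
    rw [if_neg hcon] at h
    exact absurd h (by decide)
  obtain ⟨x, y, hxy⟩ := h1
  have hx : x ≠ 0 := by
    rintro rfl
    have hy : y ≠ 0 := by
      rintro rfl; simp at hxy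
    refine han (1 / (p * y)) ?_
    field_simp
    linear_combination -hxy
  refine ⟨1 / x, p * y / x, ?_⟩
  field_simp
  linear_combination -hxy

/-- A vector (α, β) with value ν of order r + 1 writes -pq as (pα/β)² - pν/β², with an error of odd
order. For even s - r, α²p cannot have order r + 1, so β²q has order at most r + 1. Since ord β ≥ 0
and s > r - 2e, the resulting defect bound suffices to trigger property B. -/
theorem BinaryMaximal.relDefect_le (h : BinaryMaximal O p q r)
    (he : OrdEq O e (2 : F)) (hp : OrdEq O r p) (hq : OrdEq O s q) (hrs : r - 2 * e < s)
    (heven : Even (s - r)) {α β : F} (hα : OrdGE O 0 (2 * α))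
    (hαβ : OrdEq O (r + 1) (α ^ 2 * p + β ^ 2 * q)) :
    relDefect O (-(p * q)) ≤ ((e - (s - r) / 2 : ℤ) : WithTop ℤ) := by
  have hp0 := hp.ne_zero
  have hβ := h α β hα (hαβ.ge.mono (by omega))
  have hpar : ¬ OrdEq O (r + 1) (α ^ 2 * p) := by
    intro h3
    have hα0 : α ≠ 0 := by
      rintro rfl; exact h3.ne_zero (by simp)
    obtain ⟨i, hi⟩ := exists_ordEq (O := O) hα0
    have := (hi.sq.mul hp).unique h3
    omega
  have hβ0 : β ≠ 0 := by
    rintro rfl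
    exact hpar (by simpa using hαβ)
  obtain ⟨j, hj⟩ := exists_ordEq (O := O) hβ0
  have hj0 : 0 ≤ j := hj.le_of_ge hβ
  have hle : 2 * j + s ≤ r + 1 := by
    by_contra h3
    refine hpar ?_
    have := hαβ.add_ge (y := -(β ^ 2 * q)) ((hj.sq.mul hq).neg.ge.mono (by omega))
    rwa [add_neg_cancel_right] at this
  obtain ⟨i, hi⟩ := heven
  have hν : OrdEq O (r + (r + 1) - 2 * j) (-(p * (α ^ 2 * p + β ^ 2 * q) / β ^ 2)) :=
    ((hp.mul hαβ).div hj.sq).neg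
  refine (DyadicLattice.relDefect_le (s := p * α / β) he (hp.mul hq).neg ⟨r + i, by omega⟩
    ⟨r - j, by omega⟩ hν (by field_simp; ring) (by omega) (by omega)).trans ?_
  refine WithTop.coe_le_coe.2 ?_
  omega

end BinaryForms

/-! ### The cases R 1 < R 3 and R 2 - R 1 = -2e. -/

section Cases

variable {O F V : Type*} [CommRing O] [IsDomain O] [IsDiscreteValuationRing O]
  [Finite (IsLocalRing.ResidueField O)] [CharP (IsLocalRing.ResidueField O) 2]
  [Field F] [Algebra O F] [IsFractionRing O F]
  [AddCommGroup V] [Module F V] [Module O V] [IsScalarTower O F V]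
  {Q : QuadraticForm F V} {L : Submodule O V} {π : F} {e : ℤ} {n : ℕ} {a : ℕ → F} {R : ℕ → ℤ}

theorem one_le_of_ordEq_two (he : OrdEq O e (2 : F)) : 1 ≤ e := he.le_of_ge ordGE_one_two

theorem HasOrders.ordGE_third (hR : HasOrders O (n + 2) a R)
    {K : Submodule O V} (hK : HasGoodBONG Q K n (fun i => a (i + 2))) {r : ℤ}
    (hr : 1 ≤ n → r ≤ R 3) : ∀ k ∈ K, OrdGE O r (Q k) :=
  hK.ordGE fun hn => ⟨hR 3 (by omega) (by omega), hr hn⟩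

/-- If the reflections of `L` have values of constant parity, `R 3 = R 1 + 1` is impossible. -/
theorem HasGoodBONG.third_ne_of_reflectionParity (h : HasGoodBONG Q L (n + 3) a)
    (hR : HasOrders O (n + 3) a R) (he : OrdEq O e (2 : F)) (hpar : ReflectionParity Q L (R 1)) :
    R 3 ≠ R 1 + 1 := by
  intro h13
  have h2 := he.ne_zero
  obtain ⟨x₁, x₂, L₂, K, H, _, _, _, hK⟩ := h.exists_headPair (n := n + 1) hR
  have hodd12 : Odd (R 2 - R 1) → R 1 < R 2 := (h.adjacent hR he (i := 1) le_rfl (by omega)).2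
  have hodd23 : Odd (R 3 - R 2) → R 2 < R 3 :=
    (h.adjacent hR he (i := 2) (by omega) (by omega)).2
  -- Exactly one of R 2 - R 1 and R 3 - R 2 is odd. Accordingly `L₂` or `K` is contained in `L`, and
  -- x₂ or x₃ is a vector of the wrong parity whose reflection preserves `L`.
  rcases Int.even_or_odd (R 2 - R 1) with heven | hodd
  · have h23 : R 2 < R 3 := hodd23 (by
      obtain ⟨i, hi⟩ := heven
      exact ⟨-i, by omega⟩)
    have hr := hR.ordGE_third hK (fun _ => (by omega : R 1 ≤ R 3))
    have hs := hR.ordGE_third hK (fun _ => h23.le)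
    obtain ⟨b, hb⟩ := H.exists_lift₂
    obtain ⟨x₃, hx₃, _, ho₃, hn₃, _⟩ := hK.exists_first (hR.shift (n := n + 1) 2)
    have := hpar x₃ (H.le_of_norm₂ h2 hr hs hx₃) (R 3) ho₃ (by
      intro y hy
      obtain ⟨u, c, _, _, k, hk, rfl⟩ := H.exists_integral_decomp h2 hr hs hb hy
      simp only [QuadraticMap.polar_add_right, QuadraticMap.polar_smul_right,
        QuadraticMap.polar_comm Q x₃ x₁, QuadraticMap.polar_comm Q x₃ x₂, H.polarK₁ h2 hx₃,
        H.polarK₂ h2 hx₃, smul_zero, zero_add]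
      exact ordGE_polar hn₃ hx₃ hk)
    obtain ⟨i, hi⟩ := this
    omega
  · have h12 := hodd12 hodd
    have := hpar x₂ (H.le_of_norm h2 h12.le H.mem₂) (R 2) H.ord₂ (by
      intro y hy
      obtain ⟨c, y', hy', rfl⟩ := H.exists_decomp₁ hy
      rw [QuadraticMap.polar_add_right, QuadraticMap.polar_smul_right,
        QuadraticMap.polar_comm Q x₂ x₁, H.polar₁₂ h2, smul_zero, zero_add]
      exact ordGE_polar H.norm₂ H.mem₂ hy')
    exact (Int.not_even_iff_odd.2 hodd) this

theorem HasGoodBONG.third_ne_of_propertyB (h : HasGoodBONG Q L (n + 3) a)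
    (hR : HasOrders O (n + 3) a R) (he : OrdEq O e (2 : F)) (hB : PropertyB O e (n + 3) a R) :
    R 3 ≠ R 1 + 1 := by
  intro h13
  have he1 := one_le_of_ordEq_two he
  have h12 : R 1 - 2 * e ≤ R 2 ∧ (Odd (R 2 - R 1) → R 1 < R 2) :=
    h.adjacent hR he (i := 1) le_rfl (by omega)
  have h23 : R 2 - 2 * e ≤ R 3 ∧ (Odd (R 3 - R 2) → R 2 < R 3) :=
    h.adjacent hR he (i := 2) (by omega) (by omega)
  rcases Int.even_or_odd (R 3 - R 2) with heven | hodd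
  · have hodd : Odd (R 2 - R 1) := by
      obtain ⟨i, hi⟩ := heven
      exact ⟨-i, by omega⟩
    have h3 := h12.2 hodd
    by_cases h4 : R 2 - R 1 ≤ 2 * e + 1
    · have : R 3 - R 2 > 2 * e :=
        (hB.2 1 le_rfl (by omega) (Or.inl ⟨hodd, h4⟩)).2 (by omega)
      omega
    · obtain ⟨i, hi⟩ := hodd
      omega
  · have := h23.2 hodd
    have h4 : R 2 - R 1 > 2 * e :=
      (hB.2 2 (by omega) (by omega) (Or.inl ⟨hodd, (by omega : R 3 - R 2 ≤ 2 * e + 1)⟩)).1 le_rfl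
    omega

theorem HasGoodBONG.add_two_le_third (h : HasGoodBONG Q L n a) (hR : HasOrders O n a R)
    (he : OrdEq O e (2 : F)) (hB : PropertyB O e n a R ∨ ReflectionParity Q L (R 1))
    (h3 : 3 ≤ n) (h13 : R 1 < R 3) : R 1 + 2 ≤ R 3 := by
  obtain ⟨m, rfl⟩ := Nat.exists_eq_add_of_le' h3
  have : R 3 ≠ R 1 + 1 := hB.elim (h.third_ne_of_propertyB hR he)
    (h.third_ne_of_reflectionParity hR he)
  omega

/-- Unless `≺a 1, a 2≻` is maximal, the lattice has no vectors of order `R 1 + 1`. -/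
theorem HasGoodBONG.not_ordEq_succ (h : HasGoodBONG Q L (n + 2) a) (hR : HasOrders O (n + 2) a R)
    (he : OrdEq O e (2 : F)) (h3 : 1 ≤ n → R 1 + 2 ≤ R 3)
    (hmax : ¬ IsMaximalPair (V := V) O Q a) : ∀ x ∈ L, ¬ OrdEq O (R 1 + 1) (Q x) := by
  intro x hx hox
  have h2 := he.ne_zero
  obtain ⟨x₁, x₂, L₂, K, H, hQ₁, hQ₂, _, hK⟩ := h.exists_headPair hR
  refine hmax (isMaximalPair_of_binaryMaximal he H hQ₁ hQ₂ ?_)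
  rw [← hQ₁, ← hQ₂]
  have hr := hR.ordGE_third hK h3
  obtain ⟨α, β, k, hk, hL₂, rfl⟩ := H.exists_decomp hx
  have hz : OrdEq O (R 1 + 1) (α ^ 2 * Q x₁ + β ^ 2 * Q x₂) := by
    rw [H.map_eq h2 hk] at hox
    have := hox.add_ge (y := -Q k) ((hr k hk).neg.mono (by omega))
    convert this using 1; ring
  refine binaryMaximal_of_uniformizer H.ord₁ ?_ hz
  by_contra hβ
  have hβ0 : β ≠ 0 := by
    rintro rfl; exact hβ (OrdGE.zero 0)
  obtain ⟨j, hj⟩ := exists_ordEq (O := O) hβ0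
  have hj0 : j < 0 := by
    by_contra h3; exact hβ (hj.ge.mono (by omega))
  have h4 := H.norm₂ _ hL₂
  rw [map_smul_add_of_polar_eq_zero Q _ (H.polarK₂ h2 hk)] at h4
  -- If β is not integral, β²Q(x₂) has order below R 2 and must be compensated by `K`, so its order
  -- is at least R 3 ≥ R 1 + 2. Then α²Q(x₁) alone would have order R 1 + 1, which is impossible by
  -- parity.
  have h5 : OrdGE O (R 1 + 2) (β ^ 2 * Q x₂) := by
    rcases Nat.eq_zero_or_pos n with rfl | hn
    · rw [hasGoodBONG_zero.1 hK, Submodule.mem_bot] at hk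
      rw [hk, QuadraticMap.map_zero, add_zero] at h4
      have := (hj.sq.mul H.ord₂).le_of_ge h4
      omega
    · have h6 := hR.ordGE_third hK (fun _ => le_rfl) k hk
      have h7 := ((h4.mono (min_le_left (R 2) (R 3))).sub (h6.mono (min_le_right (R 2) (R 3))))
      rw [add_sub_cancel_right] at h7
      have := (hj.sq.mul H.ord₂).le_of_ge h7
      have := h3 hn
      exact (hj.sq.mul H.ord₂).ge.mono (by omega)
  have h6 : OrdEq O (R 1 + 1) (α ^ 2 * Q x₁) := by
    have := hz.add_ge (y := -(β ^ 2 * Q x₂)) (h5.neg.mono (by omega))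
    rwa [add_neg_cancel_right] at this
  have hα0 : α ≠ 0 := by
    rintro rfl; exact h6.ne_zero (by simp)
  obtain ⟨i, hi⟩ := exists_ordEq (O := O) hα0
  have := (hi.sq.mul H.ord₁).unique h6
  omega

theorem ReflectionParity.not_ordEq_succ {r : ℤ} (hpar : ReflectionParity Q L r)
    (hpol : ∀ x ∈ L, ∀ y ∈ L, OrdGE O (r + 1) (polar Q x y)) :
    ∀ x ∈ L, ¬ OrdEq O (r + 1) (Q x) := by
  intro x hx hox
  obtain ⟨i, hi⟩ := hpar x hx _ hox (hpol x hx)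
  omega

/-- If `R 2 - R 1 = -2e` and `a 1 a 2 = -t²`, then `(t / a 1) x₁ + x₂` is an isotropic vector of
the lattice; more generally it belongs to the lattice if `a 1 a 2 + t²` is small. -/
theorem HeadPair.smul_add_mem {r s : ℤ} {x₁ x₂ : V} {L₂ K : Submodule O V}
    (H : HeadPair Q L r s x₁ x₂ L₂ K) (he : OrdEq O e (2 : F)) {c : F} (hc : OrdEq O (-e) c)
    (h : OrdGE O r (c ^ 2 * Q x₁ + Q x₂)) : c • x₁ + x₂ ∈ L := by
  have h2 := he.ne_zero
  obtain ⟨b, hb⟩ := H.exists_lift₂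
  obtain ⟨_, hb2⟩ := H.lift_ordGE h2 hb
  have h3 : OrdGE O 0 (c ^ 2 - b ^ 2) := by
    have h4 := h.sub hb2
    rw [show c ^ 2 * Q x₁ + Q x₂ - (b ^ 2 * Q x₁ + Q x₂) = (c ^ 2 - b ^ 2) * Q x₁ by ring] at h4
    exact h4.of_mul_right H.ord₁ (by omega)
  have h5 : OrdGE O 0 (c - b) :=
    ordGE_zero_of_root (p := -(2 * c)) (q := c ^ 2 - b ^ 2)
      ((he.mul hc).neg.ge.mono (by omega)) h3 (by ring)
  have := L.add_mem hb (smul_mem_of_ordGE h5 H.mem₁)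
  convert this using 1
  module

/-- The case of a hyperbolic plane. -/
theorem HasGoodBONG.not_submodule_of_hyperbolic (h : HasGoodBONG Q L (n + 2) a)
    (hR : HasOrders O (n + 2) a R) (he : OrdEq O e (2 : F)) (h12 : R 2 - R 1 = -2 * e)
    {t : F} (ht : a 1 * a 2 = -t ^ 2) :
    ¬ ∃ M : Submodule O V, (M : Set V) = nonNormGenerators Q L := by
  rintro ⟨M, hM⟩
  have h2 := he.ne_zero
  obtain ⟨x₁, x₂, L₂, K, H, hQ₁, hQ₂, _, _⟩ := h.exists_headPair hR
  rw [nonNormGenerators_eq H.ord₁ ((isNormGenerator_iff H.ord₁).2 ⟨H.mem₁, H.norm₁⟩)] at hM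
  rw [← hQ₁, ← hQ₂] at ht
  have h10 := H.ord₁.ne_zero
  have hc : OrdEq O (-e) (t / Q x₁) := by
    have h3 : OrdEq O (2 * (R 1 - e)) (t ^ 2) := by
      have := (H.ord₁.mul H.ord₂).neg
      rw [ht, neg_neg] at this
      convert this using 1; omega
    have := (ordEq_of_sq h3).div H.ord₁
    convert this using 1; omega
  have key : ∀ c : F, OrdEq O (-e) c → c ^ 2 * Q x₁ + Q x₂ = 0 → c • x₁ + x₂ ∈ M := by
    intro c hc hc0
    have hmem := H.smul_add_mem he hc (by rw [hc0]; exact OrdGE.zero _)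
    have : c • x₁ + x₂ ∈ (M : Set V) := by
      rw [hM]
      refine ⟨hmem, ?_⟩
      rw [H.map_lift h2, hc0]
      exact OrdGE.zero _
    exact this
  have h3 : (t / Q x₁) ^ 2 * Q x₁ + Q x₂ = 0 := by
    field_simp
    linear_combination ht
  -- The two isotropic vectors belong to L', but their difference is 2c·x₁ with 2c a unit, a norm
  -- generator.
  have h4 := M.sub_mem (key _ hc h3) (key _ hc.neg (by rw [neg_sq]; exact h3))
  have h5 : (t / Q x₁) • x₁ + x₂ - (-(t / Q x₁) • x₁ + x₂) = (2 * (t / Q x₁)) • x₁ := by module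
  rw [h5] at h4
  have h6 : (2 * (t / Q x₁)) • x₁ ∈ (M : Set V) := h4
  rw [hM] at h6
  have h7 := h6.2
  rw [map_smul_sq] at h7
  exact ((he.mul hc).sq.mul H.ord₁).not_ge (by omega) h7

/-- Multiples of x₃, which has order R 1, correct both x₁ and bx₁ + x₂ to vectors of L'. Their polar
value still has order exactly R 1, because 2b is a unit, so the value of their sum has order R 1. -/
theorem HasGoodBONG.not_submodule_of_eq_third (h : HasGoodBONG Q L (n + 3) a)
    (hR : HasOrders O (n + 3) a R) (hπ : OrdEq O 1 π) (he : OrdEq O e (2 : F))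
    (h12 : R 2 - R 1 = -2 * e) (h13 : R 1 = R 3) :
    ¬ ∃ M : Submodule O V, (M : Set V) = nonNormGenerators Q L := by
  rintro ⟨M, hM⟩
  have h2 := he.ne_zero
  have he1 := one_le_of_ordEq_two he
  obtain ⟨x₁, x₂, L₂, K, H, hQ₁, hQ₂, _, hK⟩ := h.exists_headPair (n := n + 1) hR
  rw [nonNormGenerators_eq H.ord₁ ((isNormGenerator_iff H.ord₁).2 ⟨H.mem₁, H.norm₁⟩)] at hM
  have hr := hR.ordGE_third hK (fun _ => h13.le)
  have hs := hR.ordGE_third hK (fun _ => (by omega : R 2 ≤ R 3))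
  have hKL := H.le_of_norm₂ h2 hr hs
  obtain ⟨b, hb⟩ := H.exists_lift₂
  obtain ⟨x₃, hx₃, _, ho₃, _⟩ := hK.exists_first (hR.shift (n := n + 1) 2)
  replace ho₃ : OrdEq O (R 1) (Q x₃) := by rw [h13]; exact ho₃
  have key : ∀ y ∈ L, polar Q x₃ y = 0 → ∃ c : F, OrdGE O 0 c ∧ c • x₃ + y ∈ (M : Set V) := by
    intro y hy hpol
    obtain ⟨c, hc, hc'⟩ := exists_add_sq_mul (N := R 1) (j := 0) hπ
      ((H.norm₁ y hy).mono (by omega)) ho₃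
    refine ⟨c, hc, ?_⟩
    rw [hM]
    refine ⟨L.add_mem (smul_mem_of_ordGE hc (hKL hx₃)) hy, ?_⟩
    rw [map_smul_add_of_polar_eq_zero Q _ hpol, add_comm (c ^ 2 * Q x₃)]
    exact hc'.mono (by omega)
  have p31 : polar Q x₃ x₁ = 0 := by rw [QuadraticMap.polar_comm]; exact H.polarK₁ h2 hx₃
  have p32 : polar Q x₃ x₂ = 0 := by rw [QuadraticMap.polar_comm]; exact H.polarK₂ h2 hx₃
  obtain ⟨c, hc, hc'⟩ := key x₁ H.mem₁ p31
  obtain ⟨d, hd, hd'⟩ := key (b • x₁ + x₂) hb (by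
    rw [QuadraticMap.polar_add_right, QuadraticMap.polar_smul_right, p31, p32, smul_zero, add_zero])
  have hsum : c • x₃ + x₁ + (d • x₃ + (b • x₁ + x₂)) ∈ (M : Set V) := M.add_mem hc' hd'
  rw [hM] at hc' hd' hsum
  have h3 := (hsum.2.sub hc'.2).sub hd'.2
  have h4 : Q (c • x₃ + x₁ + (d • x₃ + (b • x₁ + x₂))) - Q (c • x₃ + x₁) -
      Q (d • x₃ + (b • x₁ + x₂)) = 2 * b * Q x₁ + c * d * (2 * Q x₃) := by
    change polar Q (c • x₃ + x₁) (d • x₃ + (b • x₁ + x₂)) = _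
    simp only [QuadraticMap.polar_add_right, QuadraticMap.polar_add_left,
      QuadraticMap.polar_smul_left, QuadraticMap.polar_smul_right, smul_eq_mul, p31, p32,
      QuadraticMap.polar_comm Q x₁ x₃, H.polar₁₂ h2, polar_self_mul]
    ring
  rw [h4] at h3
  have hb' : OrdEq O (-e) b := by
    obtain ⟨_, hb2⟩ := H.lift_ordGE h2 hb
    have h5 : OrdEq O (R 2) (b ^ 2 * Q x₁) :=
      H.ord₂.of_add_ge (by rw [add_comm (Q x₂)]; exact hb2.mono (by omega))
    have h6 := h5.div H.ord₁
    rw [mul_div_cancel_right₀ _ H.ord₁.ne_zero, h12] at h6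
    exact ordEq_of_sq (by convert h6 using 1; ring)
  have h5 : OrdEq O (R 1) (2 * b * Q x₁ + c * d * (2 * Q x₃)) := by
    have := ((he.mul hb').mul H.ord₁).add_ge (y := c * d * (2 * Q x₃))
      (((hc.mul hd).mul (he.ge.mul ho₃.ge)).mono (by omega))
    convert this using 1; omega
  exact h5.not_ge (by omega) h3

/-- The case of an anisotropic plane of discriminant `-Δ`. -/
theorem HasGoodBONG.isLattice_of_unramified (h : HasGoodBONG Q L (n + 2) a)
    (hR : HasOrders O (n + 2) a R) (hπ : OrdEq O 1 π) (he : OrdEq O e (2 : F))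
    (h12 : R 2 - R 1 = -2 * e) {Δ ρ t : F} (hρ : OrdEq O 0 ρ) (hΔ : Δ = 1 - 4 * ρ)
    (hΔ' : quadraticDefect O Δ = Submodule.span O {(4 : F)}) (ht : a 1 * a 2 = -Δ * t ^ 2)
    (h3 : 1 ≤ n → R 1 + 2 ≤ R 3) :
    IsLatticeWithGoodBONG O Q (nonNormGenerators Q L) (n + 2)
      (Function.update (Function.update a 1 (π ^ 2 * a 1)) 2 (π ^ 2 * a 2)) := by
  have h2 := he.ne_zero
  have he1 := one_le_of_ordEq_two he
  obtain ⟨x₁, x₂, L₂, K, H, hQ₁, hQ₂, _, hK⟩ := h.exists_headPair hR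
  have hgen := nonNormGenerators_eq H.ord₁ ((isNormGenerator_iff H.ord₁).2 ⟨H.mem₁, H.norm₁⟩)
  have h10 := H.ord₁.ne_zero
  have hr2 := hR.ordGE_third hK h3
  have hr : ∀ k ∈ K, OrdGE O (R 1) (Q k) := fun k hk => (hr2 k hk).mono (by omega)
  have hs : ∀ k ∈ K, OrdGE O (R 2) (Q k) := fun k hk => (hr2 k hk).mono (by omega)
  have h4 : OrdEq O (2 * e) (4 : F) := by
    have := he.sq
    rwa [show (2 : F) ^ 2 = 4 by norm_num] at this
  have hΔ0 : OrdEq O 0 Δ := by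
    rw [hΔ, sub_eq_add_neg]
    exact ordEq_one.add_ge ((h4.mul hρ).neg.ge.mono (by omega))
  -- the ring generator
  set c := t / Q x₁ with hcdef
  have hc : OrdEq O (-e) c := by
    have h5 : OrdEq O (2 * (R 1 - e)) (t ^ 2) := by
      have := (H.ord₁.mul H.ord₂).div hΔ0.neg
      rw [hQ₁, hQ₂, ht, mul_div_cancel_left₀ _ hΔ0.neg.ne_zero] at this
      convert this using 1; omega
    have := (ordEq_of_sq h5).div H.ord₁
    convert this using 1; omega
  -- With w = 2cd this turns the form on ux₁ + d(cx₁ + x₂) into (u² + uw + ρw²)Q(x₁).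
  have hcQ : c ^ 2 * Q x₁ + Q x₂ = ρ * (2 * c) ^ 2 * Q x₁ := by
    rw [hcdef]
    rw [← hQ₁, ← hQ₂, hΔ] at ht
    field_simp
    linear_combination ht
  have h2c : OrdEq O 0 (2 * c) := by
    have := he.mul hc
    rwa [add_neg_cancel] at this
  have hcL : OrdGE O (R 1) (c ^ 2 * Q x₁ + Q x₂) := by
    rw [hcQ]; exact ((hρ.mul h2c.sq).mul H.ord₁).ge.mono (by omega)
  have hy₀ := H.smul_add_mem he hc hcL
  -- A root of v² + v + ρ modulo 𝔭 would approximate Δ by (1 + 2v)² modulo 4𝔭, contrary to the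
  -- defect being 4O.
  have hanis : ∀ v : F, OrdGE O 0 v → ¬ OrdGE O 1 (v ^ 2 + v + ρ) := by
    intro v _ hv
    have h5 : Δ - (1 + 2 * v) ^ 2 = -4 * (v ^ 2 + v + ρ) := by rw [hΔ]; ring
    have h6 : (4 : F) ∈ Submodule.span O {Δ - (1 + 2 * v) ^ 2} := by
      have h7 : (4 : F) ∈ quadraticDefect O Δ := hΔ' ▸ Submodule.mem_span_singleton_self _
      rw [quadraticDefect, Submodule.mem_iInf] at h7
      exact h7 _
    rw [Submodule.mem_span_singleton, h5] at h6
    obtain ⟨o, ho⟩ := h6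
    have h7 : OrdGE O (2 * e + 1) (4 : F) := by
      rw [← ho, Algebra.smul_def]
      exact ((ordGE_algebraMap o).mul (h4.neg.ge.mul hv)).mono (by omega)
    exact h4.not_ge (by omega) h7
  have hQeq : ∀ u d : F, ∀ k ∈ K, Q (u • x₁ + d • (c • x₁ + x₂) + k) =
      (u ^ 2 + u * (2 * c * d) + ρ * (2 * c * d) ^ 2) * Q x₁ + Q k := by
    intro u d k hk
    rw [show u • x₁ + d • (c • x₁ + x₂) + k = (u + d * c) • x₁ + (d • x₂ + k) by module,
      H.map_eq h2 hk]
    linear_combination d ^ 2 * hcQ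
  have hdiv : ∀ u d : F, OrdGE O 0 u → OrdGE O 0 d →
      OrdGE O 1 (u ^ 2 + u * (2 * c * d) + ρ * (2 * c * d) ^ 2) → OrdGE O 1 u ∧ OrdGE O 1 d := by
    intro u d hu hd h5
    have hw : OrdGE O 0 (2 * c * d) := (h2c.ge.mul hd).mono (by omega)
    rcases hw.eq_or with h6 | h6
    · refine absurd ?_ (hanis (u / (2 * c * d)) ((hu.div h6).mono (by omega)))
      have := (h5.div h6.sq).mono (by omega : (1 : ℤ) ≤ _)
      convert this using 1
      have := h6.ne_zero
      have := left_ne_zero_of_mul this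
      have := right_ne_zero_of_mul h6.ne_zero
      have := right_ne_zero_of_mul h2c.ne_zero
      field_simp
    · have h7 : OrdGE O 1 (u ^ 2) := by
        have h8 : OrdGE O 1 (u * (2 * c * d)) := (hu.mul h6).mono (by omega)
        have h9 : OrdGE O 1 (ρ * (2 * c * d) ^ 2) := (hρ.ge.mul h6.sq).mono (by omega)
        have := (h5.sub h9).sub h8
        convert this using 1; ring
      exact ⟨h7.of_sq (by omega), h6.of_mul_left h2c (by omega)⟩
  set M : Submodule O V := Submodule.span O {π • x₁, π • (c • x₁ + x₂)} ⊔ K with hM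
  have hm₁ : π • x₁ ∈ M := Submodule.mem_sup_left (Submodule.subset_span (by simp))
  have hm₂ : π • (c • x₁ + x₂) ∈ M := Submodule.mem_sup_left (Submodule.subset_span (by simp))
  have hMmem : ∀ y, y ∈ M ↔ ∃ u d : F, OrdGE O 0 u ∧ OrdGE O 0 d ∧ ∃ k ∈ K,
      y = u • (π • x₁) + d • (π • (c • x₁ + x₂)) + k := by
    intro y
    constructor
    · intro hy
      obtain ⟨z, hz, k, hk, rfl⟩ := Submodule.mem_sup.1 hy
      obtain ⟨u, d, rfl⟩ := Submodule.mem_span_pair.1 hz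
      refine ⟨_, _, ordGE_algebraMap u, ordGE_algebraMap d, k, hk, ?_⟩
      rw [algebraMap_smul, algebraMap_smul]
    · rintro ⟨u, d, hu, hd, k, hk, rfl⟩
      exact M.add_mem (M.add_mem (smul_mem_of_ordGE hu hm₁) (smul_mem_of_ordGE hd hm₂))
        (Submodule.mem_sup_right hk)
  have hKL := H.le_of_norm₂ h2 hr hs
  refine ⟨M, ?_, ?_⟩
  · rw [hgen]
    ext y
    simp only [SetLike.mem_coe, Set.mem_ofPred_eq]
    constructor
    · intro hy
      obtain ⟨u, d, hu, hd, k, hk, rfl⟩ := (hMmem y).1 hy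
      have hu' : OrdGE O 1 (u * π) := (hu.mul hπ.ge).mono (by omega)
      have hd' : OrdGE O 1 (d * π) := (hd.mul hπ.ge).mono (by omega)
      have hw' : OrdGE O 1 (2 * c * (d * π)) := (h2c.ge.mul hd').mono (by omega)
      rw [smul_smul, smul_smul]
      refine ⟨L.add_mem (L.add_mem (smul_mem_of_ordGE (hu'.mono (by omega)) H.mem₁)
        (smul_mem_of_ordGE (hd'.mono (by omega)) hy₀)) (hKL hk), ?_⟩
      rw [hQeq _ _ k hk]
      refine OrdGE.add ?_ ((hr2 k hk).mono (by omega))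
      have : OrdGE O 1 ((u * π) ^ 2 + u * π * (2 * c * (d * π)) + ρ * (2 * c * (d * π)) ^ 2) :=
        ((hu'.sq.mono (by omega)).add ((hu'.mul hw').mono (by omega))).add
          ((hρ.ge.mul hw'.sq).mono (by omega))
      exact (this.mul H.ord₁.ge).mono (by omega)
    · rintro ⟨hy, hyQ⟩
      obtain ⟨u, d, hu, hd, k, hk, rfl⟩ := H.exists_integral_decomp h2 hr hs hy₀ hy
      rw [hQeq _ _ k hk] at hyQ
      have h5 := hyQ.sub ((hr2 k hk).mono (by omega))
      rw [add_sub_cancel_right] at h5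
      obtain ⟨hu', hd'⟩ := hdiv u d hu hd (h5.of_mul_right H.ord₁ (by omega))
      refine (hMmem _).2 ⟨u / π, d / π, (hu'.div hπ).mono (by omega),
        (hd'.div hπ).mono (by omega), k, hk, ?_⟩
      rw [smul_smul, smul_smul, div_mul_cancel₀ _ hπ.ne_zero, div_mul_cancel₀ _ hπ.ne_zero]
  · have ho₁ : OrdEq O (R 1 + 2) (π ^ 2 * a 1) := by
      have := hπ.sq.mul H.ord₁
      rw [hQ₁] at this
      convert this using 1; ring
    have ho₂ : OrdEq O (R 2 + 2) (π ^ 2 * a 2) := by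
      have := hπ.sq.mul H.ord₂
      rw [hQ₂] at this
      convert this using 1; ring
    refine hasGoodBONG_of_decomp (b := c) (w₁ := π • x₁) (w₂ := π • x₂) (r := R 1 + 2)
      (s := R 2 + 2) (K := K) h2 hm₁ ?_ le_sup_right ?_ ?_ ?_ ?_ ?_ ?_ ?_ ?_ ?_ ?_ ?_ ?_ ?_ ?_ ?_
    · convert hm₂ using 1; module
    · rw [QuadraticMap.polar_smul_left, QuadraticMap.polar_smul_right, H.polar₁₂ h2, smul_zero,
        smul_zero]
    · intro k hk
      rw [QuadraticMap.polar_smul_left, H.polarK₁ h2 hk, smul_zero]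
    · intro k hk
      rw [QuadraticMap.polar_smul_left, H.polarK₂ h2 hk, smul_zero]
    · intro y hy
      obtain ⟨u, d, hu, hd, k, hk, rfl⟩ := (hMmem y).1 hy
      exact ⟨u, d, hu, hd, k, hk, by module⟩
    · simp [map_smul_sq, hQ₁]
    · simp [map_smul_sq, hQ₂]
    · simpa using ho₁
    · simpa using ho₂
    · have := (hπ.sq.ge.mul hcL).mono (by omega : R 1 + 2 ≤ 2 * 1 + R 1)
      rw [hQ₁, hQ₂] at this
      convert this using 1
      simp; ring
    · exact h2c.ge
    · exact hr2
    · exact fun k hk => (hr2 k hk).mono (by omega)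
    · refine hK.congr fun i hi _ => ?_
      simp [Function.update, show i ≠ 0 by omega]
    · intro hn
      simp only [Function.update, show (3 : ℕ) ≠ 2 by decide, show (3 : ℕ) ≠ 1 by decide]
      exact (hR 3 (by omega) (by omega)).ge.mono (h3 hn)
    · intro hn
      -- Goodness at the second place: R 4 ≥ R 3 - 2e ≥ R 1 + 2 - 2e = R 2 + 2.
      have h34 : R 3 - 2 * e ≤ R 4 := (h.adjacent hR he (i := 3) (by omega) (by omega)).1
      have := h3 (by omega)
      simp only [Function.update, show (4 : ℕ) ≠ 2 by decide, show (4 : ℕ) ≠ 1 by decide]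
      exact (hR 4 (by omega) (by omega)).ge.mono (by omega)

variable [IsAdicComplete (IsLocalRing.maximalIdeal O) O]

/-- The plane is anisotropic, so an integral norm gives an integral trace, maximality gives an
integral β, and then the first coordinate relative to bx₁ + x₂ is integral too. Membership is thus
decided by the norm alone. -/
theorem HeadPair.pair_mem_of_binaryMaximal {r s : ℤ} {x₁ x₂ : V} {L₂ K : Submodule O V}
    (H : HeadPair Q L r s x₁ x₂ L₂ K) (he : OrdEq O e (2 : F)) (hrs : r - 2 * e < s)
    (hmax : BinaryMaximal O (Q x₁) (Q x₂) r) {b : F} (hb : b • x₁ + x₂ ∈ L) {α β : F}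
    (h : OrdGE O r (α ^ 2 * Q x₁ + β ^ 2 * Q x₂)) :
    OrdGE O 0 β ∧ OrdGE O 0 (α - β * b) ∧ α • x₁ + β • x₂ ∈ L := by
  have h2 := he.ne_zero
  have hα := ordGE_two_mul_of_anisotropic H.ord₁ he (hmax.ne_neg_sq he H.ord₁ H.ord₂ hrs) h
  have hβ := hmax α β hα h
  obtain ⟨hb1, hb2⟩ := H.lift_ordGE h2 hb
  have hαβ := ordGE_sub_mul H.ord₁ hα hβ h hb1 hb2
  exact ⟨hβ, hαβ, H.pair_mem h2 hb hβ hαβ⟩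

/-- A maximal component contains a vector of order R 1 + 1. All its polar values have at least that
order, so its reflection preserves `L` with the wrong parity. -/
theorem HasGoodBONG.not_binaryMaximal_of_reflectionParity (h : HasGoodBONG Q L (n + 2) a)
    (hR : HasOrders O (n + 2) a R) (hπ : OrdEq O 1 π) (he : OrdEq O e (2 : F))
    (h12 : R 1 - 2 * e < R 2) (hpar : ReflectionParity Q L (R 1)) :
    ¬ BinaryMaximal O (a 1) (a 2) (R 1) := by
  intro hmax
  obtain ⟨x₁, x₂, L₂, K, H, hQ₁, hQ₂, _, _⟩ := h.exists_headPair hR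
  rw [← hQ₁, ← hQ₂] at hmax
  obtain ⟨α, β, _, hαβ⟩ := hmax.exists_ordEq_succ hπ he H.ord₁ H.ord₂ h12
  obtain ⟨b, hb⟩ := H.exists_lift₂
  obtain ⟨_, _, hmem⟩ := H.pair_mem_of_binaryMaximal he h12 hmax hb (hαβ.ge.mono (by omega))
  refine hpar.not_ordEq_succ
    (h.ordGE_polar_succ he (one_le_of_ordEq_two he) hR (fun _ => h12)) _ hmem ?_
  rwa [H.map_pair he.ne_zero]

/-- The case of a maximal binary component. -/
theorem HasGoodBONG.isLattice_of_binaryMaximal (h : HasGoodBONG Q L (n + 2) a)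
    (hR : HasOrders O (n + 2) a R) (hπ : OrdEq O 1 π) (he : OrdEq O e (2 : F))
    (h12 : R 1 - 2 * e < R 2) (hB : PropertyB O e (n + 2) a R)
    (hmax : BinaryMaximal O (a 1) (a 2) (R 1)) {η : F} (hη : OrdEq O 0 η)
    (hsymb : hilbertSymbol (π * η) (-(a 1 * a 2)) = 1) :
    IsLatticeWithGoodBONG O Q (nonNormGenerators Q L) (n + 2)
      (Function.update (Function.update a 1 (π * η * a 1)) 2 (π * η * a 2)) := by
  have h2 := he.ne_zero
  have he1 := one_le_of_ordEq_two he
  obtain ⟨x₁, x₂, L₂, K, H, hQ₁, hQ₂, _, hK⟩ := h.exists_headPair hR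
  have hgen := nonNormGenerators_eq H.ord₁ ((isNormGenerator_iff H.ord₁).2 ⟨H.mem₁, H.norm₁⟩)
  rw [← hQ₁, ← hQ₂] at hmax hsymb
  have h10 := H.ord₁.ne_zero
  have han := hmax.ne_neg_sq he H.ord₁ H.ord₂ h12
  -- Property B applies to the first pair: maximality bounds the defect if R 2 - R 1 is even and
  -- gives R 2 - R 1 ≤ 1 if it is odd.
  have h13 : 1 ≤ n → R 2 + 2 * e < R 3 := by
    intro hn
    obtain ⟨α, β, _, hαβ⟩ := hmax.exists_ordEq_succ hπ he H.ord₁ H.ord₂ h12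
    have hα := ordGE_two_mul_of_anisotropic H.ord₁ he han (hαβ.ge.mono (by omega))
    have : R 3 - R 2 > 2 * e := by
      refine (hB.2 1 le_rfl (by omega) ?_).2 (by omega)
      rcases Int.even_or_odd (R 2 - R 1) with heven | ⟨i, hi⟩
      · right
        refine ⟨heven, ?_⟩
        have := hmax.relDefect_le he H.ord₁ H.ord₂ h12 heven hα hαβ
        rwa [hQ₁, hQ₂] at this
      · left
        refine ⟨⟨i, hi⟩, ?_⟩
        have hz := uniformizer_zpow hπ (-i)
        have := hmax 0 (π ^ (-i)) (by rw [mul_zero]; exact OrdGE.zero 0) (by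
          rw [zero_pow two_ne_zero, zero_mul, zero_add]
          exact (hz.sq.mul H.ord₂).ge.mono (by omega))
        have := hz.le_of_ge this
        change R 2 - R 1 ≤ 2 * e + 1
        omega
    omega
  have hr : ∀ k ∈ K, OrdGE O (R 1 + 1) (Q k) :=
    hR.ordGE_third hK (fun hn => by have := h13 hn; omega)
  have hs : ∀ k ∈ K, OrdGE O (R 2 + 1) (Q k) :=
    hR.ordGE_third hK (fun hn => by have := h13 hn; omega)
  have hKL := H.le_of_norm₂ h2 (fun k hk => (hr k hk).mono (by omega))
    (fun k hk => (hs k hk).mono (by omega))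
  have hpol := h.ordGE_polar_succ he he1 hR (fun _ => h12)
  obtain ⟨b, hb⟩ := H.exists_lift₂
  obtain ⟨hb1, hb2⟩ := H.lift_ordGE h2 hb
  obtain ⟨α₀, β₀, hαβ⟩ := exists_norm_eq_of_hilbertSymbol h10 han hsymb
  have hπη : OrdEq O 1 (π * η) := by
    have := hπ.mul hη
    rwa [add_zero] at this
  have hπη0 := hπη.ne_zero
  -- In terms of the quadratic algebra, w₁ = z₀ and w₂ = z₀ω for an element z₀ of norm πη: the
  -- images of x₁ and x₂ under a similarity.
  set w₁ : V := α₀ • x₁ + β₀ • x₂ with hw₁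
  set w₂ : V := (-(β₀ * (Q x₂ / Q x₁))) • x₁ + α₀ • x₂ with hw₂
  have hQw₁ : Q w₁ = π * η * Q x₁ := by rw [hw₁, H.map_pair h2, hαβ]
  have hQw₂ : Q w₂ = π * η * Q x₂ := by
    rw [hw₂, H.map_pair h2]
    field_simp
    linear_combination Q x₂ * hαβ
  have hlow : ∀ α β : F, OrdGE O (R 1 + 1) (α ^ 2 * Q x₁ + β ^ 2 * Q x₂) →
      α • x₁ + β • x₂ ∈ sublatticeOrdGE Q L (R 1 + 1) hpol := fun α β h3 =>
    ⟨(H.pair_mem_of_binaryMaximal he h12 hmax hb (h3.mono (by omega))).2.2, by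
      rwa [H.map_pair h2]⟩
  have ho₁ : OrdEq O (R 1 + 1) (π * η * a 1) := by
    have := hπη.mul H.ord₁
    rw [hQ₁] at this
    convert this using 1; ring
  have ho₂ : OrdEq O (R 2 + 1) (π * η * a 2) := by
    have := hπη.mul H.ord₂
    rw [hQ₂] at this
    convert this using 1; ring
  have pw : ∀ k ∈ K, ∀ α β : F, polar Q (α • x₁ + β • x₂) k = 0 := by
    intro k hk α β
    rw [QuadraticMap.polar_add_left, QuadraticMap.polar_smul_left, QuadraticMap.polar_smul_left,
      H.polarK₁ h2 hk, H.polarK₂ h2 hk, smul_zero, smul_zero, add_zero]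
  refine ⟨sublatticeOrdGE Q L (R 1 + 1) hpol, hgen.symm, ?_⟩
  refine hasGoodBONG_of_decomp (b := b) (w₁ := w₁) (w₂ := w₂) (r := R 1 + 1)
    (s := R 2 + 1) (K := K) h2 ?_ ?_ ?_ ?_ ?_ ?_ ?_ ?_ ?_ ?_ ?_ ?_ hb1 hr hs ?_ ?_ ?_
  · refine hlow _ _ ?_
    rw [hαβ, hQ₁]
    exact ho₁.ge
  · have := hlow (b * α₀ - β₀ * (Q x₂ / Q x₁)) (b * β₀ + α₀) (by
      have h3 := (hπη.ge.mul hb2).mono (by omega : R 1 + 1 ≤ 1 + R 1)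
      convert h3 using 1
      field_simp
      linear_combination (b ^ 2 * Q x₁ + Q x₂) * hαβ)
    convert this using 1
    rw [hw₁, hw₂]
    module
  · exact fun k hk => ⟨hKL hk, hr k hk⟩
  · rw [hw₁, hw₂]
    simp only [QuadraticMap.polar_add_right, QuadraticMap.polar_add_left,
      QuadraticMap.polar_smul_left, QuadraticMap.polar_smul_right, smul_eq_mul,
      QuadraticMap.polar_comm Q x₂ x₁, H.polar₁₂ h2, polar_self_mul]
    field_simp
    ring
  · exact fun k hk => pw k hk _ _
  · exact fun k hk => pw k hk _ _
  · rintro y ⟨hy, hyQ⟩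
    obtain ⟨u, c, hu, hc, k, hk, rfl⟩ := H.exists_integral_decomp h2
      (fun k hk => (hr k hk).mono (by omega)) (fun k hk => (hs k hk).mono (by omega)) hb hy
    have hm : OrdGE O (R 1 + 1) ((u + c * b) ^ 2 * Q x₁ + c ^ 2 * Q x₂) := by
      rw [show u • x₁ + c • (b • x₁ + x₂) + k = (u + c * b) • x₁ + (c • x₂ + k) by module,
        H.map_eq h2 hk] at hyQ
      have := hyQ.sub (hr k hk)
      convert this using 1; ring
    -- These are the coordinates of the quotient by z₀, computed as multiplication by the conjugate
    -- divided by πη. The quotient has value of order at least R 1, so it lies in the maximal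
    -- lattice.
    obtain ⟨h3, h4, _⟩ := H.pair_mem_of_binaryMaximal he h12 hmax hb
      (α := (α₀ * (u + c * b) + Q x₂ / Q x₁ * β₀ * c) / (π * η))
      (β := (α₀ * c - β₀ * (u + c * b)) / (π * η)) (by
        have := (hm.div hπη).mono (by omega : R 1 ≤ R 1 + 1 - 1)
        convert this using 1
        have hη0 := hη.ne_zero
        have hπ0 := hπ.ne_zero
        field_simp
        linear_combination (Q x₁ * (u + c * b) ^ 2 + c ^ 2 * Q x₂) * hαβ)
    refine ⟨_, _, h4, h3, k, hk, ?_⟩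
    congr 1
    have hη0 := hη.ne_zero
    have hπ0 := hπ.ne_zero
    rw [hw₁, hw₂]
    match_scalars
    · field_simp
      linear_combination (-(u + c * b)) * hαβ
    · field_simp
      linear_combination (-c) * hαβ
  · rw [hQw₁, hQ₁]; simp
  · rw [hQw₂, hQ₂]; simp
  · simpa using ho₁
  · simpa using ho₂
  · have := (hπη.ge.mul hb2).mono (by omega : R 1 + 1 ≤ 1 + R 1)
    rw [hQ₁, hQ₂] at this
    convert this using 1
    simp; ring
  · refine hK.congr fun i hi _ => ?_
    simp [Function.update, show i ≠ 0 by omega]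
  · intro hn
    have := h13 hn
    simp only [Function.update, show (3 : ℕ) ≠ 2 by decide, show (3 : ℕ) ≠ 1 by decide]
    exact (hR 3 (by omega) (by omega)).ge.mono (by omega)
  · intro hn
    have : R 2 < R 4 := hB.1 2 (by omega) (by omega)
    simp only [Function.update, show (4 : ℕ) ≠ 2 by decide, show (4 : ℕ) ≠ 1 by decide]
    exact (hR 4 (by omega) (by omega)).ge.mono (by omega)

end Cases

/-! ### Projection to the complement of a hyperbolic plane. -/

section HyperbolicProjection

variable {F V : Type*} [Field F] [AddCommGroup V] [Module F V] {Q : QuadraticForm F V}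

/-- The orthogonal projection to the complement of the hyperbolic plane with isotropic basis
`y, g`. -/
noncomputable def hyperbolicProj (Q : QuadraticForm F V) (y g : V) : V →ₗ[F] V :=
  LinearMap.id - ((polar Q y g)⁻¹ • Q.polarBilin g).smulRight y -
    ((polar Q y g)⁻¹ • Q.polarBilin y).smulRight g

theorem hyperbolicProj_apply (y g x : V) : hyperbolicProj Q y g x =
    x - ((polar Q y g)⁻¹ * polar Q g x) • y - ((polar Q y g)⁻¹ * polar Q y x) • g := by
  simp [hyperbolicProj]

variable {y g : V} (hy : Q y = 0) (hg : Q g = 0) (h : polar Q y g ≠ 0)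

theorem hyperbolicProj_eq_self {x : V} (h1 : polar Q y x = 0) (h2 : polar Q g x = 0) :
    hyperbolicProj Q y g x = x := by
  rw [hyperbolicProj_apply, h1, h2]; simp

include hy h in
theorem hyperbolicProj_left : hyperbolicProj Q y g y = 0 := by
  rw [hyperbolicProj_apply, QuadraticMap.polar_comm Q g y, polar_self_mul, hy, mul_zero, mul_zero,
    inv_mul_cancel₀ h]
  simp

include hg h in
theorem hyperbolicProj_right : hyperbolicProj Q y g g = 0 := by
  rw [hyperbolicProj_apply, polar_self_mul, hg, mul_zero, mul_zero, inv_mul_cancel₀ h]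
  simp

include hy h in
theorem polar_left_hyperbolicProj (x : V) : polar Q y (hyperbolicProj Q y g x) = 0 := by
  rw [hyperbolicProj_apply, QuadraticMap.polar_sub_right, QuadraticMap.polar_sub_right,
    QuadraticMap.polar_smul_right, QuadraticMap.polar_smul_right, polar_self_mul, hy, smul_eq_mul,
    smul_eq_mul]
  field_simp
  ring

include hg h in
theorem polar_right_hyperbolicProj (x : V) : polar Q g (hyperbolicProj Q y g x) = 0 := by
  rw [hyperbolicProj_apply, QuadraticMap.polar_sub_right, QuadraticMap.polar_sub_right,
    QuadraticMap.polar_smul_right, QuadraticMap.polar_smul_right, polar_self_mul, hg, smul_eq_mul,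
    smul_eq_mul, QuadraticMap.polar_comm Q g y]
  field_simp
  ring

theorem polar_hyperbolicProj_of_orthogonal {v : V} (h1 : polar Q y v = 0) (h2 : polar Q g v = 0)
    (x : V) : polar Q (hyperbolicProj Q y g x) v = polar Q x v := by
  rw [hyperbolicProj_apply, QuadraticMap.polar_sub_left, QuadraticMap.polar_sub_left,
    QuadraticMap.polar_smul_left, QuadraticMap.polar_smul_left, h1, h2, smul_zero, smul_zero,
    sub_zero, sub_zero]

include hy hg h in
theorem map_hyperbolicProj (x : V) : Q (hyperbolicProj Q y g x) =
    Q x - polar Q y x * polar Q g x / polar Q y g := by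
  rw [hyperbolicProj_apply, show x - ((polar Q y g)⁻¹ * polar Q g x) • y -
      ((polar Q y g)⁻¹ * polar Q y x) • g = (-((polar Q y g)⁻¹ * polar Q g x)) • y +
      ((-((polar Q y g)⁻¹ * polar Q y x)) • g + x) by module, map_smul_add, map_smul_add,
    QuadraticMap.polar_add_right, QuadraticMap.polar_smul_right, hy, hg, smul_eq_mul]
  field_simp
  ring

theorem map_triple {u₁ u₂ u₃ : V} (p₁₂ : polar Q u₁ u₂ = 0) (p₁₃ : polar Q u₁ u₃ = 0)
    (p₂₃ : polar Q u₂ u₃ = 0) (α β γ : F) :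
    Q (α • u₁ + β • u₂ + γ • u₃) = α ^ 2 * Q u₁ + β ^ 2 * Q u₂ + γ ^ 2 * Q u₃ := by
  rw [map_add_polar, map_add_polar, map_smul_sq, map_smul_sq, map_smul_sq]
  simp only [QuadraticMap.polar_add_left, QuadraticMap.polar_smul_left,
    QuadraticMap.polar_smul_right, p₁₂, p₁₃, p₂₃, smul_zero, add_zero]

theorem polar_triple {u₁ u₂ u₃ : V} (p₁₂ : polar Q u₁ u₂ = 0) (p₁₃ : polar Q u₁ u₃ = 0)
    (p₂₃ : polar Q u₂ u₃ = 0) (α β γ α' β' γ' : F) :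
    polar Q (α • u₁ + β • u₂ + γ • u₃) (α' • u₁ + β' • u₂ + γ' • u₃) =
      2 * (α * α' * Q u₁ + β * β' * Q u₂ + γ * γ' * Q u₃) := by
  simp only [QuadraticMap.polar_add_left, QuadraticMap.polar_add_right,
    QuadraticMap.polar_smul_left, QuadraticMap.polar_smul_right, p₁₂, p₁₃, p₂₃,
    QuadraticMap.polar_comm Q u₂ u₁, QuadraticMap.polar_comm Q u₃ u₁,
    QuadraticMap.polar_comm Q u₃ u₂, polar_self_mul, smul_eq_mul]
  ring

/-- The discriminant of a ternary space that is split by a hyperbolic plane. -/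
theorem discriminant_identity {q₁ q₂ q₃ α₁ α₂ α₃ β₁ β₂ β₃ h : F}
    (hα : α₁ ^ 2 * q₁ + α₂ ^ 2 * q₂ + α₃ ^ 2 * q₃ = 0)
    (hβ : β₁ ^ 2 * q₁ + β₂ ^ 2 * q₂ + β₃ ^ 2 * q₃ = 0)
    (hh : h = 2 * (α₁ * β₁ * q₁ + α₂ * β₂ * q₂ + α₃ * β₃ * q₃)) (h0 : h ≠ 0) :
    (q₃ - 2 * α₃ * q₃ * (2 * β₃ * q₃) / h) * h ^ 2 =
      -(4 * q₁ * q₂ * q₃ * (α₁ * β₂ - α₂ * β₁) ^ 2) := by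
  have h1 : (q₃ - 2 * α₃ * q₃ * (2 * β₃ * q₃) / h) * h ^ 2 =
      q₃ * h ^ 2 - 2 * α₃ * q₃ * (2 * β₃ * q₃) * h := by
    field_simp
  rw [h1, hh]
  linear_combination (-4 * q₃) * (hα * (β₃ ^ 2 * q₃) - hβ * (α₁ ^ 2 * q₁ + α₂ ^ 2 * q₂))

end HyperbolicProjection

/-! ### Hyperbolic planes that split a lattice. -/

section Splitting

variable {O F V : Type*} [CommRing O] [IsDomain O] [IsDiscreteValuationRing O]
  [Field F] [Algebra O F] [IsFractionRing O F]
  [AddCommGroup V] [Module F V] [Module O V] [IsScalarTower O F V]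
  {Q : QuadraticForm F V} {L J : Submodule O V} {π : F} {e : ℤ} {n : ℕ}

/-- `L` is the orthogonal sum of the lattice with the isotropic basis `y, g` and of `J`. -/
structure HyperbolicSplitting (Q : QuadraticForm F V) (L J : Submodule O V) (y g : V) : Prop where
  mem_left : y ∈ L
  mem_right : g ∈ L
  le : J ≤ L
  map_left : Q y = 0
  map_right : Q g = 0
  polar_left : ∀ w ∈ J, polar Q y w = 0
  polar_right : ∀ w ∈ J, polar Q g w = 0
  exists_decomp : ∀ x ∈ L, ∃ u v : F, OrdGE O 0 u ∧ OrdGE O 0 v ∧ ∃ w ∈ J, x = u • y + v • g + w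

namespace HyperbolicSplitting

variable {y g : V}

theorem map_eq (H : HyperbolicSplitting Q L J y g) (u v : F) {w : V} (hw : w ∈ J) :
    Q (u • y + v • g + w) = u * v * polar Q y g + Q w := by
  rw [show u • y + v • g + w = u • y + (v • g + w) by module, map_smul_add, map_smul_add,
    QuadraticMap.polar_add_right, QuadraticMap.polar_smul_right, H.map_left, H.map_right,
    H.polar_left w hw, H.polar_right w hw, smul_eq_mul]
  ring

theorem smul (H : HyperbolicSplitting Q L J y g) {c : F} (hc : OrdEq O 0 c) :
    HyperbolicSplitting Q L J (c • y) g where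
  mem_left := smul_mem_of_ordGE hc.ge H.mem_left
  mem_right := H.mem_right
  le := H.le
  map_left := by rw [map_smul_sq, H.map_left, mul_zero]
  map_right := H.map_right
  polar_left w hw := by rw [QuadraticMap.polar_smul_left, H.polar_left w hw, smul_zero]
  polar_right := H.polar_right
  exists_decomp x hx := by
    obtain ⟨u, v, hu, hv, w, hw, rfl⟩ := H.exists_decomp x hx
    refine ⟨u / c, v, (hu.div hc).mono (by omega), hv, w, hw, ?_⟩
    rw [smul_smul, div_mul_cancel₀ _ hc.ne_zero]

/-- A vector of `J` is orthogonal to the plane, so a reflection preserving `J` preserves `L`; this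
lets the parity property descend in the induction. -/
theorem reflectionParity (H : HyperbolicSplitting Q L J y g) {r : ℤ}
    (hpar : ReflectionParity Q L r) : ReflectionParity Q J r := by
  intro x hx k hk hpol
  refine hpar x (H.le hx) k hk fun z hz => ?_
  obtain ⟨u, v, _, _, w, hw, rfl⟩ := H.exists_decomp z hz
  rw [QuadraticMap.polar_add_right, QuadraticMap.polar_add_right, QuadraticMap.polar_smul_right,
    QuadraticMap.polar_smul_right, QuadraticMap.polar_comm Q x y, QuadraticMap.polar_comm Q x g,
    H.polar_left x hx, H.polar_right x hx, smul_zero, smul_zero, zero_add, zero_add]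
  exact hpol w hw

/-- A good BONG of `H ⟂ J`, where `H` is a hyperbolic plane, in terms of a good BONG of `J`. -/
theorem hasGoodBONG (H : HyperbolicSplitting Q L J y g) (he : OrdEq O e (2 : F))
    {a b : ℕ → F} {S : ℕ → ℤ} (hJ : HasGoodBONG Q J (n + 1) b) (hS : HasOrders O (n + 1) b S)
    {κ : F} {j : ℤ} (hκ : OrdEq O j κ) (hj : -e ≤ j) (hj' : j ≤ e)
    (hyg : polar Q y g = -(2 * κ * b 1)) (hS2 : 1 ≤ n → S 1 + 2 * j ≤ S 2)
    (ha1 : a 1 = b 1) (ha2 : a 2 = -(κ ^ 2 * b 1)) (ha : ∀ i, 1 ≤ i → i ≤ n + 1 → a (i + 2) = b i) :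
    HasGoodBONG Q L (n + 3) a := by
  have h2 := he.ne_zero
  have hκ0 := hκ.ne_zero
  obtain ⟨t, ht, hQt, hot, hnorm, _, hJ2⟩ := hJ.exists_first hS
  have hb0 : b 1 ≠ 0 := hQt ▸ hot.ne_zero
  have pyt := H.polar_left t ht
  have pgt := H.polar_right t ht
  have hot' : OrdEq O (S 1) (b 1) := hQt ▸ hot
  -- Adding an isotropic vector orthogonal to t keeps the value b 1 but makes the polar value with y
  -- nonzero. The coefficient κ then makes x₂ orthogonal to x₁.
  set x₁ : V := t - g with hx₁
  set x₂ : V := y - κ • x₁ with hx₂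
  have hQx₁ : Q x₁ = b 1 := by
    rw [hx₁, show t - g = (-1 : F) • g + t by module, map_smul_add, H.map_right, pgt, hQt]; ring
  have hQx₁0 : Q x₁ ≠ 0 := hQx₁ ▸ hb0
  have pyx₁ : polar Q y x₁ = 2 * κ * b 1 := by
    rw [hx₁, QuadraticMap.polar_sub_right, pyt, hyg]; ring
  have px₁₂ : polar Q x₁ x₂ = 0 := by
    rw [hx₂, QuadraticMap.polar_sub_right, QuadraticMap.polar_smul_right, polar_self_mul, hQx₁,
      QuadraticMap.polar_comm Q x₁ y, pyx₁, smul_eq_mul]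
    ring
  have hQx₂ : Q x₂ = -(κ ^ 2 * b 1) := by
    rw [hx₂, show y - κ • x₁ = (-κ) • x₁ + y by module, map_smul_add, H.map_left, hQx₁,
      QuadraticMap.polar_comm, pyx₁]
    ring
  have ho₂ : OrdEq O (S 1 + 2 * j) (-(κ ^ 2 * b 1)) := by
    have := (hκ.sq.mul hot').neg
    rwa [add_comm] at this
  -- the isometry that maps `J` to the complement of `x₁, x₂`
  set p : V →ₗ[F] V :=
    LinearMap.id - ((2 * κ * b 1)⁻¹ • Q.polarBilin t).smulRight y with hp
  have hpw : ∀ w, p w = w - ((2 * κ * b 1)⁻¹ * polar Q t w) • y := by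
    intro w; simp [hp]
  have hpQ : ∀ w ∈ LinearMap.ker (Q.polarBilin y), Q (p w) = Q w := by
    intro w hw
    have hw' : polar Q y w = 0 := hw
    rw [hpw, sub_eq_add_neg, ← neg_smul, add_comm, map_smul_add, H.map_left, hw']
    ring
  have hpx₁ : ∀ w ∈ J, polar Q x₁ (p w) = 0 := by
    intro w hw
    rw [hpw, QuadraticMap.polar_sub_right, QuadraticMap.polar_smul_right,
      QuadraticMap.polar_comm Q x₁ y, pyx₁, hx₁, QuadraticMap.polar_sub_left, H.polar_right w hw,
      smul_eq_mul]
    field_simp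
    ring
  have hpy : ∀ w ∈ J, polar Q y (p w) = 0 := by
    intro w hw
    rw [hpw, QuadraticMap.polar_sub_right, QuadraticMap.polar_smul_right, polar_self_mul,
      H.map_left, H.polar_left w hw]
    simp
  have hpx₂ : ∀ w ∈ J, polar Q x₂ (p w) = 0 := by
    intro w hw
    rw [hx₂, QuadraticMap.polar_sub_left, QuadraticMap.polar_smul_left, hpy w hw, hpx₁ w hw]
    simp
  have hproj : ∀ u v : F, ∀ w ∈ J, projPerp Q x₁ (u • y + v • g + w) =
      (u + (2 * κ * b 1)⁻¹ * polar Q t (w + v • t)) • x₂ + p (w + v • t) := by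
    intro u v w hw
    have hwJ : polar Q y (w + v • t) = 0 := by
      rw [QuadraticMap.polar_add_right, QuadraticMap.polar_smul_right, H.polar_left w hw, pyt]
      simp
    have hpw1 : polar Q x₁ (p (w + v • t)) = 0 := by
      rw [map_add, map_smul, QuadraticMap.polar_add_right, QuadraticMap.polar_smul_right,
        hpx₁ w hw, hpx₁ t ht]
      simp
    have : u • y + v • g + w =
        ((u + (2 * κ * b 1)⁻¹ * polar Q t (w + v • t)) * κ - v) • x₁ +
        ((u + (2 * κ * b 1)⁻¹ * polar Q t (w + v • t)) • x₂ + p (w + v • t)) := by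
      rw [hpw, hx₂, hx₁]
      module
    rw [this, projPerp_smul_add h2 hQx₁0]
    rw [QuadraticMap.polar_add_right, QuadraticMap.polar_smul_right, px₁₂, hpw1, smul_zero,
      add_zero]
  have hmem : ∀ z, z ∈ projLattice Q L x₁ ↔ ∃ u : F, OrdGE O 0 u ∧ ∃ w ∈ J,
      z = (u + (2 * κ * b 1)⁻¹ * polar Q t w) • x₂ + p w := by
    intro z
    rw [mem_projLattice]
    constructor
    · rintro ⟨x, hx, rfl⟩
      obtain ⟨u, v, hu, hv, w, hw, rfl⟩ := H.exists_decomp x hx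
      exact ⟨u, hu, w + v • t, J.add_mem hw (smul_mem_of_ordGE hv ht), hproj u v w hw⟩
    · rintro ⟨u, hu, w, hw, rfl⟩
      refine ⟨u • y + w, L.add_mem (smul_mem_of_ordGE hu H.mem_left) (H.le hw), ?_⟩
      have := hproj u 0 w hw
      rwa [zero_smul, zero_smul, add_zero, add_zero] at this
  refine hasGoodBONG_succ (n := n + 2) (x := x₁) (k := S 1) ?_ (hQx₁.trans ha1.symm)
    (ha1 ▸ hot') ?_ ?_ ?_
  · exact L.sub_mem (H.le ht) H.mem_right
  · intro x hx
    obtain ⟨u, v, hu, hv, w, hw, rfl⟩ := H.exists_decomp x hx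
    rw [H.map_eq u v hw, hyg]
    exact (((hu.mul hv).mul ((he.mul hκ).mul hot').neg.ge).mono (by omega)).add (hnorm w hw)
  · refine hasGoodBONG_succ (n := n + 1) (x := x₂) (k := S 1 + 2 * j) ?_ (hQx₂.trans ha2.symm)
      (ha2 ▸ ho₂) ?_ ?_ ?_
    · refine (hmem _).2 ⟨1, ordGE_one, 0, J.zero_mem, ?_⟩
      simp
    · intro z hz
      obtain ⟨u, hu, w, hw, rfl⟩ := (hmem z).1 hz
      rw [map_smul_add_of_polar_eq_zero Q _ (hpx₂ w hw), hQx₂, hpQ w (H.polar_left w hw)]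
      have h3 : OrdGE O (S 1 + 2 * j) (Q (projPerp Q t w)) := by
        refine hJ2.ordGE (s := S 2) (fun hn => ⟨hS 2 (by omega) (by omega), hS2 hn⟩) _
          (mem_projLattice.2 ⟨w, hw, rfl⟩)
      have h4 : OrdGE O (S 1 + j) (polar Q t w) := by
        refine hJ.ordGE_polar_of_le he _ hS _ (fun _ => by omega) (fun hn => ?_) t ht w hw
        have := hS2 (by omega)
        omega
      have h5 : Q (projPerp Q t w) = Q w - polar Q t w ^ 2 / (4 * b 1) := by
        rw [projPerp_apply, sub_eq_add_neg, ← neg_smul, add_comm w, map_smul_add, hQt]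
        have h4' : (4 : F) = 2 * 2 := by norm_num
        rw [h4']
        field_simp
        ring
      -- Expanding the square, the term with denominator combines with Q(w) to the value of the
      -- projection of w along t, whose order is bounded below by that of the second entry of the
      -- BONG of `J`.
      have h6 : (u + (2 * κ * b 1)⁻¹ * polar Q t w) ^ 2 * -(κ ^ 2 * b 1) + Q w =
          u ^ 2 * -(κ ^ 2 * b 1) + -(u * κ * polar Q t w) + Q (projPerp Q t w) := by
        rw [h5]
        have h4' : (4 : F) = 2 * 2 := by norm_num
        rw [h4']
        field_simp
        ring
      rw [h6]
      exact (((hu.sq.mul ho₂.ge).mono (by omega)).add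
        (((hu.mul hκ.ge).mul h4).neg.mono (by omega))).add h3
    · have hmap : projLattice Q (projLattice Q L x₁) x₂ = J.map (p.restrictScalars O) := by
        have hQx₂0 : Q x₂ ≠ 0 := hQx₂ ▸ ho₂.ne_zero
        ext z
        rw [mem_projLattice, Submodule.mem_map]
        constructor
        · rintro ⟨x, hx, rfl⟩
          obtain ⟨u, _, w, hw, rfl⟩ := (hmem x).1 hx
          exact ⟨w, hw, (projPerp_smul_add h2 hQx₂0 (hpx₂ w hw) _).symm⟩
        · rintro ⟨w, hw, rfl⟩
          exact ⟨_, (hmem _).2 ⟨0, OrdGE.zero 0, w, hw, rfl⟩,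
            projPerp_smul_add h2 hQx₂0 (hpx₂ w hw) _⟩
      rw [hmap]
      refine (hJ.map p hpQ fun w hw => H.polar_left w hw).congr fun i hi hin => ?_
      exact (ha i hi hin).symm
    · intro hn
      change OrdGE O _ (a (2 + 2))
      rw [ha 2 (by omega) (by omega)]
      exact (hS 2 (by omega) (by omega)).ge.mono (hS2 (by omega))
  · intro _
    rw [show (3 : ℕ) = 1 + 2 from rfl, ha 1 le_rfl (by omega)]
    exact hot'.ge

end HyperbolicSplitting

/-- Two vectors of a lattice that span a lattice with even diagonal and are isotropic modulo the
scale can be changed into isotropic vectors. -/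
theorem exists_isotropic_pair [IsAdicComplete (IsLocalRing.maximalIdeal O) O] {y g : V} {m : ℤ}
    (hy : OrdGE O (m + 1) (Q y)) (hg : OrdGE O (m + 1) (Q g)) (hyg : OrdEq O m (polar Q y g)) :
    ∃ τ σ : F, OrdGE O 0 τ ∧ OrdGE O 0 σ ∧ Q (y + τ • g) = 0 ∧ Q (g - σ • (y + τ • g)) = 0 ∧
      OrdEq O m (polar Q (y + τ • g) (g - σ • (y + τ • g))) := by
  obtain ⟨τ, hτ, hτ'⟩ := exists_quadratic_root hy hyg hg
  have hQy : Q (y + τ • g) = 0 := by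
    rw [add_comm, map_smul_add, QuadraticMap.polar_comm]
    linear_combination hτ'
  have hpol : OrdEq O m (polar Q (y + τ • g) g) := by
    rw [QuadraticMap.polar_add_left, QuadraticMap.polar_smul_left, polar_self_mul, smul_eq_mul]
    exact hyg.add_ge ((hτ.mul (ordGE_zero_two.mul hg)).mono (by omega))
  refine ⟨τ, Q g / polar Q (y + τ • g) g, hτ.mono (by omega), (hg.div hpol).mono (by omega), hQy,
    ?_, ?_⟩
  · rw [sub_eq_add_neg, ← neg_smul, add_comm, map_smul_add, hQy, neg_mul,
      div_mul_cancel₀ _ hpol.ne_zero]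
    ring
  · rw [QuadraticMap.polar_sub_right, QuadraticMap.polar_smul_right, polar_self_mul, hQy, mul_zero,
      smul_zero, sub_zero]
    exact hpol

/-- A ternary configuration `u₁, u₂, u₃` in a lattice whose reflections have values of constant
parity contains a hyperbolic plane that splits the lattice. -/
theorem exists_hyperbolic_pair [Finite (IsLocalRing.ResidueField O)]
    [CharP (IsLocalRing.ResidueField O) 2] [IsAdicComplete (IsLocalRing.maximalIdeal O) O]
    (hπ : OrdEq O 1 π) (he : OrdEq O e (2 : F)) {u₁ u₂ u₃ : V} {b : F} {N s r : ℤ}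
    (hs : 0 ≤ s) (hse : s ≤ e) (p₁₂ : polar Q u₁ u₂ = 0) (p₁₃ : polar Q u₁ u₃ = 0)
    (p₂₃ : polar Q u₂ u₃ = 0) (o₁ : OrdEq O N (Q u₁)) (o₂ : OrdEq O (N - 2 * s) (Q u₂))
    (o₃ : OrdEq O N (Q u₃)) (m₁ : u₁ ∈ L) (m₀ : b • u₁ + u₂ ∈ L) (m₃ : u₃ ∈ L)
    (hb : OrdGE O N (Q (b • u₁ + u₂))) (b₁ : ∀ x ∈ L, OrdGE O (N + e - s) (polar Q u₁ x))
    (b₀ : ∀ x ∈ L, OrdGE O (N + e - s) (polar Q (b • u₁ + u₂) x))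
    (b₃ : ∀ x ∈ L, OrdGE O (N + e - s) (polar Q u₃ x)) (hN : Even (N - r))
    (hpar : ReflectionParity Q L r) :
    Even (e - s) ∧ ∃ y g : V, HyperbolicSplitting Q L
        (L.map ((hyperbolicProj Q y g).restrictScalars O)) y g ∧
      OrdEq O (N + e - s) (polar Q y g) ∧
      (∃ c : F, hyperbolicProj Q y g u₁ = c • hyperbolicProj Q y g u₃) ∧
      (∃ c : F, hyperbolicProj Q y g (b • u₁ + u₂) = c • hyperbolicProj Q y g u₃) ∧
      OrdEq O N (Q (hyperbolicProj Q y g u₃)) ∧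
      Q (hyperbolicProj Q y g u₃) * polar Q y g ^ 2 = -(4 * Q u₁ * Q u₂ * Q u₃) ∧
      (∀ v, polar Q u₁ v = 0 → polar Q u₂ v = 0 → polar Q u₃ v = 0 →
        polar Q y v = 0 ∧ polar Q g v = 0) := by
  have h2 := he.ne_zero
  have he1 := one_le_of_ordEq_two he
  have p₀₃ : polar Q u₃ (b • u₁ + u₂) = 0 := by
    rw [QuadraticMap.polar_add_right, QuadraticMap.polar_smul_right, QuadraticMap.polar_comm,
      p₁₃, QuadraticMap.polar_comm, p₂₃, smul_zero, add_zero]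
  have p₃₁ : polar Q u₃ u₁ = 0 := by rw [QuadraticMap.polar_comm, p₁₃]
  have hQ₀ : Q (b • u₁ + u₂) = b ^ 2 * Q u₁ + Q u₂ := map_smul_add_of_polar_eq_zero Q b p₁₂
  -- no vector of the wrong parity
  have hpar' : ∀ z ∈ L, polar Q u₃ z = 0 → (∀ x ∈ L, OrdGE O (N + e - s) (polar Q z x)) →
      ∀ l k, OrdGE O 0 l → OrdEq O k (Q z + l ^ 2 * Q u₃) → k ≤ N + e - s → Even (k - N) := by
    intro z hz hpz hbz l k hl hk hkm
    have h3 := hpar (l • u₃ + z) (L.add_mem (smul_mem_of_ordGE hl m₃) hz) k (by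
      rw [map_smul_add_of_polar_eq_zero Q _ hpz, add_comm (l ^ 2 * Q u₃)]
      exact hk) (by
      intro x hx
      rw [polar_smul_add_left]
      exact ((hl.mul (b₃ x hx)).mono (by omega)).add ((hbz x hx).mono hkm))
    have := h3.sub hN
    rwa [sub_sub_sub_cancel_right] at this
  -- Parity leaves no obstruction to adding multiples of u₃ until u₁ and bu₁ + u₂ have values
  -- smaller than the ideal 𝔭^(N+e-s) of polar values.
  obtain ⟨μ, hμ, hμ'⟩ := exists_add_sq_mul_of_parity hπ he o₁.ge o₃ (m := N + e - s) (by omega)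
    (hpar' u₁ m₁ p₃₁ b₁)
  obtain ⟨l, hl, hl'⟩ := exists_add_sq_mul_of_parity hπ he hb o₃ (m := N + e - s) (by omega)
    (hpar' _ m₀ p₀₃ b₀)
  have hμ0 : OrdEq O 0 μ := by
    have h3 := (o₁.of_add_ge (hμ'.mono (by omega))).div o₃
    rw [mul_div_cancel_right₀ _ o₃.ne_zero] at h3
    exact ordEq_of_sq (by convert h3 using 1; ring)
  have hμne := hμ0.ne_zero
  set β := l / μ with hβ
  have hlβ : l = β * μ := by rw [hβ, div_mul_cancel₀ _ hμne]
  have hβ0 : OrdGE O 0 β := (hl.div hμ0).mono (by omega)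
  set g₀ : V := u₁ + μ • u₃ with hg₀
  set y₀ : V := b • u₁ + u₂ + l • u₃ with hy₀
  have hQg : Q g₀ = Q u₁ + μ ^ 2 * Q u₃ := by
    rw [hg₀, add_comm, map_smul_add_of_polar_eq_zero Q _ p₃₁, add_comm]
  have hQy : Q y₀ = Q (b • u₁ + u₂) + l ^ 2 * Q u₃ := by
    rw [hy₀, add_comm, map_smul_add_of_polar_eq_zero Q _ p₀₃, add_comm]
  rw [← hQg] at hμ'
  rw [← hQy] at hl'
  have hyg : polar Q y₀ g₀ = 2 * (Q u₁ * (b - β) + β * Q g₀) := by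
    have h3 := polar_triple p₁₂ p₁₃ p₂₃ b 1 l 1 0 μ
    rw [one_smul, one_smul, zero_smul, add_zero] at h3
    rw [hy₀, hg₀, h3, ← hg₀, hQg, hlβ]
    ring
  -- The leading term of Q(u₂) is cancelled by (b² - β²)Q(u₁), so b² - β² has order -2s. The factors
  -- b - β and b + β differ by 2β of order at least e, so each has order -s.
  have hpolyg : OrdEq O (N + e - s) (polar Q y₀ g₀) := by
    have h3 : OrdEq O (N - 2 * s) ((b - β) * (b + β) * Q u₁) := by
      have h4 : Q u₂ + (b - β) * (b + β) * Q u₁ = Q y₀ - β ^ 2 * Q g₀ := by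
        rw [hQy, hQg, hQ₀, hlβ]; ring
      refine o₂.of_add_ge ?_
      rw [h4]
      exact (hl'.sub ((hβ0.sq.mul hμ').mono (by omega))).mono (by omega)
    have h4 : OrdEq O (-(2 * s)) ((b - β) * (b + β)) := by
      have := h3.div o₁
      rw [mul_div_cancel_right₀ _ o₁.ne_zero] at this
      convert this using 1; ring
    obtain ⟨z, hz⟩ := exists_ordEq (O := O) (left_ne_zero_of_mul h4.ne_zero)
    have h5 : b + β = (b - β) + 2 * β := by ring
    have h2β : OrdGE O e (2 * β) := (he.ge.mul hβ0).mono (by omega)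
    have hzs : z = -s := by
      rcases lt_or_ge z e with hlt | hge
      · have := hz.add_ge (h2β.mono (by omega))
        rw [← h5] at this
        have := (hz.mul this).unique h4
        omega
      · have h6 : OrdGE O e (b + β) := by
          rw [h5]; exact (hz.ge.mono hge).add h2β
        have := h4.le_of_ge (hz.ge.mul h6)
        omega
    subst hzs
    rw [hyg]
    have := he.mul ((o₁.mul hz).add_ge (y := β * Q g₀) ((hβ0.mul hμ').mono (by omega)))
    convert this using 1; ring
  have my₀ : y₀ ∈ L := L.add_mem m₀ (smul_mem_of_ordGE hl m₃)
  have mg₀ : g₀ ∈ L := L.add_mem m₁ (smul_mem_of_ordGE hμ m₃)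
  have by₀ : ∀ x ∈ L, OrdGE O (N + e - s) (polar Q y₀ x) := by
    intro x hx
    rw [hy₀, QuadraticMap.polar_add_left, QuadraticMap.polar_smul_left, smul_eq_mul]
    exact (b₀ x hx).add ((hl.mul (b₃ x hx)).mono (by omega))
  have bg₀ : ∀ x ∈ L, OrdGE O (N + e - s) (polar Q g₀ x) := by
    intro x hx
    rw [hg₀, QuadraticMap.polar_add_left, QuadraticMap.polar_smul_left, smul_eq_mul]
    exact (b₁ x hx).add ((hμ.mul (b₃ x hx)).mono (by omega))
  refine ⟨?_, ?_⟩
  -- The value of y₀ + g₀ has exactly the order of the polar value, so its reflection preserves `L`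
  -- and parity yields the evenness of e - s.
  · have h3 := hpar (y₀ + g₀) (L.add_mem my₀ mg₀) (N + e - s) (by
      rw [map_add_polar, add_comm (Q y₀ + Q g₀)]
      exact hpolyg.add_ge (hl'.add hμ')) (by
      intro x hx
      rw [QuadraticMap.polar_add_left]
      exact (by₀ x hx).add (bg₀ x hx))
    have := h3.sub hN
    rwa [show N + e - s - r - (N - r) = e - s by ring] at this
  obtain ⟨τ, σ, hτ, hσ, hQy', hQg', hh⟩ := exists_isotropic_pair hl' hμ' hpolyg
  set y := y₀ + τ • g₀ with hy
  set g := g₀ - σ • y with hg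
  have my : y ∈ L := L.add_mem my₀ (smul_mem_of_ordGE hτ mg₀)
  have mg : g ∈ L := L.sub_mem mg₀ (smul_mem_of_ordGE hσ my)
  have by' : ∀ x ∈ L, OrdGE O (N + e - s) (polar Q y x) := by
    intro x hx
    rw [hy, QuadraticMap.polar_add_left, QuadraticMap.polar_smul_left, smul_eq_mul]
    exact (by₀ x hx).add ((hτ.mul (bg₀ x hx)).mono (by omega))
  have bg' : ∀ x ∈ L, OrdGE O (N + e - s) (polar Q g x) := by
    intro x hx
    rw [hg, QuadraticMap.polar_sub_left, QuadraticMap.polar_smul_left, smul_eq_mul]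
    exact (bg₀ x hx).sub ((hσ.mul (by' x hx)).mono (by omega))
  have hPy := hyperbolicProj_left hQy' hh.ne_zero
  have hPg := hyperbolicProj_right hQg' hh.ne_zero
  have hPg₀ : hyperbolicProj Q y g g₀ = 0 := by
    rw [show g₀ = g + σ • y by rw [hg]; abel, map_add, map_smul, hPg, hPy, smul_zero, add_zero]
  have hPy₀ : hyperbolicProj Q y g y₀ = 0 := by
    rw [show y₀ = y - τ • g₀ by rw [hy]; abel, map_sub, map_smul, hPg₀, hPy, smul_zero, sub_zero]
  have cy : y = (b + τ) • u₁ + (1 : F) • u₂ + (l + τ * μ) • u₃ := by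
    rw [hy, hy₀, hg₀]; module
  have cg : g = (1 - σ * (b + τ)) • u₁ + (-σ) • u₂ + (μ - σ * (l + τ * μ)) • u₃ := by
    rw [hg, cy, hg₀]; module
  have cu : u₃ = (0 : F) • u₁ + (0 : F) • u₂ + (1 : F) • u₃ := by module
  have hpy : polar Q y u₃ = 2 * (l + τ * μ) * Q u₃ := by
    have := polar_triple p₁₂ p₁₃ p₂₃ (b + τ) 1 (l + τ * μ) 0 0 1
    rw [← cy, ← cu] at this
    rw [this]; ring
  have hpg : polar Q g u₃ = 2 * (μ - σ * (l + τ * μ)) * Q u₃ := by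
    have := polar_triple p₁₂ p₁₃ p₂₃ (1 - σ * (b + τ)) (-σ) (μ - σ * (l + τ * μ)) 0 0 1
    rw [← cg, ← cu] at this
    rw [this]; ring
  have hQP := map_hyperbolicProj hQy' hQg' hh.ne_zero u₃
  have hlτ : OrdGE O 0 (l + τ * μ) := hl.add ((hτ.mul hμ).mono (by omega))
  have hμσ : OrdGE O 0 (μ - σ * (l + τ * μ)) := hμ.sub ((hσ.mul hlτ).mono (by omega))
  refine ⟨y, g, ⟨my, mg, ?_, hQy', hQg', ?_, ?_, ?_⟩, hh, ⟨-μ, ?_⟩, ⟨-l, ?_⟩, ?_, ?_, ?_⟩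
  · rintro _ ⟨x, hx, rfl⟩
    change hyperbolicProj Q y g x ∈ L
    rw [hyperbolicProj_apply]
    exact L.sub_mem (L.sub_mem hx
      (smul_mem_of_ordGE ((hh.inv.ge.mul (bg' x hx)).mono (by omega)) my))
      (smul_mem_of_ordGE ((hh.inv.ge.mul (by' x hx)).mono (by omega)) mg)
  · rintro _ ⟨x, _, rfl⟩
    exact polar_left_hyperbolicProj hQy' hh.ne_zero x
  · rintro _ ⟨x, _, rfl⟩
    exact polar_right_hyperbolicProj hQg' hh.ne_zero x
  · intro x hx
    refine ⟨_, _, (hh.inv.ge.mul (bg' x hx)).mono (by omega),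
      (hh.inv.ge.mul (by' x hx)).mono (by omega), _, Submodule.mem_map_of_mem hx, ?_⟩
    change x = _ + hyperbolicProj Q y g x
    rw [hyperbolicProj_apply]
    abel
  · have h3 : u₁ = g₀ - μ • u₃ := by rw [hg₀]; abel
    rw [h3, map_sub, map_smul, hPg₀, zero_sub, neg_smul]
  · have h3 : b • u₁ + u₂ = y₀ - l • u₃ := by rw [hy₀]; abel
    rw [h3, map_sub, map_smul, hPy₀, zero_sub, neg_smul]
  · rw [hQP, sub_eq_add_neg, hpy, hpg]
    refine o₃.add_ge (OrdGE.neg ?_)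
    exact (((((he.ge.mul hlτ).mul o₃.ge)).mul ((he.ge.mul hμσ).mul o₃.ge)).div hh).mono (by omega)
  · have hα := map_triple p₁₂ p₁₃ p₂₃ (b + τ) 1 (l + τ * μ)
    have hβ := map_triple p₁₂ p₁₃ p₂₃ (1 - σ * (b + τ)) (-σ) (μ - σ * (l + τ * μ))
    have hαβ := polar_triple p₁₂ p₁₃ p₂₃ (b + τ) 1 (l + τ * μ) (1 - σ * (b + τ)) (-σ)
      (μ - σ * (l + τ * μ))
    rw [← cy, hQy'] at hα
    rw [← cg, hQg'] at hβ
    rw [← cy, ← cg] at hαβ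
    rw [hQP, hpy, hpg, discriminant_identity hα.symm hβ.symm hαβ hh.ne_zero]
    ring
  · intro v h3 h4 h5
    constructor
    · rw [cy]
      simp [QuadraticMap.polar_add_left, QuadraticMap.polar_smul_left, h3, h4, h5]
    · rw [cg]
      simp [QuadraticMap.polar_add_left, QuadraticMap.polar_smul_left, h3, h4, h5]

end Splitting

/-! ### Induction over the equal odd orders. -/

section HyperbolicChain

variable {O F V : Type*} [CommRing O] [IsDomain O] [IsDiscreteValuationRing O]
  [Field F] [Algebra O F] [IsFractionRing O F]
  [AddCommGroup V] [Module F V] [Module O V] [IsScalarTower O F V]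
  {Q : QuadraticForm F V} {L J : Submodule O V} {π : F} {e : ℤ} {n : ℕ} {a : ℕ → F} {R : ℕ → ℤ}

/-- A good BONG of a sublattice `J` that consists of vectors `γ t + v` with `v` in a lattice
orthogonal to `t`. -/
theorem hasGoodBONG_of_complement (h2 : (2 : F) ≠ 0) {K : Submodule O V} {t : V} {b r : _}
    (ht : t ∈ J) (hQt : Q t = b) (hb : OrdEq O r b) (hJ : ∀ z ∈ J, OrdGE O r (Q z))
    (hdec : ∀ z ∈ J, ∃ γ : F, ∃ v ∈ K, z = γ • t + v)
    (hlift : ∀ v ∈ K, ∃ γ : F, γ • t + v ∈ J) (hpol : ∀ v ∈ K, polar Q t v = 0)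
    (hK : HasGoodBONG Q K n (fun i => a (i + 3))) (hgood : 2 ≤ n → OrdGE O r (a 5)) :
    HasGoodBONG Q J (n + 1) (fun i => if i = 1 then b else a (i + 2)) := by
  have hQt0 : Q t ≠ 0 := hQt ▸ hb.ne_zero
  refine hasGoodBONG_succ ht hQt hb hJ ?_ hgood
  have : projLattice Q J t = K := by
    ext z
    rw [mem_projLattice]
    constructor
    · rintro ⟨x, hx, rfl⟩
      obtain ⟨γ, v, hv, rfl⟩ := hdec x hx
      rwa [projPerp_smul_add h2 hQt0 (hpol v hv)]
    · intro hz
      obtain ⟨γ, hγ⟩ := hlift z hz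
      exact ⟨_, hγ, projPerp_smul_add h2 hQt0 (hpol z hz) γ⟩
  rw [this]
  refine hK.congr fun i hi _ => ?_
  rw [if_neg (by omega)]

variable [Finite (IsLocalRing.ResidueField O)] [CharP (IsLocalRing.ResidueField O) 2]
  [IsAdicComplete (IsLocalRing.maximalIdeal O) O]

/-- If `R 1 = R 3` and the reflections of `L` have values of constant parity, then a hyperbolic
plane splits `L`. -/
theorem HasGoodBONG.exists_hyperbolicSplitting (h : HasGoodBONG Q L (n + 3) a)
    (hR : HasOrders O (n + 3) a R) (hπ : OrdEq O 1 π) (he : OrdEq O e (2 : F)) (h13 : R 1 = R 3)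
    (h12 : R 1 - 2 * e < R 2) (hpar : ReflectionParity Q L (R 1)) :
    ∃ j, R 2 = R 1 + 2 * j ∧ Even (e + j) ∧ ∃ y g J, HyperbolicSplitting Q L J y g ∧
      OrdEq O (R 1 + e + j) (polar Q y g) ∧ ∃ b, OrdEq O (R 1) b ∧
      (∃ t, t ≠ 0 ∧ a 1 * a 2 * a 3 = -(b * t ^ 2)) ∧
      HasGoodBONG Q J (n + 1) (fun i => if i = 1 then b else a (i + 2)) := by
  have h2 := he.ne_zero
  obtain ⟨x₁, x₂, L₂, K, H, hQ₁, hQ₂, hL₂, hK⟩ := h.exists_headPair (n := n + 1) hR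
  obtain ⟨x₃, hx₃, hQ₃, ho₃, hn₃, _, hK₄⟩ := hK.exists_first (hR.shift (n := n + 1) 2)
  have hodd12 : Odd (R 2 - R 1) → R 1 < R 2 := (h.adjacent hR he (i := 1) le_rfl (by omega)).2
  have hadj23 : R 2 - 2 * e ≤ R 3 ∧ (Odd (R 3 - R 2) → R 2 < R 3) :=
    h.adjacent hR he (i := 2) (by omega) (by omega)
  have h24 : 1 ≤ n → R 2 ≤ R 4 := fun _ => h.le_add_two hR (i := 2) (by omega) (by omega)
  have h35 : 2 ≤ n → OrdGE O (R 1) (a 5) := fun _ => by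
    have : R 3 ≤ R 5 := h.le_add_two hR (i := 3) (by omega) (by omega)
    exact (hR 5 (by omega) (by omega)).ge.mono (by omega)
  have H₂ : HeadPair Q L₂ (R 2) (R 3) x₂ x₃ K (projLattice Q K x₃) :=
    ⟨H.mem₂, H.ord₂, H.norm₂, H.proj₂, hx₃, ho₃, hn₃, rfl⟩
  have p₁₃ : polar Q x₁ x₃ = 0 := H.polarK₁ h2 hx₃
  have p₂₃ : polar Q x₂ x₃ = 0 := H.polarK₂ h2 hx₃
  have p₁K₄ : ∀ v ∈ projLattice Q K x₃, polar Q x₁ v = 0 := by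
    intro v hv
    obtain ⟨z, hz, rfl⟩ := mem_projLattice.1 hv
    rw [projPerp_apply, QuadraticMap.polar_sub_right, QuadraticMap.polar_smul_right,
      H.polarK₁ h2 hz, p₁₃, smul_zero, sub_zero]
  -- An odd difference would force both R 1 < R 2 and R 2 < R 3 = R 1.
  have heven : Even (R 2 - R 1) := by
    by_contra hodd
    rw [Int.not_even_iff_odd] at hodd
    have := hodd12 hodd
    have := hadj23.2 (by
      obtain ⟨i, hi⟩ := hodd
      exact ⟨-i - 1, by omega⟩)
    omega
  obtain ⟨j, hj⟩ := heven
  refine ⟨j, by omega, ?_⟩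
  -- The ternary configuration needs orders N, N - 2s, N with s ≥ 0. For j ≤ 0 these are the orders
  -- of x₁, x₂, x₃.
  rcases le_or_gt j 0 with hj0 | hj0
  · have hr : ∀ k ∈ K, OrdGE O (R 1) (Q k) := fun k hk => (hn₃ k hk).mono h13.le
    have hs : ∀ k ∈ K, OrdGE O (R 2) (Q k) :=
      fun k hk => (hn₃ k hk).mono (by change R 2 ≤ R 3; omega)
    have hKL := H.le_of_norm₂ h2 hr hs
    obtain ⟨b, hb⟩ := H.exists_lift₂
    have hpol := h.ordGE_polar_of_le he _ hR (R 1 + e - -j) (fun _ => by omega)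
      (fun _ => by omega)
    obtain ⟨hev, y, g, hsplit, hyg, ⟨c₁, hc₁⟩, ⟨c₂, hc₂⟩, hot, hdisc, hperp⟩ :=
      exists_hyperbolic_pair (u₁ := x₁) (u₂ := x₂) (u₃ := x₃) (b := b) (N := R 1) (s := -j)
        (r := R 1) hπ he (by omega) (by omega) (H.polar₁₂ h2) p₁₃ p₂₃ H.ord₁
        (by convert H.ord₂ using 1; omega) (by rw [h13]; exact ho₃) H.mem₁ hb (hKL hx₃)
        (H.norm₁ _ hb) (hpol _ H.mem₁) (hpol _ hb) (hpol _ (hKL hx₃)) (by simp) hpar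
    refine ⟨by convert hev using 1; ring, y, g, _, hsplit, by convert hyg using 1; ring,
      Q (hyperbolicProj Q y g x₃), hot, ⟨polar Q y g / 2, div_ne_zero hyg.ne_zero h2, ?_⟩, ?_⟩
    · rw [hQ₁, hQ₂, hQ₃] at hdisc
      field_simp
      linear_combination hdisc
    have hperp' : ∀ v ∈ projLattice Q K x₃, polar Q y v = 0 ∧ polar Q g v = 0 :=
      fun v hv => hperp v (p₁K₄ v hv) (H₂.polarK₁ h2 hv) (H₂.polarK₂ h2 hv)
    refine hasGoodBONG_of_complement h2 (t := hyperbolicProj Q y g x₃)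
      (Submodule.mem_map_of_mem (f := (hyperbolicProj Q y g).restrictScalars O) (hKL hx₃)) rfl hot
      (fun z hz => H.norm₁ z (hsplit.le hz)) ?_ ?_ ?_ hK₄ h35
    · rintro _ ⟨x, hx, rfl⟩
      obtain ⟨u, c, _, _, k, hk, rfl⟩ := H.exists_integral_decomp h2 hr hs hb hx
      obtain ⟨β, v, hv, rfl⟩ := exists_decomp_of_mem (Q := Q) (x := x₃) hk
      refine ⟨u * c₁ + c * c₂ + β, v, hv, ?_⟩
      change hyperbolicProj Q y g _ = _
      rw [map_add, map_add, map_add, map_smul, map_smul, map_smul, hc₁, hc₂,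
        hyperbolicProj_eq_self (hperp' v hv).1 (hperp' v hv).2]
      module
    · intro v hv
      obtain ⟨β, hβ⟩ := exists_lift_of_mem_projLattice hv
      refine ⟨β, ⟨β • x₃ + v, hKL hβ, ?_⟩⟩
      change hyperbolicProj Q y g _ = _
      rw [map_add, map_smul, hyperbolicProj_eq_self (hperp' v hv).1 (hperp' v hv).2]
    · intro v hv
      rw [polar_hyperbolicProj_of_orthogonal (hperp' v hv).1 (hperp' v hv).2, H₂.polarK₂ h2 hv]
  · have h12' : R 1 ≤ R 2 := by omega
    have hL₂L := H.le_of_norm h2 h12'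
    have hr : ∀ k ∈ projLattice Q K x₃, OrdGE O (R 2) (Q k) :=
      hK₄.ordGE fun hn => ⟨hR 4 (by omega) (by omega), h24 hn⟩
    have hs : ∀ k ∈ projLattice Q K x₃, OrdGE O (R 3) (Q k) :=
      fun k hk => (hr k hk).mono (by omega)
    have hK₄L := H₂.le_of_norm₂ h2 hr hs
    obtain ⟨b, hb⟩ := H₂.exists_lift₂
    have hpol : ∀ z ∈ L₂, ∀ x ∈ L, OrdGE O (R 2 + e - j) (polar Q z x) := by
      intro z hz x hx
      obtain ⟨c, y', hy', rfl⟩ := H.exists_decomp₁ hx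
      rw [QuadraticMap.polar_add_right, QuadraticMap.polar_smul_right,
        QuadraticMap.polar_comm Q z x₁, H.polar₁ h2 hz, smul_zero, zero_add]
      refine hL₂.ordGE_polar_of_le he _ (hR.shift (n := n + 2) 1) (R 2 + e - j) (fun _ => ?_)
        (fun _ => ?_) z hz y' hy'
      · change R 2 + e - j ≤ R 2 + e; omega
      · change 2 * (R 2 + e - j) ≤ R 2 + R 3 + 2 * e; omega
    -- For j > 0 the triple is x₂, x₃, π^j x₁, of orders R 2, R 2 - 2j, R 2. The complement is
    -- generated modulo the later vectors by the projection of x₁ itself.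
    have hz := uniformizer_zpow hπ j
    have hu₃ : π ^ j • x₁ ∈ L := smul_mem_of_ordGE (hz.ge.mono hj0.le) H.mem₁
    have ho : OrdEq O (R 2) (Q (π ^ j • x₁)) := by
      rw [map_smul_sq]
      convert hz.sq.mul H.ord₁ using 1; omega
    obtain ⟨hev, y, g, hsplit, hyg, ⟨c₁, hc₁⟩, ⟨c₂, hc₂⟩, hot, hdisc, hperp⟩ :=
      exists_hyperbolic_pair (u₁ := x₂) (u₂ := x₃) (u₃ := π ^ j • x₁) (b := b) (N := R 2) (s := j)
        (r := R 1) hπ he (by omega) (by omega) p₂₃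
        (by rw [QuadraticMap.polar_smul_right, QuadraticMap.polar_comm, H.polar₁₂ h2, smul_zero])
        (by rw [QuadraticMap.polar_smul_right, QuadraticMap.polar_comm, p₁₃, smul_zero]) H.ord₂
        (by convert ho₃ using 1; change _ = R 3; omega) ho (hL₂L H.mem₂) (hL₂L hb) hu₃
        (H₂.norm₁ _ hb) (hpol _ H.mem₂) (hpol _ hb) (by
          intro x hx
          obtain ⟨c, hc, y', hy', rfl⟩ := H.exists_integral_decomp₁ h2 h12' hx
          rw [QuadraticMap.polar_smul_left, QuadraticMap.polar_add_right,
            QuadraticMap.polar_smul_right, H.polar₁ h2 hy', polar_self_mul, add_zero, smul_eq_mul,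
            smul_eq_mul]
          exact (hz.ge.mul (hc.mul (he.ge.mul H.ord₁.ge))).mono (by omega)) ⟨j, hj⟩ hpar
    have hP : hyperbolicProj Q y g (π ^ j • x₁) = π ^ j • hyperbolicProj Q y g x₁ := map_smul _ _ _
    have hπj := hz.ne_zero
    rw [hP] at hc₁ hc₂ hot hdisc
    rw [map_smul_sq] at hot hdisc
    have hot' : OrdEq O (R 1) (Q (hyperbolicProj Q y g x₁)) := by
      have := hot.div hz.sq
      rw [mul_div_cancel_left₀ _ hz.sq.ne_zero] at this
      convert this using 1; omega
    refine ⟨by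
      obtain ⟨i, hi⟩ := hev
      exact ⟨i + j, by omega⟩, y, g, _, hsplit, by convert hyg using 1; omega,
      Q (hyperbolicProj Q y g x₁), hot', ⟨polar Q y g / 2, div_ne_zero hyg.ne_zero h2, ?_⟩, ?_⟩
    · rw [map_smul_sq, hQ₁, hQ₂, hQ₃] at hdisc
      have h3 : Q (hyperbolicProj Q y g x₁) * polar Q y g ^ 2 = -(4 * a 2 * a 3 * a 1) := by
        apply mul_left_cancel₀ hz.sq.ne_zero
        linear_combination hdisc
      change a 1 * a 2 * a 3 = _
      field_simp
      linear_combination h3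
    have hperp' : ∀ v ∈ projLattice Q K x₃, polar Q y v = 0 ∧ polar Q g v = 0 := fun v hv =>
      hperp v (H₂.polarK₁ h2 hv) (H₂.polarK₂ h2 hv) (by
        rw [QuadraticMap.polar_smul_left, p₁K₄ v hv, smul_zero])
    refine hasGoodBONG_of_complement h2 (t := hyperbolicProj Q y g x₁)
      (Submodule.mem_map_of_mem (f := (hyperbolicProj Q y g).restrictScalars O) H.mem₁) rfl hot'
      (fun z hz => H.norm₁ z (hsplit.le hz)) ?_ ?_ ?_ hK₄ h35
    · rintro _ ⟨x, hx, rfl⟩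
      obtain ⟨c, y', hy', rfl⟩ := H.exists_decomp₁ hx
      obtain ⟨u, d, _, _, v, hv, rfl⟩ := H₂.exists_integral_decomp h2 hr hs hb hy'
      refine ⟨c + u * c₁ * π ^ j + d * c₂ * π ^ j, v, hv, ?_⟩
      change hyperbolicProj Q y g _ = _
      rw [map_add, map_add, map_add, map_smul, map_smul, map_smul, hc₁, hc₂,
        hyperbolicProj_eq_self (hperp' v hv).1 (hperp' v hv).2]
      module
    · intro v hv
      refine ⟨0, ⟨v, hL₂L (hK₄L hv), ?_⟩⟩
      change hyperbolicProj Q y g _ = _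
      rw [hyperbolicProj_eq_self (hperp' v hv).1 (hperp' v hv).2, zero_smul, zero_add]
    · intro v hv
      rw [polar_hyperbolicProj_of_orthogonal (hperp' v hv).1 (hperp' v hv).2, p₁K₄ v hv]

/-- The values `π^{S 1} ε, -π^{S 2} ε, …, π^{S (2k + 1)} ε, a (2k + 2), …`. -/
noncomputable def alternatingValues (π ε : F) (S : ℕ → ℤ) (k : ℕ) (a : ℕ → F) (i : ℕ) : F :=
  if i ≤ 2 * k + 1 then (if Odd i then π ^ S i * ε else -(π ^ S i * ε)) else a i

theorem ordEq_alternatingValues (hπ : OrdEq O 1 π) {ε : F} (hε : OrdEq O 0 ε) (S : ℕ → ℤ) (k : ℕ)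
    {i : ℕ} (h : 2 * k + 1 < i → OrdEq O (R i) (a i)) :
    OrdEq O (if i ≤ 2 * k + 1 then S i else R i) (alternatingValues π ε S k a i) := by
  have := (uniformizer_zpow hπ (S i)).mul hε
  rw [add_zero] at this
  unfold alternatingValues
  split_ifs with h1 h2
  · exact this
  · exact this.neg
  · exact h (by omega)

/-- One step of the construction of a BONG with alternating values. -/
theorem HyperbolicSplitting.hasGoodBONG_alternatingValues {y g : V} {M J : Submodule O V}
    (H : HyperbolicSplitting Q M J y g) (hπ : OrdEq O 1 π) (he : OrdEq O e (2 : F)) {ε : F}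
    (hε : OrdEq O 0 ε) {b : F} {S : ℕ → ℤ} {k : ℕ} {j : ℤ} (hR : HasOrders O (n + 3) a R)
    (hj : -e ≤ j) (hj' : j ≤ e) (hS2 : S 2 = S 3 + 2 * j) (hS1 : S 1 = S 3)
    (hS4 : 2 ≤ 2 * k + 1 → S 2 ≤ S 4) (hR4 : 1 ≤ n → S 2 ≤ R 4)
    (hyg : polar Q y g = -(2 * π ^ j * (π ^ S 3 * ε)))
    (hJ : HasGoodBONG Q J (n + 1) (alternatingValues π ε (fun i => S (i + 2)) k
      (fun i => if i = 1 then b else a (i + 2)))) :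
    HasGoodBONG Q M (n + 3) (alternatingValues π ε S (k + 1) a) := by
  have hb1 : alternatingValues π ε (fun i => S (i + 2)) k
      (fun i => if i = 1 then b else a (i + 2)) 1 = π ^ S 3 * ε := by
    simp [alternatingValues]
  refine H.hasGoodBONG he hJ (S := fun i => if i ≤ 2 * k + 1 then S (i + 2) else R (i + 2))
    ?_ (uniformizer_zpow hπ j) hj hj' (by rw [hb1]; exact hyg) ?_ ?_ ?_ ?_
  · intro i hi hin
    refine ordEq_alternatingValues (R := fun i => R (i + 2)) hπ hε (fun i => S (i + 2)) k
      fun hik => ?_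
    rw [if_neg (by omega)]
    exact hR (i + 2) (by omega) (by omega)
  · intro hn
    rw [if_pos (by omega)]
    have := hR4 hn
    split_ifs with h3
    · have := hS4 h3
      change S 3 + 2 * j ≤ S 4
      omega
    · change S 3 + 2 * j ≤ R 4
      omega
  · rw [hb1, ← hS1]
    simp [alternatingValues]
  · have hπ0 := hπ.ne_zero
    rw [hb1]
    simp only [alternatingValues, if_pos (show 2 ≤ 2 * (k + 1) + 1 by omega),
      show ¬ Odd 2 by decide, if_false]
    rw [hS2, zpow_add₀ hπ0, mul_comm 2 j, zpow_mul]
    norm_cast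
    ring
  · intro i hi _
    have h3 : Odd (i + 2) ↔ Odd i := by
      rw [Nat.odd_add]; simp
    simp only [alternatingValues, h3, show i + 2 ≤ 2 * (k + 1) + 1 ↔ i ≤ 2 * k + 1 by omega]
    split_ifs with h4 h5 h6 <;> first | rfl | omega

/-- The plane lies entirely in the sublattice, since its values are integral multiples of the polar
value of y and g. The order condition therefore only concerns the component in `J`. -/
theorem HyperbolicSplitting.sublattice {y g : V} (H : HyperbolicSplitting Q L J y g) {k : ℤ}
    (hpol : ∀ x ∈ L, ∀ y ∈ L, OrdGE O k (polar Q x y)) {M : Submodule O V}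
    (hM : ∀ w, w ∈ M ↔ w ∈ J ∧ OrdGE O k (Q w)) :
    HyperbolicSplitting Q (sublatticeOrdGE Q L k hpol) M y g where
  mem_left := ⟨H.mem_left, by rw [H.map_left]; exact OrdGE.zero _⟩
  mem_right := ⟨H.mem_right, by rw [H.map_right]; exact OrdGE.zero _⟩
  le w hw := ⟨H.le ((hM w).1 hw).1, ((hM w).1 hw).2⟩
  map_left := H.map_left
  map_right := H.map_right
  polar_left w hw := H.polar_left w ((hM w).1 hw).1
  polar_right w hw := H.polar_right w ((hM w).1 hw).1
  exists_decomp := by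
    rintro x ⟨hx, hxQ⟩
    obtain ⟨u, v, hu, hv, w, hw, rfl⟩ := H.exists_decomp x hx
    refine ⟨u, v, hu, hv, w, (hM w).2 ⟨hw, ?_⟩, rfl⟩
    rw [H.map_eq u v hw] at hxQ
    have := hxQ.sub (((hu.mul hv).mul (hpol y H.mem_left g H.mem_right)).mono
      (by omega : k ≤ 0 + 0 + k))
    rwa [add_sub_cancel_left] at this

/-- The BONGs of `L` and of the lattice of the vectors that are not norm generators, when
`R 1 = R 3 = ⋯ = R (2k + 1)`. -/
theorem HasGoodBONG.alternating (hπ : OrdEq O 1 π) (he : OrdEq O e (2 : F)) {ε : F}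
    (hε : OrdEq O 0 ε) (k : ℕ) : ∀ {n : ℕ} {L : Submodule O V} {a : ℕ → F} {R : ℕ → ℤ},
    HasGoodBONG Q L n a → HasOrders O n a R → ReflectionParity Q L (R 1) → 2 * k + 1 ≤ n →
    (∀ j ≤ k, R (2 * j + 1) = R 1) → (2 * k + 3 ≤ n → R 1 < R (2 * k + 3)) →
    (2 ≤ n → R 1 - 2 * e < R 2) →
    (∃ t : F, t ≠ 0 ∧
      ∏ i ∈ Finset.range (2 * k + 1), a (i + 1) = (-1) ^ k * ε * π ^ R 1 * t ^ 2) →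
    HasGoodBONG Q L n (alternatingValues π ε R k a) ∧
    IsLatticeWithGoodBONG O Q (nonNormGenerators Q L) n
      (alternatingValues π ε (fun i => if Odd i then R i + 2 else R i - 2) k a) := by
  have h2 := he.ne_zero
  have he1 := one_le_of_ordEq_two he
  have hπ0 := hπ.ne_zero
  induction k with
  | zero =>
    intro n L a R h hR hpar hn _ hlt h12 ht
    obtain ⟨n, rfl⟩ := Nat.exists_eq_add_of_le' hn
    obtain ⟨t, ht0, ht⟩ := ht
    simp only [mul_zero, zero_add, Finset.prod_range_one, pow_zero, one_mul] at ht
    have hR1 : OrdEq O (R 1) (a 1) := hR 1 le_rfl (by omega)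
    have hoε : OrdEq O (R 1) (π ^ R 1 * ε) := by
      have := (uniformizer_zpow hπ (R 1)).mul hε
      rwa [add_zero] at this
    -- Both a 1 and π^(R 1)ε have order R 1, so t is a unit, and t⁻¹x₁ is again a norm generator
    -- with the same projection.
    have ht1 : OrdEq O 0 t := by
      have : OrdEq O (R 1 - R 1) (a 1 / (π ^ R 1 * ε)) := hR1.div hoε
      rw [show a 1 / (π ^ R 1 * ε) = t ^ 2 by
        rw [ht, div_eq_iff hoε.ne_zero]; ring] at this
      exact ordEq_of_sq (by convert this using 1; ring)
    have htail : ∀ S : ℕ → ℤ, ∀ i, 2 ≤ i → alternatingValues π ε S 0 a i = a i := by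
      intro S i hi
      rw [alternatingValues, if_neg (by omega)]
    have hhead : ∀ S : ℕ → ℤ, alternatingValues π ε S 0 a 1 = π ^ S 1 * ε := by
      intro S
      simp [alternatingValues]
    have hL : HasGoodBONG Q L (n + 1) (alternatingValues π ε R 0 a) := by
      obtain ⟨x, hx, hQx, _, hnorm, _, hK⟩ := h.exists_first hR
      refine hasGoodBONG_succ (x := t⁻¹ • x) (k := R 1)
        (smul_mem_of_ordGE (by simpa using ht1.inv.ge) hx) ?_ ?_ hnorm ?_ ?_
      · rw [hhead, map_smul_sq, hQx, ht]
        field_simp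
      · rw [hhead]; exact hoε
      · rw [projLattice, projPerp_smul (inv_ne_zero ht0)]
        exact hK.congr fun i hi _ => (htail R (i + 1) (by omega)).symm
      · intro hn2
        rw [htail R 3 (by omega)]
        exact (hR 3 (by omega) (by omega)).ge.mono (hlt (by omega)).le
    refine ⟨hL, ?_⟩
    have hpol := h.ordGE_polar_succ he he1 hR h12
    refine isLatticeWithGoodBONG_of_no_succ hπ h2 hL (R := R) ?_ hpol
      (hpar.not_ordEq_succ hpol) ?_ ?_ ?_
    · intro i hi hin
      rcases eq_or_lt_of_le hi with rfl | hi2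
      · rw [hhead]; exact hoε
      · rw [htail R i hi2]; exact hR i hi hin
    · intro hn2
      exact h.add_two_le_third hR he (Or.inr hpar) (by omega) (hlt (by omega))
    · rw [hhead, hhead, if_pos (by decide), zpow_add₀ hπ0]
      norm_cast
      ring
    · intro i hi _
      rw [htail _ i hi, htail _ i hi]
  | succ k ih =>
    intro n L a R h hR hpar hn hodd hlt h12 ht
    obtain ⟨n, rfl⟩ := Nat.exists_eq_add_of_le' (show 3 ≤ n by omega)
    have h13 : R 1 = R 3 := (hodd 1 (by omega)).symm
    have h12 := h12 (by omega)
    have h24 : 1 ≤ n → R 2 ≤ R 4 := fun _ => h.le_add_two hR (i := 2) (by omega) (by omega)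
    have h23 : R 2 - 2 * e ≤ R 3 := (h.adjacent hR he (i := 2) (by omega) (by omega)).1
    obtain ⟨j, hj, hje, y, g, J, H, hyg, b, hb, ⟨s, hs0, hs⟩, hJ⟩ :=
      h.exists_hyperbolicSplitting hR hπ he h13 h12 hpar
    have hJR : HasOrders O (n + 1) (fun i => if i = 1 then b else a (i + 2))
        (fun i => R (i + 2)) := by
      intro i hi hin
      by_cases h1 : i = 1
      · subst h1
        change OrdEq O (R 3) (if 1 = 1 then b else a 3)
        rw [if_pos rfl, ← h13]
        exact hb
      · change OrdEq O (R (i + 2)) (if i = 1 then b else a (i + 2))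
        rw [if_neg h1]
        exact hR (i + 2) (by omega) (by omega)
    have hpol := h.ordGE_polar_succ he he1 hR (fun _ => h12)
    obtain ⟨hJ1, M, hM, hJ2⟩ := ih hJ hJR (by
        change ReflectionParity Q J (R 3)
        rw [← h13]
        exact H.reflectionParity hpar) (by omega)
      (fun i hi => by
        change R (2 * i + 1 + 2) = R 3
        rw [← h13]
        exact hodd (i + 1) (by omega))
      (fun hn => by
        change R 3 < R (2 * k + 3 + 2)
        rw [← h13]
        exact hlt (by omega))
      (fun hn => by
        change R 3 - 2 * e < R 4
        have := h24 (by omega)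
        omega) (by
        obtain ⟨t, ht0, ht⟩ := ht
        -- Replacing a 1 · a 2 · a 3 by its equal -bs² removes one sign and the square s² from the
        -- product.
        refine ⟨t / s, div_ne_zero ht0 hs0, ?_⟩
        rw [show 2 * (k + 1) + 1 = 2 * k + 1 + 1 + 1 by ring, Finset.prod_range_succ',
          Finset.prod_range_succ', Finset.prod_range_succ'] at ht
        rw [Finset.prod_range_succ']
        simp only [zero_add, show ∀ i : ℕ, (i + 1 + 1 = 1) ↔ False by simp, if_false,
          if_true]
        change (∏ i ∈ Finset.range (2 * k), a (i + 1 + 1 + 2)) * b =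
          (-1) ^ k * ε * π ^ R 3 * (t / s) ^ 2
        change (∏ i ∈ Finset.range (2 * k), a (i + 1 + 1 + 1 + 1)) * a 3 * a 2 * a 1 = _ at ht
        rw [← h13]
        field_simp
        have h4 : ∀ i, i + 1 + 1 + 2 = i + 1 + 1 + 1 + 1 := fun i => rfl
        simp only [h4]
        rw [pow_succ] at ht
        linear_combination -ht + (∏ i ∈ Finset.range (2 * k), a (i + 1 + 1 + 1 + 1)) * hs)
    -- rescaling of the hyperbolic plane
    have hh : OrdEq O (R 1 + e + j) (-(2 * π ^ j * (π ^ R 3 * ε))) := by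
      have := ((he.mul (uniformizer_zpow hπ j)).mul ((uniformizer_zpow hπ (R 3)).mul hε)).neg
      convert this using 1; omega
    have hc := hh.div hyg
    rw [sub_self] at hc
    have H' := H.smul hc
    have hyg' : polar Q ((-(2 * π ^ j * (π ^ R 3 * ε)) / polar Q y g) • y) g =
        -(2 * π ^ j * (π ^ R 3 * ε)) := by
      rw [QuadraticMap.polar_smul_left, smul_eq_mul, div_mul_cancel₀ _ hyg.ne_zero]
    refine ⟨H'.hasGoodBONG_alternatingValues hπ he hε hR (by omega) (by omega) (by omega) h13
      (fun hk => ?_) h24 hyg' hJ1, ?_⟩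
    · exact h24 (by omega)
    obtain ⟨x, _, _, hox, _, hgen, _⟩ := h.exists_first hR
    obtain ⟨x', _, _, hox', _, hgen', _⟩ := hJ.exists_first hJR
    replace hox' : OrdEq O (R 1) (Q x') := by rw [h13]; exact hox'
    rw [nonNormGenerators_eq hox' hgen'] at hM
    have H'' := H'.sublattice hpol (M := M) (fun w => by
      change w ∈ (M : Set V) ↔ _
      rw [hM]
      rfl)
    refine ⟨sublatticeOrdGE Q L _ hpol, (nonNormGenerators_eq hox hgen).symm, ?_⟩
    obtain ⟨i, hi⟩ := hje
    have hpar2 : ∀ i : ℕ, Odd (i + 2) ↔ Odd i := fun i => by rw [Nat.odd_add]; simp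
    -- The polar value of the plane is unchanged, so raising the exponent R 3 by 2 lowers j by 2.
    -- The bound -e ≤ j - 2 follows from -e < j only because e + j is even.
    refine H''.hasGoodBONG_alternatingValues (j := j - 2) (k := k) hπ he hε hR (by omega)
      (by omega) ?_ ?_ ?_ ?_ ?_ ?_ (b := b)
    · change R 2 - 2 = R 3 + 2 + 2 * (j - 2)
      omega
    · change R 1 + 2 = R 3 + 2
      omega
    · intro hk
      change R 2 - 2 ≤ R 4 - 2
      have := h24 (by omega)
      omega
    · intro hn
      change R 2 - 2 ≤ R 4
      have := h24 hn
      omega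
    · rw [hyg']
      change _ = -(2 * π ^ (j - 2) * (π ^ (R 3 + 2) * ε))
      rw [zpow_sub₀ hπ0, zpow_add₀ hπ0]
      norm_cast
      field_simp
    · convert hJ2 using 3
      exact if_congr (hpar2 _) rfl rfl

/-- Between two equal odd-indexed orders the intermediate one has the same parity, so the product
has order congruent to R 1 modulo 2 and a power of π absorbs the rest. -/
theorem HasGoodBONG.exists_prod_eq (h : HasGoodBONG Q L n a) (hR : HasOrders O n a R)
    (hπ : OrdEq O 1 π) (he : OrdEq O e (2 : F)) (k : ℕ) (hk : 2 * k + 1 ≤ n)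
    (hodd : ∀ j ≤ k, R (2 * j + 1) = R 1) : ∃ ε : F, OrdEq O 0 ε ∧ ∃ t : F, t ≠ 0 ∧
      ∏ i ∈ Finset.range (2 * k + 1), a (i + 1) = (-1) ^ k * ε * π ^ R 1 * t ^ 2 := by
  have key : ∃ c : ℤ, OrdEq O (R 1 + 2 * c) (∏ i ∈ Finset.range (2 * k + 1), a (i + 1)) := by
    induction k with
    | zero => exact ⟨0, by simpa using hR 1 le_rfl (by omega)⟩
    | succ k ih =>
      obtain ⟨c, hc⟩ := ih (by omega) (fun j hj => hodd j (by omega))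
      have h1 : R (2 * k + 1) = R 1 := hodd k (by omega)
      have h3 : R (2 * k + 3) = R 1 := hodd (k + 1) le_rfl
      have h12 : Odd (R (2 * k + 2) - R (2 * k + 1)) → R (2 * k + 1) < R (2 * k + 2) :=
        (h.adjacent hR he (i := 2 * k + 1) (by omega) (by omega)).2
      have h23 : Odd (R (2 * k + 3) - R (2 * k + 2)) → R (2 * k + 2) < R (2 * k + 3) :=
        (h.adjacent hR he (i := 2 * k + 2) (by omega) (by omega)).2
      have heven : Even (R (2 * k + 2) - R (2 * k + 1)) := by
        by_contra ho
        rw [Int.not_even_iff_odd] at ho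
        have := h12 ho
        have := h23 (by
          obtain ⟨i, hi⟩ := ho
          exact ⟨-i - 1, by omega⟩)
        omega
      obtain ⟨i, hi⟩ := heven
      refine ⟨c + R 1 + i, ?_⟩
      rw [show 2 * (k + 1) + 1 = 2 * k + 1 + 1 + 1 by ring, Finset.prod_range_succ,
        Finset.prod_range_succ]
      have := (hc.mul (hR (2 * k + 2) (by omega) (by omega))).mul
        (hR (2 * k + 3) (by omega) (by omega))
      convert this using 1
      omega
  obtain ⟨c, hc⟩ := key
  have hz := uniformizer_zpow hπ c
  have hd := ((ordEq_neg_one (O := O) (F := F)).zpow k).mul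
    ((uniformizer_zpow hπ (R 1)).mul hz.sq)
  refine ⟨(∏ i ∈ Finset.range (2 * k + 1), a (i + 1)) /
    ((-1) ^ (k : ℤ) * (π ^ R 1 * (π ^ c) ^ 2)), ?_, π ^ c, hz.ne_zero, ?_⟩
  · have := hc.div hd
    convert this using 1
    ring
  · have h1 := hd.ne_zero
    rw [zpow_natCast] at h1 ⊢
    rw [show ∀ x : F, (-1) ^ k * x * π ^ R 1 * (π ^ c) ^ 2 =
      x * ((-1) ^ k * (π ^ R 1 * (π ^ c) ^ 2)) by intro x; ring, div_mul_cancel₀ _ h1]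

end HyperbolicChain

/-! ### Unary lattices and bookkeeping. -/

section UnaryAndProducts

variable {O F V : Type*} [CommRing O] [IsDomain O] [IsDiscreteValuationRing O]
  [Field F] [Algebra O F] [IsFractionRing O F]
  [AddCommGroup V] [Module F V] [Module O V] [IsScalarTower O F V]
  {Q : QuadraticForm F V} {L : Submodule O V} {n : ℕ} {a : ℕ → F} {R : ℕ → ℤ}

theorem HasGoodBONG.not_ordEq_succ_of_unary (h : HasGoodBONG Q L 1 a) (hR : HasOrders O 1 a R) :
    ∀ x ∈ L, ¬ OrdEq O (R 1 + 1) (Q x) := by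
  intro y hy hoy
  obtain ⟨x, _, _, hox, _, _, hK⟩ := h.exists_first hR
  obtain ⟨c, y', hy', rfl⟩ := exists_decomp_of_mem (Q := Q) (x := x) hy
  rw [hasGoodBONG_zero.1 hK, Submodule.mem_bot] at hy'
  subst hy'
  rw [add_zero, map_smul_sq] at hoy
  have hc : c ≠ 0 := by
    rintro rfl
    exact hoy.ne_zero (by simp)
  obtain ⟨k, hk⟩ := exists_ordEq (O := O) hc
  have := hoy.unique (hk.sq.mul hox)
  omega

theorem HasGoodBONG.le_odd (h : HasGoodBONG Q L n a) (hR : HasOrders O n a R) {i j : ℕ}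
    (hij : i ≤ j) (hj : 2 * j + 1 ≤ n) : R (2 * i + 1) ≤ R (2 * j + 1) := by
  induction j, hij using Nat.le_induction with
  | base => exact le_rfl
  | succ j _ ih =>
    exact (ih (by omega)).trans (h.le_add_two hR (i := 2 * j + 1) (by omega) (by omega))

theorem prod_Icc_one_eq_prod_range {M : Type*} [CommMonoid M] (f : ℕ → M) (m : ℕ) :
    ∏ i ∈ Finset.Icc 1 m, f i = ∏ i ∈ Finset.range m, f (i + 1) := by
  rw [← Finset.Ico_add_one_right_eq_Icc, Finset.prod_Ico_eq_prod_range]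
  exact Finset.prod_congr rfl fun i _ => by rw [add_comm 1 i]

end UnaryAndProducts

end DyadicLattice

/-! ### Assembly of the five cases. -/

open DyadicLattice in
theorem lemma4p14 {O F V : Type*}
    -- `F` is a dyadic local field (of characteristic zero), `O` its ring of integers
    [CommRing O] [IsDomain O] [IsDiscreteValuationRing O]
    [IsAdicComplete (IsLocalRing.maximalIdeal O) O]
    [Finite (IsLocalRing.ResidueField O)] [CharP (IsLocalRing.ResidueField O) 2] [CharZero O]
    [Field F] [Algebra O F] [IsFractionRing O F]
    -- a prime element, the ramification index, and a unit of quadratic defect `4O`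
    (π : F) (hπ : ord O π = 1)
    (e : ℤ) (he : ord O (2 : F) = (e : WithTop ℤ))
    (Δ : F) (hΔ : ∃ ρ : F, ord O ρ = 0 ∧ Δ = 1 - 4 * ρ)
    (hΔ' : quadraticDefect O Δ = Submodule.span O {(4 : F)})
    -- a lattice `L ≅ ≺a₁, …, a_n≻` on the quadratic space `V`, with `ord a_i = R_i`
    [AddCommGroup V] [Module F V] [Module O V] [IsScalarTower O F V]
    (Q : QuadraticForm F V) (L : Submodule O V) [L.IsLattice F]
    (n : ℕ) (a : ℕ → F) (hL : HasGoodBONG Q L n a)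
    (R : ℕ → ℤ) (hR : ∀ i, 1 ≤ i → i ≤ n → ord O (a i) = (R i : WithTop ℤ))
    (hB : PropertyB O e n a R ∨ spinorNorms Q L = unitSquares O) :
    -- (i)
    (2 ≤ n → R 2 - R 1 = -2 * e →
      (∃ t : F, t ≠ 0 ∧ a 1 * a 2 = -Δ * t ^ 2) → (3 ≤ n → R 1 < R 3) →
      IsLatticeWithGoodBONG O Q (nonNormGenerators Q L) n
        (Function.update (Function.update a 1 (π ^ 2 * a 1)) 2 (π ^ 2 * a 2))) ∧
    -- (ii)
    (2 ≤ n → R 2 - R 1 = -2 * e →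
      ((∃ t : F, t ≠ 0 ∧ a 1 * a 2 = -t ^ 2) ∨ (3 ≤ n ∧ R 1 = R 3)) →
      ¬ ∃ M : Submodule O V, (M : Set V) = nonNormGenerators Q L) ∧
    -- (iii)
    ((n = 1 ∨ (2 ≤ n ∧ R 2 - R 1 > -2 * e ∧ ¬ IsMaximalPair (V := V) O Q a ∧
        (3 ≤ n → R 1 < R 3))) →
      IsLatticeWithGoodBONG O Q (nonNormGenerators Q L) n
        (Function.update a 1 (π ^ 2 * a 1))) ∧
    -- (iv)
    (2 ≤ n → R 2 - R 1 > -2 * e → IsMaximalPair (V := V) O Q a →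
      (∃ η : F, ord O η = 0 ∧ hilbertSymbol (π * η) (-(a 1 * a 2)) = 1) ∧
      ∀ η : F, ord O η = 0 → hilbertSymbol (π * η) (-(a 1 * a 2)) = 1 →
        IsLatticeWithGoodBONG O Q (nonNormGenerators Q L) n
          (Function.update (Function.update a 1 (π * η * a 1)) 2 (π * η * a 2))) ∧
    -- (v)
    (3 ≤ n → R 2 - R 1 > -2 * e → R 1 = R 3 →
      ∀ k : ℕ, 1 ≤ k → 2 * k + 1 ≤ n → R 1 = R (2 * k + 1) →
        (∀ j : ℕ, 2 * j + 1 ≤ n → R 1 = R (2 * j + 1) → j ≤ k) →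
        (∃ ε : F, ord O ε = 0 ∧ ∃ t : F, t ≠ 0 ∧
          ∏ i ∈ Finset.Icc 1 (2 * k + 1), a i = (-1) ^ k * ε * π ^ R 1 * t ^ 2) ∧
        ∀ ε : F, ord O ε = 0 →
          (∃ t : F, t ≠ 0 ∧
            ∏ i ∈ Finset.Icc 1 (2 * k + 1), a i = (-1) ^ k * ε * π ^ R 1 * t ^ 2) →
          HasGoodBONG Q L n
            (fun i => if i ≤ 2 * k + 1 then
                (if Odd i then π ^ R i * ε else -(π ^ R i * ε))
              else a i) ∧
          IsLatticeWithGoodBONG O Q (nonNormGenerators Q L) n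
            (fun i => if i ≤ 2 * k + 1 then
                (if Odd i then π ^ (R i + 2) * ε else -(π ^ (R i - 2) * ε))
              else a i)) := by
  replace hπ : OrdEq O 1 π := hπ
  replace he : OrdEq O e (2 : F) := he
  replace hR : HasOrders O n a R := hR
  have h2 := he.ne_zero
  have he1 := one_le_of_ordEq_two he
  -- Finite dimension is needed for the determinant of a reflection; it holds because a finitely
  -- generated lattice spans `V`.
  have : Module.Finite F V := by
    obtain ⟨s, hs⟩ := Submodule.IsLattice.fg (A := F) (M := L)
    refine ⟨s, ?_⟩
    rw [← Submodule.IsLattice.span_eq_top (A := F) (M := L), ← hs, Submodule.span_span_of_tower]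
  have hB' : 1 ≤ n → PropertyB O e n a R ∨ ReflectionParity Q L (R 1) := by
    intro hn
    obtain ⟨n, rfl⟩ := Nat.exists_eq_add_of_le' hn
    refine hB.imp_right fun hθ => ?_
    obtain ⟨x, _, _, hox, _, hgen, _⟩ := hL.exists_first hR
    exact reflectionParity_of_spinorNorms hox hgen hθ.le
  refine ⟨?_, ?_, ?_, ?_, ?_⟩
  · rintro hn h12 ⟨t, _, ht⟩ h13
    obtain ⟨n, rfl⟩ := Nat.exists_eq_add_of_le' hn
    obtain ⟨ρ, hρ, hΔρ⟩ := hΔ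
    exact hL.isLattice_of_unramified hR hπ he h12 hρ hΔρ hΔ' ht fun hn =>
      hL.add_two_le_third hR he (hB' (by omega)) (by omega) (h13 (by omega))
  · rintro hn h12 (⟨t, _, ht⟩ | ⟨hn3, h13⟩)
    · obtain ⟨n, rfl⟩ := Nat.exists_eq_add_of_le' hn
      exact hL.not_submodule_of_hyperbolic hR he h12 ht
    · obtain ⟨n, rfl⟩ := Nat.exists_eq_add_of_le' hn3
      exact hL.not_submodule_of_eq_third hR hπ he h12 h13
  · rintro (rfl | ⟨hn, h12, hmax, h13⟩)
    · exact isLatticeWithGoodBONG_of_no_succ (n := 0) hπ h2 hL hR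
        (hL.ordGE_polar_succ he he1 hR (fun h => by omega)) (hL.not_ordEq_succ_of_unary hR)
        (fun h => by omega) (by simp) (fun i hi _ => Function.update_of_ne (by omega) _ _)
    · obtain ⟨n, rfl⟩ := Nat.exists_eq_add_of_le' hn
      have h3 : 3 ≤ n + 2 → R 1 + 2 ≤ R 3 := fun hn3 =>
        hL.add_two_le_third hR he (hB' (by omega)) hn3 (h13 hn3)
      exact isLatticeWithGoodBONG_of_no_succ (n := n + 1) hπ h2 hL hR
        (hL.ordGE_polar_succ he he1 hR (fun _ => by omega))
        (hL.not_ordEq_succ hR he (fun h => h3 (by omega)) hmax)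
        (fun h => h3 (by omega)) (by simp) (fun i hi _ => Function.update_of_ne (by omega) _ _)
  · intro hn h12 hmax
    obtain ⟨n, rfl⟩ := Nat.exists_eq_add_of_le' hn
    have h12' : R 1 - 2 * e < R 2 := by omega
    have hbin := binaryMaximal_of_isMaximalPair hπ he
      (fun i hi hi2 => hR i hi (by omega)) hmax
    refine ⟨?_, fun η hη hsymb => ?_⟩
    · have hR1 : OrdEq O (R 1) (a 1) := hR 1 le_rfl (by omega)
      obtain ⟨α, β, hα, h⟩ := hbin.exists_ordEq_succ hπ he hR1 (hR 2 (by omega) (by omega)) h12'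
      exact exists_hilbertSymbol_eq_one hπ hR1 hα h
    · rcases hB' (by omega) with hB | hpar
      · exact hL.isLattice_of_binaryMaximal hR hπ he h12' hB hbin hη hsymb
      -- Under the spinor norm hypothesis a maximal pair does not occur.
      · exact (hL.not_binaryMaximal_of_reflectionParity hR hπ he h12' hpar hbin).elim
  · intro hn h12 h13 k _ hkn hk hkmax
    have hpar : ReflectionParity Q L (R 1) := by
      -- Property B contains property A, which excludes R 1 = R 3, so only the spinor norm
      -- hypothesis remains.
      refine (hB' (by omega)).resolve_left fun hB => ?_
      have : R 1 < R 3 := hB.1 1 le_rfl (by omega)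
      omega
    have hodd : ∀ j ≤ k, R (2 * j + 1) = R 1 := fun j hj =>
      le_antisymm (hk ▸ hL.le_odd hR hj hkn) (hL.le_odd hR (Nat.zero_le j) (by omega))
    have hlt : 2 * k + 3 ≤ n → R 1 < R (2 * k + 3) := fun hn3 =>
      lt_of_le_of_ne (hL.le_odd hR (Nat.zero_le (k + 1)) hn3) fun heq => by
        have := hkmax (k + 1) hn3 heq
        omega
    rw [prod_Icc_one_eq_prod_range]
    refine ⟨hL.exists_prod_eq hR hπ he k hkn hodd, fun ε hε ht => ?_⟩
    obtain ⟨h1, M, hM, h3⟩ := HasGoodBONG.alternating hπ he hε k hL hR hpar hkn hodd hlt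
      (fun _ => by omega) ht
    refine ⟨h1, M, hM, h3.congr fun i _ _ => ?_⟩
    by_cases h4 : Odd i <;> simp [alternatingValues, h4]
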